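/- **Theorem (Triviality).** Let $0<\alpha_1<\alpha_2<\cdots<1$ and put $\mathbb N_*=\{1,2,\dots\}$, $\overline{\mathbb N}_*=\mathbb N_*\cup\{\infty\}$, $c_k=\alpha_k/\Gamma(1-\alpha_k/\alpha_{k+1})$. On a probability space let the following be mutually independent: for every $k\ge1$ and $v\in\mathbb N_*^{k-1}$, the marks $\gamma_k(v1)>\gamma_k(v2)>\cdots>0$ of a Poisson point process on $(0,\infty)$ with intensity $c_k t^{-1-\alpha_k}\,dt$; for every $k,x\in\mathbb N_*$, a Poisson process $N^{k,x}$ of rate $1$ with marks $0<\sigma^{k,x}_1<\sigma^{k,x}_2<\cdots$; for every $k,x,i\in\mathbb N_*$, an exponential random variable $T^{k,x}_i$ of mean $1$. Define recursively $X_0\equiv\emptyset$ and, for $k\ge1$ and $t\ge0$, $$\Xi_k(t)=\sum_{x\in\mathbb N_*}\sum_{i=1}^{N^{k,x}(t)}\gamma_k\big(X_{k-1}(\sigma^{k,x}_i)\,x\big)\,T^{k,x}_i ,\qquad \Xi_k^{-1}(t)=\inf\{r\ge0:\Xi_k(r)>t\},$$ and $X_k(t)=(X_{k-1}(\Xi_k^{-1}(t)),x)\in\overline{\mathbb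 N}_*^k$ if $t\in\bigcup_i[\Xi_k(\sigma^{k,x}_i-),\Xi_k(\sigma^{k,x}_i))$ for some $x\in\mathbb N_*$, and $X_k(t)=(X_{k-1}(\Xi_k^{-1}(t)),\infty)$ if there is no such $x$ (almost surely $X_{k-1}(\sigma_i^{k,x})\in\mathbb N_*^{k-1}$ for all $k,x,i$, so that $\Xi_k$ is well defined). For $v\in\mathbb N_*^k$, where $y|_j$ denotes the first $j$ coordinates of $y$, let $$W(v)=\lim_{n\to\infty}\ \sum_{y\in\mathbb N_*^n:\ y|_k=v}\ \Big(\prod_{j=k+1}^n\gamma_j(y|_j)\Big)^{\alpha_{n+1}}$$ (the limit exists almost surely), and for $n\ge k\ge1$ let $$\widetilde\Xi_n(t)=\sum_{x\in\mathbb N_*}\sum_{i=1}^{N^{n,x}(t)}W\big(X_{n-1}(\sigma^{n,x}_i)x\big)\,\gamma_n\big(X_{n-1}(\sigma^{n,x}_i)x\big)\,T^{n,x}_i,\qquad \widetilde\theta_k^n=\widetilde\Xi_n\circ\Xi_{n-1}\circ\cdots\circ\Xi_k .$$ Call a process $\theta$ on $[0,\infty)$ a limit clock $\theta_k^\infty$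 if almost surely it is finite, nondecreasing and right-continuous, and there is a deterministic countable dense set $D_k\subset[0,\infty)$ such that, for every $t\in D_k$, almost surely $\widetilde\theta_k^n(t)\to\theta(t)$ as $n\to\infty$. Suppose that $$\sum_{k=1}^\infty(1-\alpha_k)<\infty\qquad\text{and}\qquad\sum_{k=1}^\infty\frac{1-\alpha_{k+1}}{1-\alpha_k}=\infty .$$ Then, for every $k\ge1$, the limit clock $\theta_k^\infty$ exists, being given by $\theta_k^\infty(t)=\inf_{s>t}\limsup_{n\to\infty}\widetilde\theta_k^n(s)$, and every version of it satisfies $\theta_k^\infty(t)=0$ almost surely for every $t\ge0$. -/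

import Mathlib

open MeasureTheory ProbabilityTheory Filter Set
open scoped ENNReal NNReal Topology

noncomputable section

namespace KTree

/-! ### Indexing

Levels are numbered from `0`: the level called `k` here is the level `k + 1` in the usual `1`-based
numbering. So `α k`, `Ξ k`, `σ k`, `T k` below stand for `α_{k+1}`, `Ξ_{k+1}`, `σ^{k+1}`, `T^{k+1}`.
The only exception is the number of levels in `X k`, which is `k` (and `X 0` is constantly the root).
The children of each vertex of the tree are labelled by `ℕ` instead of `{1, 2, …}`, and a vertex at
depth `k` is the list of length `k` of the labels met on the way from the root, first label first. -/

/-- The number of indices `i` for which the random point `ξ i` falls into `B`. -/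
def pointCount {Ω : Type*} (ξ : ℕ → Ω → ℝ) (B : Set ℝ) (ω : Ω) : ℕ∞ :=
  Set.encard {i | ξ i ω ∈ B}

/-- The random points `ξ 0, ξ 1, …` are the marks of a Poisson point process on the real line with
intensity measure `μ`: the number of points in a Borel set of finite intensity is Poisson
distributed, and the numbers of points in disjoint Borel sets are independent. -/
structure IsPoissonPointProcess {Ω : Type*} [MeasurableSpace Ω] (ξ : ℕ → Ω → ℝ) (μ : Measure ℝ)
    (P : Measure Ω) : Prop where
  measurable : ∀ i, Measurable (ξ i)
  count : ∀ B : Set ℝ, MeasurableSet B → μ B ≠ ∞ →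
    ∀ n : ℕ, P {ω | pointCount ξ B ω = n} = poissonMeasure (μ B).toNNReal {n}
  indep : ∀ (m : ℕ) (B : Fin m → Set ℝ), (∀ j, MeasurableSet (B j)) →
    Pairwise (Function.onFun Disjoint B) → iIndepFun (fun j => pointCount ξ (B j)) P

/-- The constant `c_k = α_k / Γ(1 - α_k / α_{k+1})`. -/
def intensityConst (α : ℕ → ℝ) (k : ℕ) : ℝ :=
  α k / Real.Gamma (1 - α k / α (k + 1))

/-- The measure `μ_k(dt) = c_k t^{-(1 + α_k)} dt` on `(0, ∞)`. -/
def intensity (α : ℕ → ℝ) (k : ℕ) : Measure ℝ :=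
  (volume.restrict (Ioi 0)).withDensity
    fun t => ENNReal.ofReal (intensityConst α k / t ^ (1 + α k))

/-- The raw random data of the construction.
* `γ v x` is the parameter of the vertex `v ++ [x]`, the child of `v` with label `x`;
* `σ k x i` is the `i`-th mark of the Poisson process `N^{k,x}`;
* `T k x i` is the exponential random variable attached to that mark. -/
structure Data (Ω : Type*) where
  γ : List ℕ → ℕ → Ω → ℝ
  σ : ℕ → ℕ → ℕ → Ω → ℝ
  T : ℕ → ℕ → ℕ → Ω → ℝ

/-- Names of the independent sources of randomness: the point process of parameters of the children
of the vertex `v`, the Poisson process `N^{k,x}`, and the variable `T^{k,x}_i`. -/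
inductive Source where
  | env (v : List ℕ)
  | marks (k x : ℕ)
  | hold (k x i : ℕ)

namespace Data

variable {Ω : Type*} (D : Data Ω)

/-- The σ-algebra generated by a source of randomness. -/
@[reducible] def sourceAlgebra : Source → MeasurableSpace Ω
  | .env v => MeasurableSpace.comap (fun ω x => D.γ v x ω) inferInstance
  | .marks k x => MeasurableSpace.comap (fun ω i => D.σ k x i ω) inferInstance
  | .hold k x i => MeasurableSpace.comap (D.T k x i) inferInstance

/-- The joint law of the data: the parameters of the children of `v` are the marks, in decreasing
order, of a Poisson point process with intensity `μ_k`, where `k` is the level of these children;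
`N^{k,x}` is a Poisson process on `(0, ∞)` of rate `1` with marks in increasing order; `T^{k,x}_i`
is exponential of mean `1`; all of these are mutually independent. -/
structure IsGREM [MeasurableSpace Ω] (α : ℕ → ℝ) (P : Measure Ω) : Prop where
  poisson_γ : ∀ v, IsPoissonPointProcess (D.γ v) (intensity α v.length) P
  strictAnti_γ : ∀ v, ∀ᵐ ω ∂P, StrictAnti fun x => D.γ v x ω
  poisson_σ : ∀ k x, IsPoissonPointProcess (D.σ k x) (volume.restrict (Ioi 0)) P
  strictMono_σ : ∀ k x, ∀ᵐ ω ∂P, StrictMono fun i => D.σ k x i ω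
  measurable_T : ∀ k x i, Measurable (D.T k x i)
  law_T : ∀ k x i, P.map (D.T k x i) = expMeasure 1
  indep : iIndep D.sourceAlgebra P

/-- The parameter `γ` of the child `x` of `v`, as an extended nonnegative real. -/
def g (ω : Ω) (v : List ℕ) (x : ℕ) : ℝ≥0∞ := ENNReal.ofReal (D.γ v x ω)

/-- The product of the parameters along the path which starts in `v` and follows the labels `w`,
the parameter of `v` itself not included: `γ̄(v w) / γ̄(v)`. -/
def pathProd (ω : Ω) : List ℕ → List ℕ → ℝ≥0∞
  | _, [] => 1
  | v, x :: w => D.g ω v x * pathProd ω (v ++ [x]) w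

/-- `W(v) = lim_n ∑_y (γ̄(y) / γ̄(v))^{α_{n+1}}`, the sum running over the descendants `y = v w` of `v`
at depth `n = |v| + m`. The limit exists almost surely; elsewhere it is read as a `limsup`. -/
def W (α : ℕ → ℝ) (ω : Ω) (v : List ℕ) : ℝ≥0∞ :=
  limsup (fun m : ℕ => ∑' w : List.Vector ℕ m, D.pathProd ω v w.toList ^ α (v.length + m)) atTop

end Data

/-- Weights of vertices, extended to the states which have an infinite coordinate (almost surely such
states are never met in the sums below). -/
def extendWeight (g : List ℕ → ℕ → ℝ≥0∞) (s : List ℕ∞) (x : ℕ) : ℝ≥0∞ :=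
  open Classical in if ⊤ ∈ s then 0 else g (s.map ENat.toNat) x

/-- `t ↦ ∑_x ∑_{i : σ^x_i ≤ t} g(X(σ^x_i) x) T^x_i`, with time running through `[0, ∞]`. -/
def clockOf (g : List ℕ → ℕ → ℝ≥0∞) (σ T : ℕ → ℕ → ℝ) (X : ℝ≥0∞ → List ℕ∞) (t : ℝ≥0∞) : ℝ≥0∞ :=
  ∑' x : ℕ, ∑' i : ℕ,
    if ENNReal.ofReal (σ x i) ≤ t then
      extendWeight g (X (ENNReal.ofReal (σ x i))) x * ENNReal.ofReal (T x i)
    else 0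

/-- The generalized inverse `t ↦ inf {r | Ξ r > t}`. -/
def genInverse (Ξ : ℝ≥0∞ → ℝ≥0∞) (t : ℝ≥0∞) : ℝ≥0∞ := sInf {r | t < Ξ r}

/-- The label `x` for which `t` lies in some interval `[Ξ(σ^x_i -), Ξ(σ^x_i))`, and `∞` if there is
none. -/
def lastCoord (Ξ : ℝ≥0∞ → ℝ≥0∞) (σ : ℕ → ℕ → ℝ) (t : ℝ≥0∞) : ℕ∞ :=
  ⨅ x ∈ {x : ℕ | ∃ i : ℕ, t ∈ Ico (Function.leftLim Ξ (ENNReal.ofReal (σ x i)))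
    (Ξ (ENNReal.ofReal (σ x i)))}, (x : ℕ∞)

namespace Data

variable {Ω : Type*} (D : Data Ω)

/-- The K process with `k` levels. -/
def X (ω : Ω) : ℕ → ℝ≥0∞ → List ℕ∞
  | 0, _ => []
  | k + 1, t =>
    let Ξ := clockOf (D.g ω) (fun x i => D.σ k x i ω) (fun x i => D.T k x i ω) (X ω k)
    X ω k (genInverse Ξ t) ++ [lastCoord Ξ (fun x i => D.σ k x i ω) t]

/-- The clock process `Ξ` of a level, driven by the K process on the preceding levels. -/
def Ξ (ω : Ω) (k : ℕ) : ℝ≥0∞ → ℝ≥0∞ :=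
  clockOf (D.g ω) (fun x i => D.σ k x i ω) (fun x i => D.T k x i ω) (D.X ω k)

/-- The adjusted clock process `Ξ̃`, in which each parameter is multiplied by the `W` of its
vertex. -/
def adjustedΞ (α : ℕ → ℝ) (ω : Ω) (k : ℕ) : ℝ≥0∞ → ℝ≥0∞ :=
  clockOf (fun v x => D.W α ω (v ++ [x]) * D.g ω v x)
    (fun x i => D.σ k x i ω) (fun x i => D.T k x i ω) (D.X ω k)

/-- The composition `Ξ_{k+m-1} ∘ ⋯ ∘ Ξ_k` of `m` successive clocks. -/
def clockComp (ω : Ω) (k : ℕ) : ℕ → ℝ≥0∞ → ℝ≥0∞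
  | 0 => id
  | m + 1 => D.Ξ ω (k + m) ∘ clockComp ω k m

/-- The adjusted clock composition `θ̃_k^{k+m} = Ξ̃_{k+m} ∘ Ξ_{k+m-1} ∘ ⋯ ∘ Ξ_k`. -/
def adjustedθ (α : ℕ → ℝ) (ω : Ω) (k m : ℕ) : ℝ≥0∞ → ℝ≥0∞ :=
  D.adjustedΞ α ω (k + m) ∘ D.clockComp ω k m

/-- `θ` is the limit of the adjusted clocks that start at level `k`: almost surely finite,
nondecreasing and right continuous, and, for every `t` in some deterministic countable dense set of
times, almost surely the limit of `θ̃_k^n(t)` as `n → ∞`. -/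
def IsLimitClock [MeasurableSpace Ω] (α : ℕ → ℝ) (P : Measure Ω) (k : ℕ)
    (θ : Ω → ℝ≥0 → ℝ≥0∞) : Prop :=
  (∀ᵐ ω ∂P, (∀ t, θ ω t ≠ ∞) ∧ Monotone (θ ω) ∧
      ∀ t, ContinuousWithinAt (θ ω) (Ici t) t) ∧
    ∃ S : Set ℝ≥0, S.Countable ∧ Dense S ∧
      ∀ t ∈ S, ∀ᵐ ω ∂P, Tendsto (fun m => D.adjustedθ α ω k m t) atTop (𝓝 (θ ω t))

/-- The limit clock `θ_k^∞`: the right-continuous version of the limit of `θ̃_k^n` as `n → ∞`. -/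
def limitθ (α : ℕ → ℝ) (k : ℕ) (ω : Ω) (t : ℝ≥0) : ℝ≥0∞ :=
  ⨅ (s : ℝ≥0) (_ : t < s), limsup (fun m => D.adjustedθ α ω k m s) atTop

end Data

end KTree

end

/-! The clocks are tested through Laplace transforms: the adjusted clocks at a fixed time converge
almost surely, and the expectation of their `expNeg` tends to 1, so the limit is 0.

One level: given all parameters and the earlier levels, the marks and holding variables of level `n`
integrate out explicitly, and the Laplace transform of a clock with weights `w` becomes the
exponential of minus the integral of `∑ x, w / (1 + w)` along the path of the K process
(`setLIntegral_expNeg_clockOf`). By the occupation formula (`occupation_eq`, `occupation_le`), an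
integral of `h` along the path with one more level is the preceding clock with its parameters
multiplied by `h`. Averaging over level `n + 1` thus yields a clock of level `n` with weights
`nextRate`. Iterated down to the root, this bounds the Laplace transform of the adjusted clock at
time `t` below by that of `t * R`, where `R` is the quenched rate `backRate` of the root started
from `W` (`lintegral_backRate_le`). As `frac u ≤ u` and `∑ x, W(vx) γ(vx) ≤ W(v)` (`ae_tsum_W_le`),
the same computation makes `expNeg` of the adjusted clocks a bounded submartingale, whence the
almost sure convergence.

The rates: if the rates of the children have Laplace exponent at most `F`, that of the parent is at
most both `l ^ α_k * Λ F` and `l * Λ F`, where `Λ F` is the integral of `1 - e^{-F}` against the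
intensity. The constants `c_k` make `Λ` equal to 1 at `t ^ α_{k+1}`; replacing this function by its
minimum with `t` loses at least a fixed multiple of `(1 - α_{k+1}) / (1 - α_k)`. Bounds of the form
`β ^ α_k * min l (l ^ α_k)` reproduce themselves, `1 / β` growing at each level by a multiple of
that ratio (`levelExponent_minRpow_le`, `le_lintegral_expNeg_backRate_W`). The series of ratios
diverges, so `β` tends to 0 and the exponents vanish in the limit.

Other starting levels: the clocks started at level `k` at time `t` are dominated by those started at
level 0 at time `r`, once the first `k` clocks send `r` beyond `t`. Such an `r` exists because these
clocks are unbounded (`ae_iSup_clockComp`); this uses equality in the occupation formula, hence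
their finiteness (`ae_clockComp_ne_top`). -/

namespace KTree

/-! ### The function `x ↦ e^{-x}` on `[0, ∞]` -/

/-- `e^{-x}` for `x ∈ [0, ∞]`. -/
noncomputable def expNeg (x : ℝ≥0∞) : ℝ≥0∞ := (EReal.exp x)⁻¹

/-- `-log y` for `y ∈ [0, 1]`. -/
noncomputable def negLog (y : ℝ≥0∞) : ℝ≥0∞ := (-(ENNReal.log y)).toENNReal

@[simp] lemma expNeg_zero : expNeg 0 = 1 := by simp [expNeg]

@[simp] lemma expNeg_top : expNeg ∞ = 0 := by simp [expNeg]

lemma expNeg_add (x y : ℝ≥0∞) : expNeg (x + y) = expNeg x * expNeg y := by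
  unfold expNeg
  rw [EReal.coe_ennreal_add, EReal.exp_add, ENNReal.mul_inv]
  · left; simp [EReal.exp_eq_zero_iff]
  · right; simp [EReal.exp_eq_zero_iff]

lemma expNeg_ofReal {x : ℝ} (hx : 0 ≤ x) :
    expNeg (ENNReal.ofReal x) = ENNReal.ofReal (Real.exp (-x)) := by
  unfold expNeg
  rw [EReal.coe_ennreal_ofReal, max_eq_left hx, EReal.exp_coe, Real.exp_neg,
    ENNReal.ofReal_inv_of_pos (Real.exp_pos x)]

lemma strictAnti_expNeg : StrictAnti expNeg := by
  intro x y h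
  unfold expNeg
  rw [ENNReal.inv_lt_inv]
  exact EReal.exp_strictMono (EReal.coe_ennreal_strictMono h)

lemma antitone_expNeg : Antitone expNeg := strictAnti_expNeg.antitone

lemma expNeg_injective : Function.Injective expNeg := strictAnti_expNeg.injective

lemma continuous_expNeg : Continuous expNeg :=
  (ENNReal.continuous_exp.comp continuous_coe_ennreal_ereal).inv

lemma measurable_expNeg : Measurable expNeg := continuous_expNeg.measurable

lemma expNeg_le_one (x : ℝ≥0∞) : expNeg x ≤ 1 := by
  rw [← expNeg_zero]; exact antitone_expNeg zero_le

lemma expNeg_ne_top (x : ℝ≥0∞) : expNeg x ≠ ∞ := ne_top_of_le_ne_top ENNReal.one_ne_top (expNeg_le_one x)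

@[simp] lemma expNeg_eq_zero {x : ℝ≥0∞} : expNeg x = 0 ↔ x = ∞ :=
  ⟨fun h => expNeg_injective (by simpa using h), fun h => by simp [h]⟩

lemma expNeg_negLog {y : ℝ≥0∞} (hy : y ≤ 1) : expNeg (negLog y) = y := by
  unfold expNeg negLog
  rw [EReal.coe_toENNReal, EReal.exp_neg, ENNReal.exp_log, inv_inv]
  rw [EReal.neg_nonneg]; simpa using hy

lemma negLog_expNeg (x : ℝ≥0∞) : negLog (expNeg x) = x :=
  expNeg_injective (expNeg_negLog (expNeg_le_one x))

lemma measurable_negLog : Measurable negLog :=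
  (ENNReal.measurable_log.neg).ereal_toENNReal

lemma expNeg_finsetSum {ι : Type*} (s : Finset ι) (f : ι → ℝ≥0∞) :
    expNeg (∑ i ∈ s, f i) = ∏ i ∈ s, expNeg (f i) := by
  classical
  induction s using Finset.induction_on with
  | empty => simp
  | insert a s ha ih => rw [Finset.sum_insert ha, Finset.prod_insert ha, expNeg_add, ih]

lemma expNeg_nsmul (n : ℕ) (x : ℝ≥0∞) : expNeg (n * x) = expNeg x ^ n := by
  have := expNeg_finsetSum (Finset.range n) (fun _ => x)
  simpa using this

lemma tendsto_prod_expNeg {ι : Type*} (f : ι → ℝ≥0∞) :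
    Tendsto (fun s : Finset ι => ∏ i ∈ s, expNeg (f i)) atTop (𝓝 (expNeg (∑' i, f i))) := by
  simp_rw [← expNeg_finsetSum]
  exact (continuous_expNeg.tendsto _).comp ENNReal.summable.hasSum

lemma one_sub_expNeg_le (x : ℝ≥0∞) : 1 - expNeg x ≤ x := by
  induction x with
  | top => simp
  | coe x =>
    rw [← ENNReal.ofReal_coe_nnreal, expNeg_ofReal (NNReal.coe_nonneg x), ← ENNReal.ofReal_one,
      ← ENNReal.ofReal_sub _ (Real.exp_pos _).le]
    apply ENNReal.ofReal_le_ofReal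
    have := Real.add_one_le_exp (-(x:ℝ))
    linarith

lemma one_sub_one_sub_expNeg (x : ℝ≥0∞) : 1 - (1 - expNeg x) = expNeg x :=
  ENNReal.sub_sub_cancel ENNReal.one_ne_top (expNeg_le_one x)

lemma lintegral_expNeg_le_one {Ω : Type*} [MeasurableSpace Ω] (P : Measure Ω)
    [IsProbabilityMeasure P] (f : Ω → ℝ≥0∞) : ∫⁻ ω, expNeg (f ω) ∂P ≤ 1 :=
  (lintegral_mono fun _ => expNeg_le_one _).trans (by simp)

/-! ### Independence -/

lemma lintegral_indepFun {Ω E F : Type*} [MeasurableSpace Ω] [MeasurableSpace E]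
    [MeasurableSpace F] {P : Measure Ω} [IsProbabilityMeasure P] {X : Ω → E} {Y : Ω → F}
    (hX : Measurable X) (hY : Measurable Y) (h : IndepFun X Y P) {H : E × F → ℝ≥0∞}
    (hH : Measurable H) :
    ∫⁻ ω, H (X ω, Y ω) ∂P = ∫⁻ ω, ∫⁻ ω', H (X ω, Y ω') ∂P ∂P := by
  have hmap := (indepFun_iff_map_prod_eq_prod_map_map hX.aemeasurable hY.aemeasurable).1 h
  have := Measure.isProbabilityMeasure_map (μ := P) hX.aemeasurable
  have := Measure.isProbabilityMeasure_map (μ := P) hY.aemeasurable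
  rw [← lintegral_map hH (hX.prodMk hY), hmap, lintegral_prod _ hH.aemeasurable,
    lintegral_map hH.lintegral_prod_right' hX]
  exact lintegral_congr fun ω => lintegral_map (hH.comp measurable_prodMk_left) hY

/-- Integration over the diagonal for two independent σ-algebras. -/
lemma lintegral_diag_of_indep {Ω : Type*} {m₁ m₂ m0 : MeasurableSpace Ω} {P : Measure Ω}
    [IsProbabilityMeasure P] (h₁ : m₁ ≤ m0) (h₂ : m₂ ≤ m0) (h : Indep m₁ m₂ P)
    {H : Ω × Ω → ℝ≥0∞} (hH : Measurable[m₁.prod m₂] H) :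
    ∫⁻ ω, H (ω, ω) ∂P = ∫⁻ ω, ∫⁻ ω', H (ω, ω') ∂P ∂P := by
  -- The two σ-algebras are independent exactly when the identity, read as a map into `(Ω, m₁)` and
  -- into `(Ω, m₂)`, gives two independent variables; the diagonal then carries the product law.
  have hI : @IndepFun Ω Ω Ω m0 m₁ m₂ id id P := by
    rw [@IndepFun_iff_Indep Ω Ω Ω m0 m₁ m₂]; simpa [MeasurableSpace.comap_id] using h
  exact @lintegral_indepFun Ω Ω Ω m0 m₁ m₂ P _ id id (measurable_id'' h₁) (measurable_id'' h₂)
    hI H hH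

/-- A property which holds almost surely in the second variable, for every value of the first,
holds almost surely on the diagonal. -/
lemma ae_diag_of_indep {Ω : Type*} {m₁ m₂ m0 : MeasurableSpace Ω} {P : Measure Ω}
    [IsProbabilityMeasure P] (h₁ : m₁ ≤ m0) (h₂ : m₂ ≤ m0) (h : Indep m₁ m₂ P)
    {S : Set (Ω × Ω)} (hS : MeasurableSet[m₁.prod m₂] S)
    (hae : ∀ ω, ∀ᵐ ω' ∂P, (ω, ω') ∈ S) : ∀ᵐ ω ∂P, (ω, ω) ∈ S := by
  have hm : Measurable[m₁.prod m₂] (Sᶜ.indicator (fun _ => (1 : ℝ≥0∞))) :=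
    Measurable.indicator measurable_const hS.compl
  have key := lintegral_diag_of_indep h₁ h₂ h hm
  have hz : ∀ ω, ∫⁻ ω', Sᶜ.indicator (fun _ => (1 : ℝ≥0∞)) (ω, ω') ∂P = 0 := by
    intro ω
    rw [← lintegral_zero (μ := P)]
    refine lintegral_congr_ae ?_
    filter_upwards [hae ω] with ω' h'
    simp [h']
  simp only [hz, lintegral_zero] at key
  have hm' : @Measurable Ω (Ω × Ω) m0 (m₁.prod m₂) (fun ω => (ω, ω)) :=
    @Measurable.prodMk _ m0 _ _ m₁ m₂ _ _ (measurable_id'' h₁) (measurable_id'' h₂)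
  have hc : Measurable fun ω => Sᶜ.indicator (fun _ => (1 : ℝ≥0∞)) (ω, ω) := hm.comp hm'
  rw [lintegral_eq_zero_iff hc] at key
  filter_upwards [key] with ω hω
  by_contra hn
  simp [hn] at hω

/-- Expectations of products of functions of disjoint blocks of independent σ-algebras. -/
lemma lintegral_prod_of_blocks {Ω ι κ : Type*} {m0 : MeasurableSpace Ω} {P : Measure Ω}
    [IsProbabilityMeasure P] {m : ι → MeasurableSpace Ω} (hle : ∀ i, m i ≤ m0) (hi : iIndep m P)
    {B : κ → Set ι} (hB : Pairwise (Function.onFun Disjoint B)) {Y : κ → Ω → ℝ≥0∞}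
    (hY : ∀ k, Measurable[⨆ i ∈ B k, m i] (Y k)) (s : Finset κ) :
    ∫⁻ ω, ∏ k ∈ s, Y k ω ∂P = ∏ k ∈ s, ∫⁻ ω, Y k ω ∂P := by
  classical
  induction s using Finset.induction_on with
  | empty => simp
  | insert a s ha ih =>
    simp_rw [Finset.prod_insert ha]
    rw [← ih]
    have hd : Disjoint (B a) (⋃ k ∈ s, B k) := by
      rw [disjoint_iUnion₂_right]
      exact fun k hk => hB (by rintro rfl; exact ha hk)
    refine lintegral_mul_eq_lintegral_mul_lintegral_of_independent_measurableSpace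
      (iSup₂_le fun i _ => hle i) (iSup₂_le fun i _ => hle i)
      (indep_iSup_of_disjoint hle hi hd) (hY a) ?_
    refine Finset.measurable_fun_prod s fun k hk => (hY k).mono ?_ le_rfl
    exact iSup₂_le fun i hik => le_iSup₂_of_le i (mem_biUnion hk hik) le_rfl

/-- The Laplace transform of a sum of functions of disjoint blocks of independent σ-algebras. -/
lemma lintegral_expNeg_tsum {Ω ι κ : Type*} [Countable κ] {m0 : MeasurableSpace Ω} {P : Measure Ω}
    [IsProbabilityMeasure P] {m : ι → MeasurableSpace Ω} (hle : ∀ i, m i ≤ m0) (hi : iIndep m P)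
    {B : κ → Set ι} (hB : Pairwise (Function.onFun Disjoint B)) {Y : κ → Ω → ℝ≥0∞}
    (hY : ∀ k, Measurable[⨆ i ∈ B k, m i] (Y k)) :
    ∫⁻ ω, expNeg (∑' k, Y k ω) ∂P = expNeg (∑' k, negLog (∫⁻ ω, expNeg (Y k ω) ∂P)) := by
  have hYm : ∀ k, Measurable (Y k) := fun k => (hY k).mono (iSup₂_le fun i _ => hle i) le_rfl
  have h1 : Tendsto (fun s : Finset κ => ∫⁻ ω, ∏ k ∈ s, expNeg (Y k ω) ∂P) atTop
      (𝓝 (∫⁻ ω, expNeg (∑' k, Y k ω) ∂P)) := by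
    refine tendsto_lintegral_filter_of_dominated_convergence (fun _ => 1) ?_ ?_ (by simp) ?_
    · exact Eventually.of_forall fun s => Finset.measurable_fun_prod s
        fun k _ => measurable_expNeg.comp (hYm k)
    · exact Eventually.of_forall fun s => ae_of_all _ fun ω =>
        Finset.prod_le_one' fun k _ => expNeg_le_one _
    · exact ae_of_all _ fun ω => tendsto_prod_expNeg _
  have h2 := tendsto_prod_expNeg fun k => negLog (∫⁻ ω, expNeg (Y k ω) ∂P)
  refine tendsto_nhds_unique h1 (h2.congr fun s => ?_)
  rw [lintegral_prod_of_blocks hle hi hB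
    (Y := fun k ω => expNeg (Y k ω)) (fun k => measurable_expNeg.comp (hY k))]
  exact Finset.prod_congr rfl fun k _ => expNeg_negLog (lintegral_expNeg_le_one P _)

/-! ### Convergence of bounded submartingales -/

/-- Only `expNeg (Y n)` is a submartingale; `Y n` itself may be infinite or not integrable.
Boundedness by 1 gives convergence, and the continuous left inverse `negLog` brings it back to `Y
n`. -/
lemma ae_exists_tendsto_of_submartingale {Ω : Type*} [m0 : MeasurableSpace Ω] {P : Measure Ω}
    [IsProbabilityMeasure P] {ℱ : ℕ → MeasurableSpace Ω} (hmono : Monotone ℱ)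
    (hle : ∀ n, ℱ n ≤ m0) {Y : ℕ → Ω → ℝ≥0∞} (hY : ∀ n, Measurable[ℱ n] (Y n))
    (hsub : ∀ n, ∀ A, MeasurableSet[ℱ n] A →
      ∫⁻ ω in A, expNeg (Y n ω) ∂P ≤ ∫⁻ ω in A, expNeg (Y (n + 1) ω) ∂P) :
    ∀ᵐ ω ∂P, ∃ y, Tendsto (fun n => Y n ω) atTop (𝓝 y) := by
  let 𝒢 : Filtration ℕ m0 := ⟨ℱ, hmono, hle⟩
  have hm : ∀ n, Measurable[ℱ n] fun ω => (expNeg (Y n ω)).toReal :=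
    fun n => (measurable_expNeg.comp (hY n)).ennreal_toReal
  have hb : ∀ n ω, ‖(expNeg (Y n ω)).toReal‖ ≤ 1 := by
    intro n ω
    rw [Real.norm_of_nonneg ENNReal.toReal_nonneg]
    exact ENNReal.toReal_le_of_le_ofReal zero_le_one (by simpa using expNeg_le_one _)
  have hint : ∀ n, Integrable (fun ω => (expNeg (Y n ω)).toReal) P := fun n =>
    Integrable.of_bound ((hm n).mono (hle n) le_rfl).aestronglyMeasurable 1 (ae_of_all _ (hb n))
  have hs : Submartingale (fun n ω => (expNeg (Y n ω)).toReal) 𝒢 P := by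
    refine submartingale_of_setIntegral_le_succ (fun n => (hm n).stronglyMeasurable) hint ?_
    intro n A hA
    have hmm : ∀ i, AEMeasurable (fun ω => expNeg (Y i ω)) (P.restrict A) := fun i =>
      ((measurable_expNeg.comp (hY i)).mono (hle i) le_rfl).aemeasurable
    rw [integral_toReal (hmm n) (ae_of_all _ fun ω => (expNeg_ne_top _).lt_top),
      integral_toReal (hmm (n+1)) (ae_of_all _ fun ω => (expNeg_ne_top _).lt_top)]
    refine ENNReal.toReal_mono ?_ (hsub n A hA)
    refine ne_top_of_le_ne_top (measure_ne_top P A) ?_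
    calc ∫⁻ ω in A, expNeg (Y (n+1) ω) ∂P ≤ ∫⁻ ω in A, 1 ∂P :=
          lintegral_mono fun ω => expNeg_le_one _
      _ = P A := by simp
  have hbd : ∀ n, eLpNorm (fun ω => (expNeg (Y n ω)).toReal) 1 P ≤ (1 : ℝ≥0) := by
    intro n
    refine (eLpNorm_le_of_ae_bound (ae_of_all _ (hb n))).trans (by simp)
  filter_upwards [hs.ae_tendsto_limitProcess hbd] with ω hω'
  obtain ⟨l, hω⟩ : ∃ l, Tendsto (fun n => (expNeg (Y n ω)).toReal) atTop (𝓝 l) := ⟨_, hω'⟩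
  refine ⟨negLog (ENNReal.ofReal l), ?_⟩
  have h1 : Tendsto (fun n => expNeg (Y n ω)) atTop (𝓝 (ENNReal.ofReal l)) := by
    refine (ENNReal.tendsto_ofReal hω).congr fun n => ?_
    exact ENNReal.ofReal_toReal (expNeg_ne_top _)
  have h2 : Tendsto (fun n => negLog (expNeg (Y n ω))) atTop (𝓝 (negLog (ENNReal.ofReal l))) := by
    have hc : Continuous negLog := by
      unfold negLog
      exact EReal.continuous_toENNReal.comp (continuous_neg.comp ENNReal.continuous_log)
    exact (hc.tendsto _).comp h1
  simpa [negLog_expNeg] using h2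

/-! ### The Laplace functional of a Poisson point process -/

lemma toENNReal_pointCount {Ω : Type*} (ξ : ℕ → Ω → ℝ) (B : Set ℝ) (ω : Ω) :
    (pointCount ξ B ω : ℝ≥0∞) = ∑' i, B.indicator (fun _ => 1) (ξ i ω) := by
  unfold pointCount
  rw [← ENNReal.tsum_set_one, tsum_subtype {i | ξ i ω ∈ B} (fun _ => (1 : ℝ≥0∞))]
  rfl

lemma measurable_pointCount {Ω : Type*} [MeasurableSpace Ω] {ξ : ℕ → Ω → ℝ}
    (hξ : ∀ i, Measurable (ξ i)) {B : Set ℝ} (hB : MeasurableSet B) :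
    Measurable (pointCount ξ B) := by
  have h : Measurable fun ω => (pointCount ξ B ω : ℝ≥0∞) := by
    simp_rw [toENNReal_pointCount]
    exact Measurable.tsum fun i => (measurable_const.indicator hB).comp (hξ i)
  refine measurable_to_countable' fun n => ?_
  have : pointCount ξ B ⁻¹' {n} = (fun ω => (pointCount ξ B ω : ℝ≥0∞)) ⁻¹' {(n : ℝ≥0∞)} := by
    ext ω; simp
  rw [this]
  exact h (measurableSet_singleton _)

/-- The exponential series. With `q = 1` it says that the Poisson weights exhaust the mass; with `q
= expNeg a` it gives the Laplace transform of a count. -/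
lemma tsum_poisson_pow (r : ℝ≥0) (q : ℝ≥0∞) (hq : q ≤ 1) :
    ∑' n : ℕ, poissonMeasure r {n} * q ^ n = expNeg (r * (1 - q)) := by
  lift q to ℝ≥0 using ne_top_of_le_ne_top ENNReal.one_ne_top hq
  have hq' : (q : ℝ) ≤ 1 := by exact_mod_cast hq
  have h1 : ((r : ℝ≥0∞) * (1 - q)) = ENNReal.ofReal (r * (1 - q)) := by
    rw [ENNReal.ofReal_mul r.coe_nonneg, ENNReal.ofReal_coe_nnreal, ENNReal.ofReal_sub _ q.coe_nonneg,
      ENNReal.ofReal_coe_nnreal, ENNReal.ofReal_one]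
  rw [h1, expNeg_ofReal (mul_nonneg r.coe_nonneg (by linarith))]
  have h2 : HasSum (fun n : ℕ => Real.exp (-r) * (r * q) ^ n / n.factorial)
      (Real.exp (-(r * (1 - q)))) := by
    have := (NormedSpace.expSeries_div_hasSum_exp ((r : ℝ) * q)).mul_left (Real.exp (-r))
    rw [← Real.exp_eq_exp_ℝ, ← Real.exp_add] at this
    rw [show -((r : ℝ) * (1 - q)) = -r + r * q by ring]
    simpa only [mul_div_assoc] using this
  rw [← h2.tsum_eq, ENNReal.ofReal_tsum_of_nonneg (fun n => by positivity) h2.summable]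
  refine tsum_congr fun n => ?_
  rw [poissonMeasure_singleton, ← ENNReal.ofReal_coe_nnreal, ← ENNReal.ofReal_pow q.coe_nonneg,
    ← ENNReal.ofReal_mul (by positivity)]
  congr 1
  rw [mul_pow]; ring

namespace IsPoissonPointProcess

variable {Ω : Type*} [MeasurableSpace Ω] {P : Measure Ω} {ξ : ℕ → Ω → ℝ}
  {μ : Measure ℝ}

/-- The law of a count is prescribed only at finite values; these probabilities already sum to 1, so
nothing is left for `⊤`. -/
lemma ae_pointCount_ne_top [IsProbabilityMeasure P] (h : IsPoissonPointProcess ξ μ P) {B : Set ℝ}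
    (hB : MeasurableSet B) (hμ : μ B ≠ ∞) : ∀ᵐ ω ∂P, pointCount ξ B ω ≠ ⊤ := by
  have hm := measurable_pointCount h.measurable hB
  have h1 : P (⋃ n : ℕ, {ω | pointCount ξ B ω = n}) = 1 := by
    rw [measure_iUnion]
    · simp_rw [h.count B hB hμ]
      have := tsum_poisson_pow (μ B).toNNReal 1 le_rfl
      simpa using this
    · intro i j hij
      refine Set.disjoint_left.2 fun ω h1 h2 => hij ?_
      simp only [mem_ofPred_eq] at h1 h2
      exact_mod_cast h1.symm.trans h2
    · exact fun n => hm (measurableSet_singleton _)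
  have h2 : MeasurableSet (⋃ n : ℕ, {ω | pointCount ξ B ω = n}) :=
    MeasurableSet.iUnion fun n => hm (measurableSet_singleton _)
  have h3 : ∀ᵐ ω ∂P, ω ∈ ⋃ n : ℕ, {ω | pointCount ξ B ω = n} :=
    (prob_compl_eq_zero_iff h2).2 h1
  filter_upwards [h3] with ω hω
  obtain ⟨n, hn⟩ := mem_iUnion.1 hω
  simp only [mem_ofPred_eq] at hn
  rw [hn]; exact ENat.natCast_ne_top n

lemma lintegral_expNeg_mul_pointCount [IsProbabilityMeasure P] (h : IsPoissonPointProcess ξ μ P)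
    {B : Set ℝ} (hB : MeasurableSet B) (hμ : μ B ≠ ∞) (a : ℝ≥0∞) :
    ∫⁻ ω, expNeg (a * pointCount ξ B ω) ∂P = expNeg ((1 - expNeg a) * μ B) := by
  have hm := measurable_pointCount h.measurable hB
  have h1 : ∀ᵐ ω ∂P, expNeg (a * pointCount ξ B ω)
      = ∑' n : ℕ, {ω | pointCount ξ B ω = n}.indicator (fun _ => expNeg a ^ n) ω := by
    filter_upwards [h.ae_pointCount_ne_top hB hμ] with ω hω
    lift pointCount ξ B ω to ℕ using hω with N hN
    rw [tsum_eq_single N]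
    · simp [← hN, mul_comm a, ← expNeg_nsmul]
    · intro n hn
      simp [← hN, hn.symm]
  have hms : ∀ n : ℕ, MeasurableSet {ω | pointCount ξ B ω = n} :=
    fun n => hm (measurableSet_singleton _)
  rw [lintegral_congr_ae h1, lintegral_tsum fun n =>
    (measurable_const.indicator (hms n)).aemeasurable]
  have h2 : ∀ n : ℕ, ∫⁻ ω, {ω | pointCount ξ B ω = n}.indicator (fun _ => expNeg a ^ n) ω ∂P
      = poissonMeasure (μ B).toNNReal {n} * expNeg a ^ n := by
    intro n
    rw [lintegral_indicator (hms n), setLIntegral_const,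
      h.count B hB hμ, mul_comm]
  simp_rw [h2]
  rw [tsum_poisson_pow _ _ (expNeg_le_one a), ENNReal.coe_toNNReal hμ, mul_comm]

lemma _root_.KTree.tsum_simpleFunc {Ω : Type*} (ξ : ℕ → Ω → ℝ) (s : SimpleFunc ℝ ℝ≥0∞) (ω : Ω) :
    ∑' i, s (ξ i ω) = ∑ a ∈ s.range.filter (· ≠ 0), a * pointCount ξ (s ⁻¹' {a}) ω := by
  have hs : ∀ t, s t = ∑ a ∈ s.range.filter (· ≠ 0), a * (s ⁻¹' {a}).indicator (fun _ => 1) t := by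
    intro t
    by_cases ht : s t = 0
    · rw [ht, eq_comm]
      refine Finset.sum_eq_zero fun a ha => ?_
      have : t ∉ s ⁻¹' {a} := by
        simp only [mem_preimage, mem_singleton_iff, ht]
        exact fun h => (Finset.mem_filter.1 ha).2 h.symm
      simp [this]
    · rw [Finset.sum_eq_single (s t)]
      · simp
      · intro a _ ha
        simp [ha.symm]
      · intro hn
        exact absurd (Finset.mem_filter.2 ⟨s.mem_range_self t, ht⟩) hn
  calc ∑' i, s (ξ i ω) = ∑' i, ∑ a ∈ s.range.filter (· ≠ 0),
        a * (s ⁻¹' {a}).indicator (fun _ => 1) (ξ i ω) := tsum_congr fun i => hs _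
    _ = ∑ a ∈ s.range.filter (· ≠ 0), ∑' i, a * (s ⁻¹' {a}).indicator (fun _ => 1) (ξ i ω) :=
        Summable.tsum_finsetSum fun _ _ => ENNReal.summable
    _ = _ := by
        refine Finset.sum_congr rfl fun a _ => ?_
        rw [ENNReal.tsum_mul_left, toENNReal_pointCount]

/-- The fibres over the nonzero values are finitely many disjoint sets of finite intensity, so their
counts are independent Poisson variables. The fibre over 0 is discarded, since its intensity may be
infinite. -/
lemma lintegral_expNeg_simpleFunc [IsProbabilityMeasure P] (h : IsPoissonPointProcess ξ μ P)
    (s : SimpleFunc ℝ ℝ≥0∞) (hs : ∀ a, a ≠ 0 → μ (s ⁻¹' {a}) ≠ ∞) :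
    ∫⁻ ω, expNeg (∑' i, s (ξ i ω)) ∂P = expNeg (∫⁻ t, (1 - expNeg (s t)) ∂μ) := by
  classical
  set R := s.range.filter (· ≠ 0) with hR
  let e := R.equivFin
  let B : Fin R.card → Set ℝ := fun j => s ⁻¹' {(e.symm j : ℝ≥0∞)}
  have hBm : ∀ j, MeasurableSet (B j) := fun j => s.measurableSet_preimage _
  have hBd : Pairwise (Function.onFun Disjoint B) := by
    intro i j hij
    refine Disjoint.preimage _ ?_
    rw [Set.disjoint_singleton]
    exact fun h => hij (e.symm.injective (Subtype.ext h))
  have hind := h.indep _ B hBm hBd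
  have hmc : ∀ j, Measurable (pointCount ξ (B j)) := fun j =>
    measurable_pointCount h.measurable (hBm j)
  have hsum : ∀ (F : ℝ≥0∞ → ℝ≥0∞), ∑ a ∈ R, F a = ∑' j, F (e.symm j) := by
    intro F
    rw [tsum_fintype, ← Finset.sum_coe_sort R F]
    exact (Equiv.sum_comp e.symm (fun a : R => F a)).symm
  have h1 : ∀ ω, ∑' i, s (ξ i ω) = ∑' j, (e.symm j : ℝ≥0∞) * pointCount ξ (B j) ω := by
    intro ω
    rw [tsum_simpleFunc, hsum]
  simp_rw [h1]
  rw [lintegral_expNeg_tsum (m := fun j => MeasurableSpace.comap (pointCount ξ (B j)) inferInstance)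
    (B := fun j => {j}) (fun j => (hmc j).comap_le) hind
    (fun i j hij => by simpa [Function.onFun] using hij) (fun j => ?_)]
  · congr 1
    have h2 : ∀ j, negLog (∫⁻ ω, expNeg ((e.symm j : ℝ≥0∞) * pointCount ξ (B j) ω) ∂P)
        = (1 - expNeg (e.symm j)) * μ (B j) := by
      intro j
      rw [h.lintegral_expNeg_mul_pointCount (hBm j) (hs _ (Finset.mem_filter.1 (e.symm j).2).2),
        negLog_expNeg]
    simp_rw [h2]
    rw [← hsum fun a => (1 - expNeg a) * μ (s ⁻¹' {a})]
    have h3 : ∀ t, 1 - expNeg (s t) = (s.map fun a => 1 - expNeg a) t := fun t => rfl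
    simp_rw [h3]
    rw [SimpleFunc.lintegral_eq_lintegral, SimpleFunc.map_lintegral]
    refine Finset.sum_subset (Finset.filter_subset _ _) fun a ha hn => ?_
    have : a = 0 := by
      by_contra h0
      exact hn (Finset.mem_filter.2 ⟨ha, h0⟩)
    simp [this]
  · have : Measurable[MeasurableSpace.comap (pointCount ξ (B j)) inferInstance]
        fun ω => (e.symm j : ℝ≥0∞) * pointCount ξ (B j) ω :=
      (Measurable.of_discrete (f := fun n : ℕ∞ => (e.symm j : ℝ≥0∞) * n)).comp
        (comap_measurable _)
    exact this.mono (le_iSup₂_of_le j rfl le_rfl) le_rfl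

/-- The Laplace functional of a Poisson point process. -/
theorem lintegral_expNeg_tsum [IsProbabilityMeasure P] [SigmaFinite μ]
    (h : IsPoissonPointProcess ξ μ P) {G : ℝ → ℝ≥0∞} (hG : Measurable G) :
    ∫⁻ ω, expNeg (∑' i, G (ξ i ω)) ∂P = expNeg (∫⁻ t, (1 - expNeg (G t)) ∂μ) := by
  -- The usual approximations are cut off outside sets of finite intensity, so that nonzero fibres
  -- have finite intensity; they still increase to `G`.
  let s : ℕ → SimpleFunc ℝ ℝ≥0∞ := fun n =>
    (SimpleFunc.eapprox G n).restrict (spanningSets μ n)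
  have hs : ∀ n t, s n t = (spanningSets μ n).indicator (SimpleFunc.eapprox G n) t := fun n t => by
    rw [SimpleFunc.restrict_apply _ (measurableSet_spanningSets μ n)]
  have hmono : ∀ t, Monotone fun n => s n t := by
    intro t i j hij
    simp only [hs]
    exact (indicator_le_indicator_of_subset (monotone_spanningSets μ hij) (fun _ => zero_le) t).trans
      (indicator_le_indicator (SimpleFunc.monotone_eapprox G hij t))
  have hlim : ∀ t, Tendsto (fun n => s n t) atTop (𝓝 (G t)) := by
    intro t
    have h1 : Tendsto (fun n => SimpleFunc.eapprox G n t) atTop (𝓝 (G t)) := by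
      rw [← SimpleFunc.iSup_eapprox_apply hG t]
      exact tendsto_atTop_iSup fun i j hij => SimpleFunc.monotone_eapprox G hij t
    refine h1.congr' ?_
    have : t ∈ ⋃ n, spanningSets μ n := by rw [iUnion_spanningSets]; trivial
    obtain ⟨N, hN⟩ := mem_iUnion.1 this
    filter_upwards [eventually_ge_atTop N] with n hn
    rw [hs, indicator_of_mem (monotone_spanningSets μ hn hN)]
  have hfin : ∀ n a, a ≠ 0 → μ (s n ⁻¹' {a}) ≠ ∞ := by
    intro n a ha
    refine ne_top_of_le_ne_top (measure_spanningSets_lt_top μ n).ne (measure_mono fun t ht => ?_)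
    by_contra hc
    simp only [mem_preimage, hs, indicator_of_notMem hc, mem_singleton_iff] at ht
    exact ha ht.symm
  have hL : Tendsto (fun n => ∫⁻ ω, expNeg (∑' i, s n (ξ i ω)) ∂P) atTop
      (𝓝 (∫⁻ ω, expNeg (∑' i, G (ξ i ω)) ∂P)) := by
    refine tendsto_lintegral_of_dominated_convergence (fun _ => 1) ?_ ?_ (by simp) ?_
    · exact fun n => measurable_expNeg.comp
        (Measurable.tsum fun i => (s n).measurable.comp (h.measurable i))
    · exact fun n => ae_of_all _ fun ω => expNeg_le_one _
    · refine ae_of_all _ fun ω => (continuous_expNeg.tendsto _).comp ?_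
      have := lintegral_tendsto_of_tendsto_of_monotone (μ := Measure.count)
        (f := fun n i => s n (ξ i ω)) (F := fun i => G (ξ i ω))
        (fun n => measurable_from_nat.aemeasurable) (ae_of_all _ fun i => hmono _)
        (ae_of_all _ fun i => hlim _)
      simpa [lintegral_count] using this
  have hR : Tendsto (fun n => expNeg (∫⁻ t, (1 - expNeg (s n t)) ∂μ)) atTop
      (𝓝 (expNeg (∫⁻ t, (1 - expNeg (G t)) ∂μ))) := by
    refine (continuous_expNeg.tendsto _).comp ?_
    refine lintegral_tendsto_of_tendsto_of_monotone
      (fun n => (measurable_const.sub (measurable_expNeg.comp (s n).measurable)).aemeasurable)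
      (ae_of_all _ fun t i j hij => tsub_le_tsub_left (antitone_expNeg (hmono t hij)) _)
      (ae_of_all _ fun t => ?_)
    exact ENNReal.Tendsto.sub tendsto_const_nhds ((continuous_expNeg.tendsto _).comp (hlim t))
      (Or.inl ENNReal.one_ne_top)
  refine tendsto_nhds_unique hL (hR.congr fun n => ?_)
  rw [h.lintegral_expNeg_simpleFunc (s n) (hfin n)]

/-- Almost surely no point lies in a given null set. -/
lemma ae_notMem [IsProbabilityMeasure P] (h : IsPoissonPointProcess ξ μ P) {B : Set ℝ}
    (hB : MeasurableSet B) (hμ : μ B = 0) : ∀ᵐ ω ∂P, ∀ i, ξ i ω ∉ B := by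
  have h0 := h.count B hB (by simp [hμ]) 0
  rw [hμ, poissonMeasure_singleton] at h0
  simp only [ENNReal.toNNReal_zero, NNReal.coe_zero, neg_zero, Real.exp_zero, pow_zero,
    Nat.factorial_zero, Nat.cast_one, mul_one, div_one, ENNReal.ofReal_one, CharP.cast_eq_zero] at h0
  have hm : MeasurableSet {ω | pointCount ξ B ω = 0} :=
    measurable_pointCount h.measurable hB (measurableSet_singleton 0)
  have h3 : ∀ᵐ ω ∂P, ω ∈ {ω | pointCount ξ B ω = 0} := (prob_compl_eq_zero_iff hm).2 h0
  filter_upwards [h3] with ω hω i hi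
  simp only [pointCount, Set.encard_eq_zero] at hω
  exact (Set.eq_empty_iff_forall_notMem.1 hω i) hi

end IsPoissonPointProcess

/-! ### The Laplace transform of one clock -/

/-- There are only countably many states, so the discrete σ-algebra loses nothing and every function
of a state is measurable. -/
instance instMeasurableSpaceListENat : MeasurableSpace (List ℕ∞) := ⊤

instance instDiscreteMeasurableSpaceListENat : DiscreteMeasurableSpace (List ℕ∞) := ⟨fun _ => MeasurableSpace.measurableSet_top⟩

lemma measurable_tsum {Ω ι : Type*} {m : MeasurableSpace Ω} [Countable ι] {f : ι → Ω → ℝ≥0∞}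
    (hf : ∀ i, Measurable (f i)) : Measurable fun ω => ∑' i, f i ω :=
  Measurable.tsum hf

lemma measurable_mul {Ω : Type*} {m : MeasurableSpace Ω} {f g : Ω → ℝ≥0∞}
    (hf : Measurable f) (hg : Measurable g) : Measurable fun ω => f ω * g ω :=
  hf.mul hg

/-- `u / (1 + u)`, with value `1` at infinity. -/
noncomputable def frac (u : ℝ≥0∞) : ℝ≥0∞ := 1 - (1 + u)⁻¹

@[simp] lemma frac_zero : frac 0 = 0 := by simp [frac]

lemma measurable_frac : Measurable frac :=
  Measurable.sub (f := fun _ : ℝ≥0∞ => (1 : ℝ≥0∞)) (g := fun u => (1 + u)⁻¹) measurable_const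
    (measurable_inv.comp (measurable_const_add 1))

lemma lintegral_expNeg_mul_expMeasure (c : ℝ≥0∞) :
    ∫⁻ s, expNeg (c * ENNReal.ofReal s) ∂(expMeasure 1) = (1 + c)⁻¹ := by
  have he : ∀ r, Measurable (exponentialPDF r) := fun r =>
    (measurable_exponentialPDFReal r).ennreal_ofReal
  have hm : ∀ c : ℝ≥0∞, Measurable fun s : ℝ => expNeg (c * ENNReal.ofReal s) := fun c =>
    measurable_expNeg.comp (measurable_const.mul ENNReal.measurable_ofReal)
  have h0 : ∀ c : ℝ≥0∞, ∫⁻ s, expNeg (c * ENNReal.ofReal s) ∂(expMeasure 1)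
      = ∫⁻ s, exponentialPDF 1 s * expNeg (c * ENNReal.ofReal s) := by
    intro c
    have : expMeasure 1 = volume.withDensity (exponentialPDF 1) := rfl
    rw [this, lintegral_withDensity_eq_lintegral_mul _ (he 1) (hm c)]
    rfl
  rw [h0]
  induction c with
  | top =>
    rw [add_top, ENNReal.inv_top, lintegral_eq_zero_iff (measurable_mul (he 1) (hm _))]
    have : ∀ᵐ s : ℝ, s ≠ 0 := by simp [ae_iff]
    filter_upwards [this] with s hs
    rcases lt_or_gt_of_ne hs with h | h
    · simp [exponentialPDF_of_neg h]
    · simp [ENNReal.top_mul, h]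
  | coe c =>
    have hc : (0 : ℝ) < 1 + c := by positivity
    -- Up to the factor `1 / (1 + c)`, the tilted density is the exponential density of rate `1 +
    -- c`, whose integral is 1.
    have h1 : ∀ s : ℝ, exponentialPDF 1 s * expNeg (c * ENNReal.ofReal s)
        = (1 + c : ℝ≥0∞)⁻¹ * exponentialPDF (1 + c) s := by
      intro s
      rcases lt_or_ge s 0 with h | h
      · simp [exponentialPDF_of_neg h]
      · rw [exponentialPDF_of_nonneg h, exponentialPDF_of_nonneg h, ← ENNReal.ofReal_coe_nnreal,
          ← ENNReal.ofReal_mul c.coe_nonneg, expNeg_ofReal (by positivity),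
          ← ENNReal.ofReal_mul (by positivity), ← ENNReal.ofReal_one,
          ← ENNReal.ofReal_add zero_le_one c.coe_nonneg, ← ENNReal.ofReal_inv_of_pos hc,
          ← ENNReal.ofReal_mul (by positivity), ← mul_assoc, inv_mul_cancel₀ hc.ne', one_mul,
          one_mul, ← Real.exp_add]
        ring_nf
    simp_rw [h1]
    rw [lintegral_const_mul _ (he _),
      lintegral_exponentialPDF_eq_one hc, mul_one]

/-- The integrand in the exponent of the Laplace transform of a clock run up to time `r`. -/
noncomputable def clockRate (w : List ℕ → ℕ → ℝ≥0∞) (X : ℝ≥0∞ → List ℕ∞) (r : ℝ≥0∞) (x : ℕ)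
    (s : ℝ) : ℝ≥0∞ :=
  if ENNReal.ofReal s ≤ r then extendWeight w (X (ENNReal.ofReal s)) x else 0

lemma clockOf_eq (w : List ℕ → ℕ → ℝ≥0∞) (σ T : ℕ → ℕ → ℝ) (X : ℝ≥0∞ → List ℕ∞) (r : ℝ≥0∞) :
    clockOf w σ T X r
      = ∑' x, ∑' i, clockRate w X r x (σ x i) * ENNReal.ofReal (T x i) := by
  unfold clockOf clockRate
  refine tsum_congr fun x => tsum_congr fun i => ?_
  split_ifs <;> simp

lemma measurable_clockRate {w : List ℕ → ℕ → ℝ≥0∞} {X : ℝ≥0∞ → List ℕ∞} (hX : Measurable X)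
    (r : ℝ≥0∞) (x : ℕ) : Measurable (clockRate w X r x) := by
  refine Measurable.ite (measurableSet_le ENNReal.measurable_ofReal measurable_const) ?_
    measurable_const
  exact (Measurable.of_discrete (f := fun l => extendWeight w l x)).comp
    (hX.comp ENNReal.measurable_ofReal)

namespace Data.IsGREM

variable {Ω : Type*} [m0 : MeasurableSpace Ω] {P : Measure Ω} {D : Data Ω} {α : ℕ → ℝ}

lemma measurable_γ (hD : D.IsGREM α P) (v : List ℕ) (x : ℕ) : Measurable (D.γ v x) :=
  (hD.poisson_γ v).measurable x

lemma measurable_σ (hD : D.IsGREM α P) (k x i : ℕ) : Measurable (D.σ k x i) :=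
  (hD.poisson_σ k x).measurable i

lemma sourceAlgebra_le (hD : D.IsGREM α P) (s : Source) : D.sourceAlgebra s ≤ m0 := by
  cases s with
  | env v => exact (measurable_pi_lambda _ fun x => hD.measurable_γ v x).comap_le
  | marks k x => exact (measurable_pi_lambda _ fun i => hD.measurable_σ k x i).comap_le
  | hold k x i => exact (hD.measurable_T k x i).comap_le

end Data.IsGREM

/-! ### σ-algebras generated by blocks of sources -/

namespace Data

variable {Ω : Type*} (D : Data Ω)

/-- The σ-algebra generated by a set of sources of randomness. -/
@[reducible] def algebraOf (S : Set Source) : MeasurableSpace Ω := ⨆ s ∈ S, D.sourceAlgebra s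

lemma algebraOf_mono {S S' : Set Source} (h : S ⊆ S') : D.algebraOf S ≤ D.algebraOf S' :=
  biSup_mono h

lemma measurable_γ_algebraOf {S : Set Source} {v : List ℕ} (h : Source.env v ∈ S) (x : ℕ) :
    Measurable[D.algebraOf S] (D.γ v x) := by
  have h1 : Measurable[D.sourceAlgebra (.env v)] (fun ω x => D.γ v x ω) :=
    comap_measurable (fun ω x => D.γ v x ω)
  have h2 : Measurable[D.sourceAlgebra (.env v)] (D.γ v x) :=
    (measurable_pi_apply x).comp h1
  exact h2.mono (le_iSup₂_of_le _ h le_rfl) le_rfl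

lemma measurable_σ_algebraOf {S : Set Source} {k x : ℕ} (h : Source.marks k x ∈ S) (i : ℕ) :
    Measurable[D.algebraOf S] (D.σ k x i) := by
  have h1 : Measurable[D.sourceAlgebra (.marks k x)] (fun ω i => D.σ k x i ω) :=
    comap_measurable (fun ω i => D.σ k x i ω)
  have h2 : Measurable[D.sourceAlgebra (.marks k x)] (D.σ k x i) :=
    (measurable_pi_apply i).comp h1
  exact h2.mono (le_iSup₂_of_le _ h le_rfl) le_rfl

lemma measurable_T_algebraOf {S : Set Source} {k x i : ℕ} (h : Source.hold k x i ∈ S) :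
    Measurable[D.algebraOf S] (D.T k x i) := by
  have h1 : Measurable[D.sourceAlgebra (.hold k x i)] (D.T k x i) := comap_measurable _
  exact h1.mono (le_iSup₂_of_le _ h le_rfl) le_rfl

end Data

namespace Data.IsGREM

variable {Ω : Type*} [m0 : MeasurableSpace Ω] {P : Measure Ω} {D : Data Ω} {α : ℕ → ℝ}

lemma algebraOf_le (hD : D.IsGREM α P) (S : Set Source) : D.algebraOf S ≤ m0 :=
  iSup₂_le fun s _ => hD.sourceAlgebra_le s

lemma indep_algebraOf (hD : D.IsGREM α P) {S S' : Set Source} (h : Disjoint S S') :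
    Indep (D.algebraOf S) (D.algebraOf S') P :=
  indep_iSup_of_disjoint hD.sourceAlgebra_le hD.indep h

lemma lintegral_expNeg_hold [IsProbabilityMeasure P] (hD : D.IsGREM α P) (k x : ℕ)
    (c : ℕ → ℝ≥0∞) :
    ∫⁻ ω, expNeg (∑' i, c i * ENNReal.ofReal (D.T k x i ω)) ∂P
      = expNeg (∑' i, negLog ((1 + c i)⁻¹)) := by
  rw [lintegral_expNeg_tsum (B := fun i => {Source.hold k x i}) hD.sourceAlgebra_le hD.indep]
  · congr 1
    refine tsum_congr fun i => ?_
    have hm : Measurable fun s : ℝ => expNeg (c i * ENNReal.ofReal s) :=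
      measurable_expNeg.comp (measurable_const.mul ENNReal.measurable_ofReal)
    rw [← lintegral_expNeg_mul_expMeasure, ← hD.law_T k x i,
      lintegral_map hm (hD.measurable_T k x i)]
  · intro i j hij
    simpa [Function.onFun] using hij
  · intro i
    exact measurable_const.mul (ENNReal.measurable_ofReal.comp
      (D.measurable_T_algebraOf (S := {Source.hold k x i}) rfl))

/-- With the marks frozen, the holding variables contribute the product of `(1 + G)⁻¹` over the
marks. The Laplace functional of the marks then has exponent `1 - (1 + G)⁻¹`, which is `frac ∘ G`.
-/
lemma lintegral_expNeg_clockTerm [IsProbabilityMeasure P] (hD : D.IsGREM α P) (k x : ℕ)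
    {G : ℝ → ℝ≥0∞} (hG : Measurable G) :
    ∫⁻ ω, expNeg (∑' i, G (D.σ k x i ω) * ENNReal.ofReal (D.T k x i ω)) ∂P
      = expNeg (∫⁻ s in Ioi 0, frac (G s)) := by
  set S₁ : Set Source := {Source.marks k x}
  set S₂ : Set Source := range (Source.hold k x)
  have hd : Disjoint S₁ S₂ := by simp [S₁, S₂]
  have hH : Measurable[(D.algebraOf S₁).prod (D.algebraOf S₂)] fun p : Ω × Ω =>
      expNeg (∑' i, G (D.σ k x i p.1) * ENNReal.ofReal (D.T k x i p.2)) := by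
    refine measurable_expNeg.comp (measurable_tsum fun i => ?_)
    refine measurable_mul ?_ ?_
    · exact (hG.comp (D.measurable_σ_algebraOf (S := S₁) rfl i)).comp
        (@measurable_fst _ _ (D.algebraOf S₁) (D.algebraOf S₂))
    · exact (ENNReal.measurable_ofReal.comp (D.measurable_T_algebraOf (S := S₂) ⟨i, rfl⟩)).comp
        (@measurable_snd _ _ (D.algebraOf S₁) (D.algebraOf S₂))
  rw [lintegral_diag_of_indep (hD.algebraOf_le S₁) (hD.algebraOf_le S₂) (hD.indep_algebraOf hd) hH]
  simp_rw [hD.lintegral_expNeg_hold k x]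
  rw [(hD.poisson_σ k x).lintegral_expNeg_tsum (G := fun s => negLog ((1 + G s)⁻¹))]
  · congr 1
    refine lintegral_congr fun s => ?_
    rw [expNeg_negLog (by simp), frac]
  · exact measurable_negLog.comp (measurable_const.add hG).inv

/-- The Laplace transform of a clock driven by a deterministic path. -/
theorem lintegral_expNeg_clockOf [IsProbabilityMeasure P] (hD : D.IsGREM α P) (k : ℕ)
    (w : List ℕ → ℕ → ℝ≥0∞) {X : ℝ≥0∞ → List ℕ∞} (hX : Measurable X) (r : ℝ≥0∞) :
    ∫⁻ ω, expNeg (clockOf w (fun x i => D.σ k x i ω) (fun x i => D.T k x i ω) X r) ∂P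
      = expNeg (∑' x, ∫⁻ s in Ioi 0, frac (clockRate w X r x s)) := by
  simp_rw [clockOf_eq]
  rw [lintegral_expNeg_tsum (B := fun x => insert (Source.marks k x) (range (Source.hold k x)))
    hD.sourceAlgebra_le hD.indep]
  · congr 1
    refine tsum_congr fun x => ?_
    rw [hD.lintegral_expNeg_clockTerm k x (measurable_clockRate hX r x), negLog_expNeg]
  · intro x y hxy
    rw [Function.onFun, Set.disjoint_left]
    rintro s (rfl | ⟨i, rfl⟩) (h | ⟨j, h⟩)
    · exact hxy (by injection h)
    · cases h
    · cases h
    · exact hxy (by injection h with _ h _; exact h.symm)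
  · intro x
    refine measurable_tsum fun i => measurable_mul ?_ ?_
    · exact (measurable_clockRate hX r x).comp
        (D.measurable_σ_algebraOf (mem_insert _ _) i)
    · exact ENNReal.measurable_ofReal.comp
        (D.measurable_T_algebraOf (mem_insert_of_mem _ ⟨i, rfl⟩))

end Data.IsGREM

/-! ### Measurability of clocks and of the K process -/

lemma measurable_extendWeight {E : Type*} {m : MeasurableSpace E} {w : E → List ℕ → ℕ → ℝ≥0∞}
    (hw : ∀ v x, Measurable fun a => w a v x) {L : E → List ℕ∞} (hL : Measurable L) (x : ℕ) :
    Measurable fun a => extendWeight (w a) (L a) x := by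
  have h : Measurable fun p : List ℕ∞ × E => extendWeight (w p.2) p.1 x := by
    refine measurable_from_prod_countable_right fun l => ?_
    unfold extendWeight
    by_cases hl : ⊤ ∈ l
    · simp [hl]
    · simpa [hl] using hw _ x
  exact h.comp (hL.prodMk measurable_id)

lemma measurable_clockOf {E : Type*} {m : MeasurableSpace E} {w : E → List ℕ → ℕ → ℝ≥0∞}
    (hw : ∀ v x, Measurable fun a => w a v x) {σ T : E → ℕ → ℕ → ℝ}
    (hσ : ∀ x i, Measurable fun a => σ a x i) (hT : ∀ x i, Measurable fun a => T a x i)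
    {X : E → ℝ≥0∞ → List ℕ∞} (hX : Measurable fun p : E × ℝ≥0∞ => X p.1 p.2) {r : E → ℝ≥0∞}
    (hr : Measurable r) : Measurable fun a => clockOf (w a) (σ a) (T a) (X a) (r a) := by
  unfold clockOf
  refine measurable_tsum fun x => measurable_tsum fun i => ?_
  have h1 : Measurable fun a => ENNReal.ofReal (σ a x i) := (hσ x i).ennreal_ofReal
  refine Measurable.ite (measurableSet_le h1 hr) ?_ measurable_const
  exact measurable_mul (measurable_extendWeight hw (hX.comp (measurable_id.prodMk h1)) x)
    (hT x i).ennreal_ofReal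

lemma monotone_clockOf (w : List ℕ → ℕ → ℝ≥0∞) (σ T : ℕ → ℕ → ℝ) (X : ℝ≥0∞ → List ℕ∞) :
    Monotone (clockOf w σ T X) := by
  intro r r' h
  refine ENNReal.tsum_le_tsum fun x => ENNReal.tsum_le_tsum fun i => ?_
  by_cases h1 : ENNReal.ofReal (σ x i) ≤ r
  · simp [h1, h1.trans h]
  · simp [h1]

lemma measurable_genInverse {E : Type*} {m : MeasurableSpace E} {Ξ : E → ℝ≥0∞ → ℝ≥0∞}
    (hΞ : Measurable fun p : E × ℝ≥0∞ => Ξ p.1 p.2) (hmono : ∀ a, Monotone (Ξ a)) {t : E → ℝ≥0∞}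
    (ht : Measurable t) : Measurable fun a => genInverse (Ξ a) (t a) := by
  refine measurable_of_Iio fun c => ?_
  -- By monotonicity of the clock, rational times suffice.
  have : (fun a => genInverse (Ξ a) (t a)) ⁻¹' Iio c
      = ⋃ q : ℚ, ⋃ _ : ENNReal.ofReal q < c, {a | t a < Ξ a (ENNReal.ofReal q)} := by
    ext a
    simp only [mem_preimage, mem_Iio, genInverse, sInf_lt_iff, mem_iUnion, exists_prop,
      mem_ofPred_eq]
    constructor
    · rintro ⟨r, hr, hrc⟩
      obtain ⟨q, -, h1, h2⟩ := ENNReal.lt_iff_exists_rat_btwn.1 hrc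
      exact ⟨q, h2, hr.trans_le (hmono a h1.le)⟩
    · rintro ⟨q, h1, h2⟩
      exact ⟨_, h2, h1⟩
  rw [this]
  exact MeasurableSet.iUnion fun q => MeasurableSet.iUnion fun _ =>
    measurableSet_lt ht (hΞ.comp (measurable_id.prodMk measurable_const))

/-- For `s ≠ 0` the left limit is the supremum of the earlier values. At 0 there are no earlier
times, `leftLim` defaults to the value itself and the interval is empty. The right side reduces to
countably many conditions, as measurability of `lastCoord` requires. -/
lemma mem_Ico_leftLim {Ξ : ℝ≥0∞ → ℝ≥0∞} (hmono : Monotone Ξ) {s t : ℝ≥0∞} :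
    t ∈ Ico (Function.leftLim Ξ s) (Ξ s) ↔ s ≠ 0 ∧ t < Ξ s ∧ ∀ r < s, Ξ r ≤ t := by
  rcases eq_or_ne s 0 with rfl | hs
  · have h0 : Function.leftLim Ξ 0 = Ξ 0 := by
      apply leftLim_eq_of_eq_bot
      simp
    simp [h0]
  · have : (𝓝[<] s).NeBot := nhdsLT_neBot_of_exists_lt ⟨0, pos_iff_ne_zero.2 hs⟩
    rw [mem_Ico, hmono.leftLim_eq_sSup]
    simp only [sSup_le_iff, mem_image, mem_Iio, forall_exists_index, and_imp,
      forall_apply_eq_imp_iff₂]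
    tauto

lemma measurable_lastCoord {E : Type*} {m : MeasurableSpace E} {Ξ : E → ℝ≥0∞ → ℝ≥0∞}
    (hΞ : Measurable fun p : E × ℝ≥0∞ => Ξ p.1 p.2) (hmono : ∀ a, Monotone (Ξ a))
    {σ : E → ℕ → ℕ → ℝ} (hσ : ∀ x i, Measurable fun a => σ a x i) {t : E → ℝ≥0∞}
    (ht : Measurable t) : Measurable fun a => lastCoord (Ξ a) (σ a) (t a) := by
  have h1 : ∀ x i, MeasurableSet {a | t a ∈ Ico (Function.leftLim (Ξ a) (ENNReal.ofReal (σ a x i)))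
      (Ξ a (ENNReal.ofReal (σ a x i)))} := by
    intro x i
    have hs : Measurable fun a => ENNReal.ofReal (σ a x i) := (hσ x i).ennreal_ofReal
    have : {a | t a ∈ Ico (Function.leftLim (Ξ a) (ENNReal.ofReal (σ a x i)))
        (Ξ a (ENNReal.ofReal (σ a x i)))} = ({a | ENNReal.ofReal (σ a x i) = 0}ᶜ ∩
        {a | t a < Ξ a (ENNReal.ofReal (σ a x i))}) ∩ ⋂ q : ℚ,
        ({a | ENNReal.ofReal q < ENNReal.ofReal (σ a x i)}ᶜ ∪
          {a | Ξ a (ENNReal.ofReal q) ≤ t a}) := by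
      ext a
      simp only [mem_ofPred_eq, mem_Ico_leftLim (hmono a), mem_inter_iff, mem_compl_iff, mem_iInter,
        mem_union, and_assoc]
      refine and_congr_right fun _ => and_congr_right fun _ => ?_
      constructor
      · intro h q
        by_cases hq : ENNReal.ofReal q < ENNReal.ofReal (σ a x i)
        · exact Or.inr (h _ hq)
        · exact Or.inl hq
      · intro h r hr
        obtain ⟨q, -, h1, h2⟩ := ENNReal.lt_iff_exists_rat_btwn.1 hr
        exact (hmono a h1.le).trans ((h q).resolve_left (not_not.2 h2))
    rw [this]
    refine ((hs (measurableSet_singleton 0)).compl.inter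
      (measurableSet_lt ht (hΞ.comp (measurable_id.prodMk hs)))).inter
      (MeasurableSet.iInter fun q => ?_)
    exact (measurableSet_lt measurable_const hs).compl.union
      (measurableSet_le (hΞ.comp (measurable_id.prodMk measurable_const)) ht)
  have hborel : BorelSpace ℕ∞ := ⟨borel_eq_top_of_countable.symm⟩
  unfold lastCoord
  refine Measurable.iInf fun x => ?_
  have h2 : MeasurableSet {a | ∃ i, t a ∈ Ico (Function.leftLim (Ξ a) (ENNReal.ofReal (σ a x i)))
      (Ξ a (ENNReal.ofReal (σ a x i)))} := by
    rw [ofPred_exists]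
    exact MeasurableSet.iUnion fun i => h1 x i
  classical
  have h3 : (fun a => ⨅ (_ : x ∈ {x : ℕ | ∃ i : ℕ, t a ∈ Ico (Function.leftLim (Ξ a)
      (ENNReal.ofReal (σ a x i))) (Ξ a (ENNReal.ofReal (σ a x i)))}), (x : ℕ∞))
      = fun a => if a ∈ {a | ∃ i, t a ∈ Ico (Function.leftLim (Ξ a) (ENNReal.ofReal (σ a x i)))
      (Ξ a (ENNReal.ofReal (σ a x i)))} then (x : ℕ∞) else ⊤ := by
    ext a
    exact iInf_eq_if _
  rw [h3]
  exact Measurable.ite h2 measurable_const measurable_const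

/-- All the parameters and the Poisson and exponential variables of the levels before `k`. -/
def history (k : ℕ) : Set Source :=
  {s | match s with
    | .env _ => True
    | .marks j _ => j < k
    | .hold j _ _ => j < k}

/-- The Poisson and exponential variables of level `k`. -/
def levelNoise (k : ℕ) : Set Source :=
  {s | match s with
    | .env _ => False
    | .marks j _ => j = k
    | .hold j _ _ => j = k}

lemma monotone_history : Monotone history := by
  rintro k l hkl (v | ⟨j, x⟩ | ⟨j, x, i⟩) h
  · trivial
  · exact lt_of_lt_of_le (show j < k from h) hkl
  · exact lt_of_lt_of_le (show j < k from h) hkl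

lemma disjoint_history_levelNoise (k : ℕ) : Disjoint (history k) (levelNoise k) := by
  rw [Set.disjoint_left]
  rintro (v | ⟨j, x⟩ | ⟨j, x, i⟩) h h'
  · exact h'
  · exact (ne_of_lt (show j < k from h)) h'
  · exact (ne_of_lt (show j < k from h)) h'

namespace Data

variable {Ω : Type*} (D : Data Ω)

lemma measurable_g {m : MeasurableSpace Ω} (hγ : ∀ v x, Measurable (D.γ v x)) (v : List ℕ)
    (x : ℕ) : Measurable fun ω => D.g ω v x := (hγ v x).ennreal_ofReal

lemma monotone_Ξ (ω : Ω) (k : ℕ) : Monotone (D.Ξ ω k) := monotone_clockOf _ _ _ _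

lemma X_succ (ω : Ω) (k : ℕ) (t : ℝ≥0∞) :
    D.X ω (k + 1) t = D.X ω k (genInverse (D.Ξ ω k) t) ++
      [lastCoord (D.Ξ ω k) (fun x i => D.σ k x i ω) t] := rfl

lemma measurable_Ξ_of_measurable_X {m : MeasurableSpace Ω} {k : ℕ}
    (hγ : ∀ v x, Measurable (D.γ v x))
    (hσ : ∀ x i, Measurable (D.σ k x i)) (hT : ∀ x i, Measurable (D.T k x i))
    (hX : Measurable fun p : Ω × ℝ≥0∞ => D.X p.1 k p.2) :
    Measurable fun p : Ω × ℝ≥0∞ => D.Ξ p.1 k p.2 := by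
  unfold Ξ
  refine measurable_clockOf (E := Ω × ℝ≥0∞) (w := fun p => D.g p.1)
    (fun v x => (D.measurable_g hγ v x).comp measurable_fst)
    (fun x i => (hσ x i).comp measurable_fst) (fun x i => (hT x i).comp measurable_fst)
    ?_ measurable_snd
  exact hX.comp ((measurable_fst.comp measurable_fst).prodMk measurable_snd)

lemma measurable_X {m : MeasurableSpace Ω} {k : ℕ} (hγ : ∀ v x, Measurable (D.γ v x))
    (hσ : ∀ j < k, ∀ x i, Measurable (D.σ j x i)) (hT : ∀ j < k, ∀ x i, Measurable (D.T j x i)) :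
    Measurable fun p : Ω × ℝ≥0∞ => D.X p.1 k p.2 := by
  induction k with
  | zero => exact measurable_const
  | succ k ih =>
    have hX := ih (fun j hj => hσ j (hj.trans k.lt_succ_self)) fun j hj =>
      hT j (hj.trans k.lt_succ_self)
    have hΞ := D.measurable_Ξ_of_measurable_X hγ (hσ k k.lt_succ_self) (hT k k.lt_succ_self) hX
    have hΞ' : Measurable fun p : (Ω × ℝ≥0∞) × ℝ≥0∞ => D.Ξ p.1.1 k p.2 :=
      hΞ.comp ((measurable_fst.comp measurable_fst).prodMk measurable_snd)
    have h1 : Measurable fun p : Ω × ℝ≥0∞ => genInverse (D.Ξ p.1 k) p.2 :=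
      measurable_genInverse (E := Ω × ℝ≥0∞) (Ξ := fun p => D.Ξ p.1 k) hΞ'
        (fun a => D.monotone_Ξ _ _) measurable_snd
    have h2 : Measurable fun p : Ω × ℝ≥0∞ =>
        lastCoord (D.Ξ p.1 k) (fun x i => D.σ k x i p.1) p.2 :=
      measurable_lastCoord (E := Ω × ℝ≥0∞) (Ξ := fun p => D.Ξ p.1 k) hΞ'
        (fun a => D.monotone_Ξ _ _) (σ := fun p x i => D.σ k x i p.1)
        (fun x i => (hσ k k.lt_succ_self x i).comp measurable_fst) measurable_snd
    have h3 : Measurable fun p : Ω × ℝ≥0∞ => D.X p.1 k (genInverse (D.Ξ p.1 k) p.2) :=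
      hX.comp (measurable_fst.prodMk h1)
    have h4 : Measurable fun q : List ℕ∞ × ℕ∞ => q.1 ++ [q.2] := Measurable.of_discrete
    simp_rw [X_succ]
    exact h4.comp (h3.prodMk h2)

lemma measurable_Ξ {m : MeasurableSpace Ω} {k : ℕ} (hγ : ∀ v x, Measurable (D.γ v x))
    (hσ : ∀ j ≤ k, ∀ x i, Measurable (D.σ j x i)) (hT : ∀ j ≤ k, ∀ x i, Measurable (D.T j x i)) :
    Measurable fun p : Ω × ℝ≥0∞ => D.Ξ p.1 k p.2 :=
  D.measurable_Ξ_of_measurable_X hγ (hσ k le_rfl) (hT k le_rfl)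
    (D.measurable_X hγ (fun j hj => hσ j hj.le) fun j hj => hT j hj.le)

lemma measurable_clockComp {m : MeasurableSpace Ω} {k : ℕ} (hγ : ∀ v x, Measurable (D.γ v x))
    (hσ : ∀ j < k, ∀ x i, Measurable (D.σ j x i)) (hT : ∀ j < k, ∀ x i, Measurable (D.T j x i))
    (t : ℝ≥0∞) : Measurable fun ω => D.clockComp ω 0 k t := by
  induction k with
  | zero => exact measurable_const
  | succ k ih =>
    have h1 := ih (fun j hj => hσ j (hj.trans k.lt_succ_self)) fun j hj =>
      hT j (hj.trans k.lt_succ_self)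
    have h2 := D.measurable_Ξ (k := k) hγ (fun j hj => hσ j (Nat.lt_succ_of_le hj))
      (fun j hj => hT j (Nat.lt_succ_of_le hj))
    simp only [clockComp, Function.comp, zero_add]
    exact h2.comp (measurable_id.prodMk h1)

lemma measurable_pathProd {m : MeasurableSpace Ω} (w : List ℕ) {v : List ℕ}
    (hγ : ∀ u x, Measurable (D.γ (v ++ u) x)) : Measurable fun ω => D.pathProd ω v w := by
  induction w generalizing v with
  | nil => exact measurable_const
  | cons x w ih =>
    have h0 : Measurable fun ω => D.g ω v x := by
      have := (hγ [] x).ennreal_ofReal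
      rwa [List.append_nil] at this
    exact measurable_mul h0 (ih fun u y => by simpa using hγ ([x] ++ u) y)

/-- The sum whose limit as `m → ∞` is `W v`. -/
noncomputable def partialW (α : ℕ → ℝ) (ω : Ω) (v : List ℕ) (m : ℕ) : ℝ≥0∞ :=
  ∑' w : List.Vector ℕ m, D.pathProd ω v w.toList ^ α (v.length + m)

lemma measurable_partialW {m : MeasurableSpace Ω} {v : List ℕ}
    (hγ : ∀ u x, Measurable (D.γ (v ++ u) x)) (α : ℕ → ℝ) (n : ℕ) :
    Measurable fun ω => D.partialW α ω v n :=
  measurable_tsum fun w => (D.measurable_pathProd w.toList hγ).pow_const _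

lemma measurable_W {m : MeasurableSpace Ω} {v : List ℕ}
    (hγ : ∀ u x, Measurable (D.γ (v ++ u) x)) (α : ℕ → ℝ) : Measurable fun ω => D.W α ω v :=
  Measurable.limsup fun n => D.measurable_partialW hγ α n

end Data

/-! ### The occupation formula -/

/-- Extension of a function of vertices by `0` to the states which have an infinite coordinate. -/
def extendFun (h : List ℕ → ℝ≥0∞) (s : List ℕ∞) : ℝ≥0∞ :=
  extendWeight (fun v _ => h v) s 0

lemma extendFun_append (h : List ℕ → ℝ≥0∞) (g : List ℕ → ℕ → ℝ≥0∞) (s : List ℕ∞) (x : ℕ) :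
    extendWeight (fun v x => h (v ++ [x]) * g v x) s x
      = extendFun h (s ++ [(x : ℕ∞)]) * extendWeight g s x := by
  unfold extendFun extendWeight
  by_cases hs : ⊤ ∈ s
  · simp [hs]
  · simp [hs]

lemma extendFun_append_top (h : List ℕ → ℝ≥0∞) (s : List ℕ∞) : extendFun h (s ++ [⊤]) = 0 := by
  simp [extendFun, extendWeight]

/-- Times of the K process live in `[0, ∞]` and Lebesgue measure on `ℝ`; this moves lengths between
the two. The condition `0 < s` is needed because `ENNReal.ofReal` collapses the negative half-line
to 0. -/
lemma volume_ofReal_mem_Ico (a b : ℝ≥0∞) :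
    volume {s : ℝ | 0 < s ∧ ENNReal.ofReal s ∈ Ico a b} = b - a := by
  induction a with
  | top => simp
  | coe a =>
    induction b with
    | top =>
      have : volume (Ioi (a : ℝ)) ≤ volume {s : ℝ | 0 < s ∧ ENNReal.ofReal s ∈ Ico (a : ℝ≥0∞) ∞} := by
        refine measure_mono fun s hs => ⟨a.coe_nonneg.trans_lt hs, ?_, by simp⟩
        rw [← ENNReal.ofReal_coe_nnreal]
        exact ENNReal.ofReal_le_ofReal (le_of_lt hs)
      simpa using this
    | coe b =>
      have e : (b : ℝ≥0∞) - a = ENNReal.ofReal (b - a) := by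
        rw [ENNReal.ofReal_sub _ a.coe_nonneg, ENNReal.ofReal_coe_nnreal, ENNReal.ofReal_coe_nnreal]
      rw [e]
      refine le_antisymm ?_ ?_
      · rw [← Real.volume_Icc]
        refine measure_mono fun s hs => ?_
        obtain ⟨h0, h1, h2⟩ := hs
        rw [← ENNReal.ofReal_coe_nnreal, ENNReal.ofReal_le_ofReal_iff h0.le] at h1
        rw [← ENNReal.ofReal_coe_nnreal] at h2
        exact ⟨h1, ((ENNReal.ofReal_lt_ofReal_iff').1 h2).1.le⟩
      · rw [← Real.volume_Ioo]
        refine measure_mono fun s hs => ?_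
        have h0 : 0 < s := a.coe_nonneg.trans_lt hs.1
        refine ⟨h0, ?_, ?_⟩
        · rw [← ENNReal.ofReal_coe_nnreal]; exact ENNReal.ofReal_le_ofReal hs.1.le
        · rw [← ENNReal.ofReal_coe_nnreal]
          exact (ENNReal.ofReal_lt_ofReal_iff (h0.trans hs.2)).2 hs.2

section Occupation

variable {g : List ℕ → ℕ → ℝ≥0∞} {σ T : ℕ → ℕ → ℝ} {X : ℝ≥0∞ → List ℕ∞}

/-- The jump of a clock at its mark `(x, i)`. -/
noncomputable def clockJump (g : List ℕ → ℕ → ℝ≥0∞) (σ T : ℕ → ℕ → ℝ) (X : ℝ≥0∞ → List ℕ∞)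
    (p : ℕ × ℕ) : ℝ≥0∞ :=
  extendWeight g (X (ENNReal.ofReal (σ p.1 p.2))) p.1 * ENNReal.ofReal (T p.1 p.2)

lemma clockOf_eq_tsum (r : ℝ≥0∞) :
    clockOf g σ T X r
      = ∑' p : ℕ × ℕ, if ENNReal.ofReal (σ p.1 p.2) ≤ r then clockJump g σ T X p else 0 := by
  rw [ENNReal.tsum_prod']
  rfl

/-- Monotone convergence along times increasing strictly to `τ`: exactly the marks at `τ` are lost.
No finiteness of the clock is needed. -/
lemma leftLim_clockOf {τ : ℝ≥0∞} (hτ : τ ≠ 0) :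
    Function.leftLim (clockOf g σ T X) τ
      = ∑' p : ℕ × ℕ, if ENNReal.ofReal (σ p.1 p.2) < τ then clockJump g σ T X p else 0 := by
  have hne : (𝓝[<] τ).NeBot := nhdsLT_neBot_of_exists_lt ⟨0, pos_iff_ne_zero.2 hτ⟩
  obtain ⟨u, humono, hult, hu⟩ := exists_seq_strictMono_tendsto' (pos_iff_ne_zero.2 hτ)
  have h1 : Tendsto (fun n => clockOf g σ T X (u n)) atTop
      (𝓝 (Function.leftLim (clockOf g σ T X) τ)) := by
    refine ((monotone_clockOf g σ T X).tendsto_leftLim τ).comp ?_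
    exact tendsto_nhdsWithin_iff.2 ⟨hu, Eventually.of_forall fun n => (hult n).2⟩
  have h2 := lintegral_tendsto_of_tendsto_of_monotone (μ := (Measure.count : Measure (ℕ × ℕ)))
    (f := fun n p => if ENNReal.ofReal (σ p.1 p.2) ≤ u n then clockJump g σ T X p else 0)
    (F := fun p => if ENNReal.ofReal (σ p.1 p.2) < τ then clockJump g σ T X p else 0)
    (fun n => Measurable.of_discrete.aemeasurable) (ae_of_all _ fun p i j hij => ?_)
    (ae_of_all _ fun p => ?_)
  · simp only [lintegral_count] at h2
    refine tendsto_nhds_unique h1 (h2.congr fun n => ?_)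
    rw [clockOf_eq_tsum]
  · by_cases h : ENNReal.ofReal (σ p.1 p.2) ≤ u i
    · simp [h, h.trans (humono.monotone hij)]
    · simp [h]
  · by_cases h : ENNReal.ofReal (σ p.1 p.2) < τ
    · refine tendsto_const_nhds.congr' ?_
      filter_upwards [hu.eventually (lt_mem_nhds h)] with n hn
      simp [h, le_of_lt hn]
    · refine tendsto_const_nhds.congr fun n => ?_
      have : ¬ ENNReal.ofReal (σ p.1 p.2) ≤ u n := fun h' => h (h'.trans_lt (hult n).2)
      simp [h, this]

variable (hpos : ∀ x i, 0 < σ x i) (hinj : Function.Injective fun p : ℕ × ℕ => σ p.1 p.2)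

include hpos hinj in
lemma clockOf_mark (p : ℕ × ℕ) :
    clockOf g σ T X (ENNReal.ofReal (σ p.1 p.2))
      = Function.leftLim (clockOf g σ T X) (ENNReal.ofReal (σ p.1 p.2)) + clockJump g σ T X p := by
  have hp : ENNReal.ofReal (σ p.1 p.2) ≠ 0 := by simpa using hpos p.1 p.2
  rw [leftLim_clockOf hp, clockOf_eq_tsum]
  have h1 : clockJump g σ T X p = ∑' q, if q = p then clockJump g σ T X q else 0 := by
    rw [tsum_eq_single p fun q hq => by simp [hq]]; simp
  rw [h1, ← ENNReal.tsum_add]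
  refine tsum_congr fun q => ?_
  by_cases hq : q = p
  · simp [hq]
  · have : ENNReal.ofReal (σ q.1 q.2) ≠ ENNReal.ofReal (σ p.1 p.2) := by
      intro h
      exact hq (hinj ((ENNReal.ofReal_eq_ofReal_iff (hpos _ _).le (hpos _ _).le).1 h))
    by_cases h : ENNReal.ofReal (σ q.1 q.2) < ENNReal.ofReal (σ p.1 p.2)
    · simp [h, h.le, hq]
    · have h' : ¬ ENNReal.ofReal (σ q.1 q.2) ≤ ENNReal.ofReal (σ p.1 p.2) :=
        fun h'' => h (lt_of_le_of_ne h'' this)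
      simp [h, h', hq]

/-- The times which the inverse clock spends at the mark `p`. -/
def jumpSet (g : List ℕ → ℕ → ℝ≥0∞) (σ T : ℕ → ℕ → ℝ) (X : ℝ≥0∞ → List ℕ∞) (p : ℕ × ℕ) :
    Set ℝ≥0∞ :=
  Ico (Function.leftLim (clockOf g σ T X) (ENNReal.ofReal (σ p.1 p.2)))
    (clockOf g σ T X (ENNReal.ofReal (σ p.1 p.2)))

lemma genInverse_of_mem_jumpSet {p : ℕ × ℕ} {t : ℝ≥0∞} (ht : t ∈ jumpSet g σ T X p) :
    genInverse (clockOf g σ T X) t = ENNReal.ofReal (σ p.1 p.2) := by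
  obtain ⟨-, h2, h3⟩ := (mem_Ico_leftLim (monotone_clockOf g σ T X)).1 ht
  refine le_antisymm (sInf_le h2) (le_sInf fun r hr => ?_)
  by_contra hc
  exact absurd (h3 r (not_le.1 hc)) (not_le.2 hr)

include hpos hinj in
lemma eq_of_mem_jumpSet {p q : ℕ × ℕ} {t : ℝ≥0∞} (hp : t ∈ jumpSet g σ T X p)
    (hq : t ∈ jumpSet g σ T X q) : q = p := by
  have := (genInverse_of_mem_jumpSet hq).symm.trans (genInverse_of_mem_jumpSet hp)
  exact hinj ((ENNReal.ofReal_eq_ofReal_iff (hpos _ _).le (hpos _ _).le).1 this)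

include hpos hinj in
lemma lastCoord_of_mem_jumpSet {p : ℕ × ℕ} {t : ℝ≥0∞} (hp : t ∈ jumpSet g σ T X p) :
    lastCoord (clockOf g σ T X) σ t = p.1 := by
  unfold lastCoord
  have : {x : ℕ | ∃ i : ℕ, t ∈ Ico (Function.leftLim (clockOf g σ T X) (ENNReal.ofReal (σ x i)))
      (clockOf g σ T X (ENNReal.ofReal (σ x i)))} = {p.1} := by
    ext x
    simp only [mem_ofPred_eq, mem_singleton_iff]
    constructor
    · rintro ⟨i, hi⟩
      exact congrArg Prod.fst (eq_of_mem_jumpSet hpos hinj hp (q := (x, i)) hi)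
    · rintro rfl
      exact ⟨p.2, hp⟩
  rw [this]
  simp

lemma lastCoord_of_forall_notMem {t : ℝ≥0∞} (h : ∀ p, t ∉ jumpSet g σ T X p) :
    lastCoord (clockOf g σ T X) σ t = ⊤ := by
  unfold lastCoord
  simp only [iInf_eq_top]
  rintro x ⟨i, hi⟩
  exact absurd hi (h (x, i))

/-- The path obtained by adding one level. -/
noncomputable def nextPath (g : List ℕ → ℕ → ℝ≥0∞) (σ T : ℕ → ℕ → ℝ) (X : ℝ≥0∞ → List ℕ∞)
    (t : ℝ≥0∞) : List ℕ∞ :=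
  X (genInverse (clockOf g σ T X) t) ++ [lastCoord (clockOf g σ T X) σ t]

include hpos hinj in
-- Inside the jump set of a mark the path is frozen, and `t < Ξ r` holds exactly when the mark is at
-- most `r`. Outside all jump sets the last coordinate is `⊤`, where `extendFun` vanishes.
lemma occupation_pointwise (h : List ℕ → ℝ≥0∞) (r t : ℝ≥0∞) :
    (if t < clockOf g σ T X r then extendFun h (nextPath g σ T X t) else 0)
      = ∑' p, (jumpSet g σ T X p).indicator (fun _ => if ENNReal.ofReal (σ p.1 p.2) ≤ r then
          extendFun h (X (ENNReal.ofReal (σ p.1 p.2)) ++ [(p.1 : ℕ∞)]) else 0) t := by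
  by_cases hex : ∃ p, t ∈ jumpSet g σ T X p
  · obtain ⟨p, hp⟩ := hex
    rw [tsum_eq_single p fun q hq => indicator_of_notMem
      (fun hq' => hq (eq_of_mem_jumpSet hpos hinj hp hq')) _, indicator_of_mem hp]
    obtain ⟨-, h2, h3⟩ := (mem_Ico_leftLim (monotone_clockOf g σ T X)).1 hp
    have hiff : t < clockOf g σ T X r ↔ ENNReal.ofReal (σ p.1 p.2) ≤ r := by
      constructor
      · intro hr
        by_contra hc
        exact absurd (h3 r (not_le.1 hc)) (not_le.2 hr)
      · intro hr
        exact h2.trans_le (monotone_clockOf g σ T X hr)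
    simp only [hiff, nextPath, genInverse_of_mem_jumpSet hp,
      lastCoord_of_mem_jumpSet hpos hinj hp]
  · push Not at hex
    rw [nextPath, lastCoord_of_forall_notMem hex, extendFun_append_top]
    simp [hex]

/-- The two integrands differ at one time at most. The clock sums over `σ ≤ r`, while jump sets are
half-open, so both forms occur. -/
lemma setLIntegral_le_eq_lt (r : ℝ≥0∞) (F : ℝ → ℝ≥0∞) :
    ∫⁻ s in Ioi 0, (if ENNReal.ofReal s ≤ r then F s else 0)
      = ∫⁻ s in Ioi 0, (if ENNReal.ofReal s < r then F s else 0) := by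
  refine lintegral_congr_ae ?_
  have h1 : ∀ᵐ s : ℝ ∂(volume.restrict (Ioi 0)), s ≠ r.toReal :=
    ae_restrict_of_ae (by simp [ae_iff])
  have h2 : ∀ᵐ s : ℝ ∂(volume.restrict (Ioi 0)), s ∈ Ioi (0 : ℝ) :=
    ae_restrict_mem measurableSet_Ioi
  filter_upwards [h1, h2] with s hs hs0
  have : ENNReal.ofReal s ≠ r := by
    rintro rfl
    exact hs (ENNReal.toReal_ofReal (le_of_lt hs0)).symm
  have h3 : ENNReal.ofReal s ≤ r ↔ ENNReal.ofReal s < r :=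
    ⟨fun h => lt_of_le_of_ne h this, le_of_lt⟩
  simp only [h3]

include hpos hinj in
lemma occupation_eq_tsum (h : List ℕ → ℝ≥0∞) (r : ℝ≥0∞) :
    ∫⁻ s in Ioi 0, (if ENNReal.ofReal s ≤ clockOf g σ T X r then
        extendFun h (nextPath g σ T X (ENNReal.ofReal s)) else 0)
      = ∑' p : ℕ × ℕ, (if ENNReal.ofReal (σ p.1 p.2) ≤ r then
          extendFun h (X (ENNReal.ofReal (σ p.1 p.2)) ++ [(p.1 : ℕ∞)]) else 0) *
        (clockOf g σ T X (ENNReal.ofReal (σ p.1 p.2)) -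
          Function.leftLim (clockOf g σ T X) (ENNReal.ofReal (σ p.1 p.2))) := by
  rw [setLIntegral_le_eq_lt]
  have hm : ∀ p, MeasurableSet ((fun s : ℝ => ENNReal.ofReal s) ⁻¹' jumpSet g σ T X p) := fun p =>
    ENNReal.measurable_ofReal measurableSet_Ico
  simp_rw [occupation_pointwise hpos hinj]
  rw [lintegral_tsum fun p => by
    exact ((measurable_const.indicator measurableSet_Ico).comp
      ENNReal.measurable_ofReal).aemeasurable]
  refine tsum_congr fun p => ?_
  have h1 : ∀ (c : ℝ≥0∞) (s : ℝ), (jumpSet g σ T X p).indicator (fun _ => c) (ENNReal.ofReal s)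
      = ((fun s : ℝ => ENNReal.ofReal s) ⁻¹' jumpSet g σ T X p).indicator (fun _ => c) s :=
    fun c s => rfl
  simp_rw [h1]
  rw [lintegral_indicator_const (hm p), ← volume_ofReal_mem_Ico, Measure.restrict_apply (hm p)]
  congr 2
  ext s
  simp only [mem_inter_iff, mem_preimage, mem_Ioi, mem_ofPred_eq, jumpSet]
  exact and_comm

lemma clockOf_mul_eq_tsum (h : List ℕ → ℝ≥0∞) (r : ℝ≥0∞) :
    clockOf (fun v x => h (v ++ [x]) * g v x) σ T X r
      = ∑' p : ℕ × ℕ, (if ENNReal.ofReal (σ p.1 p.2) ≤ r then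
          extendFun h (X (ENNReal.ofReal (σ p.1 p.2)) ++ [(p.1 : ℕ∞)]) else 0) *
        clockJump g σ T X p := by
  rw [clockOf_eq_tsum]
  refine tsum_congr fun p => ?_
  split_ifs
  · rw [clockJump, extendFun_append, clockJump, mul_assoc]
  · simp

include hpos hinj in
-- The length of a jump set is `(left limit + jump) - left limit`. This is always at most the jump,
-- but drops to 0 when the left limit is infinite; hence only an inequality without a finiteness
-- hypothesis.
lemma occupation_le (h : List ℕ → ℝ≥0∞) (r : ℝ≥0∞) :
    ∫⁻ s in Ioi 0, (if ENNReal.ofReal s ≤ clockOf g σ T X r then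
        extendFun h (nextPath g σ T X (ENNReal.ofReal s)) else 0)
      ≤ clockOf (fun v x => h (v ++ [x]) * g v x) σ T X r := by
  rw [occupation_eq_tsum hpos hinj, clockOf_mul_eq_tsum]
  refine ENNReal.tsum_le_tsum fun p => ?_
  gcongr
  rw [clockOf_mark hpos hinj]
  exact tsub_le_iff_left.2 le_rfl

include hpos hinj in
lemma occupation_eq (h : List ℕ → ℝ≥0∞) {r : ℝ≥0∞} (hr : clockOf g σ T X r ≠ ∞) :
    ∫⁻ s in Ioi 0, (if ENNReal.ofReal s ≤ clockOf g σ T X r then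
        extendFun h (nextPath g σ T X (ENNReal.ofReal s)) else 0)
      = clockOf (fun v x => h (v ++ [x]) * g v x) σ T X r := by
  rw [occupation_eq_tsum hpos hinj, clockOf_mul_eq_tsum]
  refine tsum_congr fun p => ?_
  split_ifs with hp
  · congr 1
    rw [clockOf_mark hpos hinj]
    refine ENNReal.add_sub_cancel_left ?_
    refine ne_top_of_le_ne_top hr (((monotone_clockOf g σ T X).leftLim_le le_rfl).trans ?_)
    exact monotone_clockOf g σ T X hp
  · simp

end Occupation

/-! ### Integrals with respect to the intensity measures -/

/-- Convexity: the chord of Gamma between 1 and 2 is constant equal to 1. -/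
lemma Gamma_le_one {x : ℝ} (h1 : 1 ≤ x) (h2 : x ≤ 2) : Real.Gamma x ≤ 1 := by
  have h01 : (1 : ℝ) ∈ Ioi (0 : ℝ) := by simp
  have h02 : (2 : ℝ) ∈ Ioi (0 : ℝ) := by simp
  have := Real.convexOn_Gamma.2 h01 h02 (show 0 ≤ 2 - x by linarith) (show 0 ≤ x - 1 by linarith)
    (by ring)
  simp only [smul_eq_mul, Real.Gamma_one, Real.Gamma_two] at this
  have e : (2 - x) * 1 + (x - 1) * 2 = x := by ring
  rw [e] at this
  linarith

lemma lintegral_expMeasure_eq {F : ℝ → ℝ≥0∞} (hF : Measurable F) :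
    ∫⁻ s, F s ∂(expMeasure 1) = ∫⁻ s in Ioi 0, ENNReal.ofReal (Real.exp (-s)) * F s := by
  have he : Measurable (exponentialPDF 1) := (measurable_exponentialPDFReal 1).ennreal_ofReal
  have : expMeasure 1 = volume.withDensity (exponentialPDF 1) := rfl
  rw [this, lintegral_withDensity_eq_lintegral_mul _ he hF, ← lintegral_indicator measurableSet_Ioi]
  have h0 : ∀ᵐ s : ℝ, s ≠ 0 := by simp [ae_iff]
  refine lintegral_congr_ae ?_
  filter_upwards [h0] with s hs
  rcases lt_or_gt_of_ne hs with h | h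
  · simp [exponentialPDF_of_neg h, h.le]
  · simp [exponentialPDF_of_nonneg h.le, h]

lemma ae_expMeasure_pos : ∀ᵐ s ∂(expMeasure 1), 0 < s := by
  have hm : Measurable ((Iic (0 : ℝ)).indicator fun _ => (1 : ℝ≥0∞)) :=
    measurable_const.indicator measurableSet_Iic
  have h := lintegral_expMeasure_eq hm
  have h2 : ∫⁻ s in Ioi (0 : ℝ), ENNReal.ofReal (Real.exp (-s)) *
      (Iic (0 : ℝ)).indicator (fun _ => (1 : ℝ≥0∞)) s = 0 := by
    rw [← lintegral_zero (μ := volume.restrict (Ioi (0 : ℝ)))]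
    refine setLIntegral_congr_fun measurableSet_Ioi fun s hs => ?_
    have : s ∉ Iic (0 : ℝ) := notMem_Iic.2 hs
    simp [this]
  rw [h2, lintegral_indicator_const measurableSet_Iic, one_mul] at h
  rw [ae_iff, show {s : ℝ | ¬ 0 < s} = Iic 0 by ext s; simp]
  exact h

lemma lintegral_rpow_expMeasure {q : ℝ} (hq : -1 < q) :
    ∫⁻ s, ENNReal.ofReal (s ^ q) ∂(expMeasure 1) = ENNReal.ofReal (Real.Gamma (1 + q)) := by
  rw [lintegral_expMeasure_eq (by fun_prop), Real.Gamma_eq_integral (by linarith),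
    ofReal_integral_eq_lintegral_ofReal (Real.GammaIntegral_convergent (by linarith))]
  · refine setLIntegral_congr_fun measurableSet_Ioi fun s hs => ?_
    rw [← ENNReal.ofReal_mul (Real.exp_pos _).le]
    congr 3; ring
  · filter_upwards [ae_restrict_mem measurableSet_Ioi] with s hs
    exact mul_nonneg (Real.exp_pos _).le (Real.rpow_nonneg (le_of_lt hs) _)

lemma expMeasure_Iio {u : ℝ} (hu : 0 ≤ u) :
    expMeasure 1 (Iio u) = 1 - expNeg (ENNReal.ofReal u) := by
  have : IsProbabilityMeasure (expMeasure 1) := isProbabilityMeasure_expMeasure one_pos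
  have hna : NullSingletonClass (expMeasure 1) := by
    have : expMeasure 1 = volume.withDensity (exponentialPDF 1) := rfl
    rw [this]; exact nullSingletonClass_withDensity _
  rw [measure_congr Iio_ae_eq_Iic]
  have h1 := cdf_expMeasure_eq one_pos u
  rw [cdf_eq_real, if_pos hu] at h1
  rw [← ofReal_measureReal, h1, ENNReal.ofReal_sub _ (Real.exp_pos _).le, expNeg_ofReal hu]
  simp

section Intensity

variable {α : ℕ → ℝ}

instance (k : ℕ) : SigmaFinite (intensity α k) := by
  unfold intensity
  exact SigmaFinite.withDensity_ofReal _

lemma lintegral_intensity (k : ℕ) {F : ℝ → ℝ≥0∞} (hF : Measurable F) :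
    ∫⁻ t, F t ∂(intensity α k)
      = ∫⁻ t in Ioi 0, ENNReal.ofReal (intensityConst α k / t ^ (1 + α k)) * F t := by
  unfold intensity
  rw [lintegral_withDensity_eq_lintegral_mul _ (by fun_prop) hF]
  rfl

lemma ae_intensity_pos (k : ℕ) : ∀ᵐ t ∂(intensity α k), 0 < t := by
  unfold intensity
  exact (withDensity_absolutelyContinuous _ _).ae_le (ae_restrict_mem measurableSet_Ioi)

variable (hpos : ∀ k, 0 < α k) (hmono : StrictMono α) (hlt : ∀ k, α k < 1)

include hpos hmono in
lemma intensityConst_pos (k : ℕ) : 0 < intensityConst α k := by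
  refine div_pos (hpos k) (Real.Gamma_pos_of_pos ?_)
  rw [sub_pos, div_lt_one (hpos _)]
  exact hmono k.lt_succ_self

/-- Homogeneity of the density under the substitution `t ↦ s * t`. All powers `l ^ α k` in the
Laplace exponents come from here. -/
lemma lintegral_intensity_comp_mul (k : ℕ) {F : ℝ → ℝ≥0∞} (hF : Measurable F) {s : ℝ}
    (hs : 0 < s) :
    ∫⁻ t, F (s * t) ∂(intensity α k) = ENNReal.ofReal (s ^ α k) * ∫⁻ t, F t ∂(intensity α k) := by
  have hFs : Measurable fun t => F (s * t) := hF.comp (measurable_const_mul s)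
  rw [lintegral_intensity k hFs, lintegral_intensity k hF]
  have himg : (fun t => s * t) '' Ioi 0 = Ioi (0 : ℝ) := by
    simpa using Set.image_mul_left_Ioi hs 0
  have hcv := lintegral_image_eq_lintegral_abs_deriv_mul (s := Ioi (0 : ℝ)) (f := fun t => s * t)
    (f' := fun _ => s) measurableSet_Ioi
    (fun t _ => by simpa using ((hasDerivAt_id t).const_mul s).hasDerivWithinAt)
    ((mul_right_injective₀ hs.ne').injOn)
    (fun t => ENNReal.ofReal (intensityConst α k / t ^ (1 + α k)) * F t)
  rw [himg] at hcv
  rw [hcv, ← lintegral_const_mul _ (by fun_prop)]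
  refine setLIntegral_congr_fun measurableSet_Ioi fun t ht => ?_
  have ht' : (0 : ℝ) < t := ht
  have e : intensityConst α k / t ^ (1 + α k)
      = s ^ α k * (s * (intensityConst α k / (s * t) ^ (1 + α k))) := by
    rw [Real.mul_rpow hs.le ht'.le, Real.rpow_add hs, Real.rpow_one]
    field_simp
  rw [e, ENNReal.ofReal_mul (Real.rpow_nonneg hs.le _), ENNReal.ofReal_mul hs.le, abs_of_pos hs]
  ring

include hpos hmono in
lemma intensity_Ioi (k : ℕ) {y : ℝ} (hy : 0 < y) :
    intensity α k (Ioi y) = ENNReal.ofReal (intensityConst α k / α k * y ^ (-α k)) := by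
  have hc := intensityConst_pos hpos hmono k
  have h1 : intensity α k (Ioi y) = ∫⁻ t in Ioi y, ENNReal.ofReal (intensityConst α k *
      t ^ (-(1 + α k))) := by
    rw [← lintegral_indicator_one measurableSet_Ioi,
      lintegral_intensity k (measurable_one.indicator measurableSet_Ioi)]
    have h2 : ∀ t : ℝ, ENNReal.ofReal (intensityConst α k / t ^ (1 + α k)) *
        (Ioi y).indicator (1 : ℝ → ℝ≥0∞) t = (Ioi y).indicator
          (fun t => ENNReal.ofReal (intensityConst α k / t ^ (1 + α k))) t := by
      intro t
      by_cases ht : t ∈ Ioi y <;> simp [ht]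
    simp_rw [h2]
    rw [lintegral_indicator measurableSet_Ioi, Measure.restrict_restrict measurableSet_Ioi,
      inter_eq_left.2 (Ioi_subset_Ioi hy.le)]
    refine setLIntegral_congr_fun measurableSet_Ioi fun t ht => ?_
    rw [Real.rpow_neg (hy.trans ht).le, div_eq_mul_inv]
  have h3 : -(1 + α k) < -1 := by linarith [hpos k]
  rw [h1, ← ofReal_integral_eq_lintegral_ofReal ((integrableOn_Ioi_rpow_of_lt h3 hy).const_mul _),
    integral_const_mul, integral_Ioi_rpow_of_lt h3 hy]
  · congr 1
    have e : -(1 + α k) + 1 = -α k := by ring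
    rw [e, neg_div_neg_eq]
    ring
  · filter_upwards [ae_restrict_mem measurableSet_Ioi] with t ht
    exact mul_nonneg hc.le (Real.rpow_nonneg (hy.trans ht).le _)

include hpos hmono in
/-- The Laplace exponent of a sum of powers of the points of the Poisson process. -/
lemma lintegral_intensity_rpow (k : ℕ) {p : ℝ} (hp : α k < p) :
    ∫⁻ t, (1 - expNeg (ENNReal.ofReal (t ^ p))) ∂(intensity α k)
      = ENNReal.ofReal (intensityConst α k / α k * Real.Gamma (1 - α k / p)) := by
  have hc := intensityConst_pos hpos hmono k
  have hp0 : 0 < p := (hpos k).trans hp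
  have : IsProbabilityMeasure (expMeasure 1) := isProbabilityMeasure_expMeasure one_pos
  -- `1 - e^{-u}` is the probability that a standard exponential variable is below `u`. After
  -- exchanging the integrals the tail of the intensity gives a multiple of `s ^ (-α k / p)`, whose
  -- exponential mean is a Gamma value.
  have h1 : ∫⁻ t, (1 - expNeg (ENNReal.ofReal (t ^ p))) ∂(intensity α k)
      = ∫⁻ t, ∫⁻ s, (if s < t ^ p then 1 else 0) ∂(expMeasure 1) ∂(intensity α k) := by
    refine lintegral_congr_ae ?_
    filter_upwards [ae_intensity_pos (α := α) k] with t ht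
    rw [← expMeasure_Iio (Real.rpow_nonneg ht.le _), ← lintegral_indicator_one measurableSet_Iio]
    refine lintegral_congr fun s => ?_
    by_cases h : s < t ^ p <;> simp [h]
  rw [h1, lintegral_lintegral_swap]
  · have h2 : ∫⁻ s, ∫⁻ t, (if s < t ^ p then 1 else 0) ∂(intensity α k) ∂(expMeasure 1)
        = ∫⁻ s, ENNReal.ofReal (intensityConst α k / α k) * ENNReal.ofReal (s ^ (-(α k / p)))
          ∂(expMeasure 1) := by
      refine lintegral_congr_ae ?_
      filter_upwards [ae_expMeasure_pos] with s hs
      have e : (s ^ p⁻¹) ^ (-α k) = s ^ (-(α k / p)) := by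
        rw [← Real.rpow_mul hs.le]; congr 1; field_simp
      rw [← ENNReal.ofReal_mul (div_pos hc (hpos k)).le, ← e,
        ← intensity_Ioi hpos hmono k (Real.rpow_pos_of_pos hs _),
        ← lintegral_indicator_one measurableSet_Ioi]
      refine lintegral_congr_ae ?_
      filter_upwards [ae_intensity_pos (α := α) k] with t ht
      have hiff : s < t ^ p ↔ s ^ p⁻¹ < t := by
        rw [Real.rpow_inv_lt_iff_of_pos hs.le ht.le hp0]
      by_cases h : s < t ^ p
      · have := hiff.1 h; simp [h, this]
      · have := mt hiff.2 h; simp [h, not_lt.1 this]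
    rw [h2, lintegral_const_mul _ (by fun_prop), lintegral_rpow_expMeasure,
      ← ENNReal.ofReal_mul (div_pos hc (hpos k)).le]
    · congr 2
    · have : α k / p < 1 := (div_lt_one hp0).2 hp
      linarith
  · refine Measurable.aemeasurable ?_
    exact Measurable.ite (measurableSet_lt measurable_snd
      ((measurable_id.pow_const p).comp measurable_fst)) measurable_const measurable_const

include hpos hmono in
-- The normalisation for which the constant `c_k` is chosen: its Gamma factor cancels the one of the
-- previous lemma.
lemma lintegral_intensity_rpow_succ (k : ℕ) :
    ∫⁻ t, (1 - expNeg (ENNReal.ofReal (t ^ α (k + 1)))) ∂(intensity α k) = 1 := by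
  have hG : 0 < Real.Gamma (1 - α k / α (k + 1)) := by
    refine Real.Gamma_pos_of_pos ?_
    rw [sub_pos, div_lt_one (hpos _)]
    exact hmono k.lt_succ_self
  rw [lintegral_intensity_rpow hpos hmono k (hmono k.lt_succ_self), intensityConst,
    ← ENNReal.ofReal_one]
  congr 1
  have := (hpos k).ne'
  field_simp

include hpos hmono in
/-- The Laplace exponent with an additional factor. -/
lemma lintegral_intensity_mul_rpow (k : ℕ) {B : ℝ} (hB : 0 < B) :
    ∫⁻ t, (1 - expNeg (ENNReal.ofReal (B * t ^ α (k + 1)))) ∂(intensity α k)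
      = ENNReal.ofReal (B ^ (α k / α (k + 1))) := by
  have hF : Measurable fun t : ℝ => 1 - expNeg (ENNReal.ofReal (t ^ α (k + 1))) :=
    Measurable.sub measurable_const (measurable_expNeg.comp (by fun_prop))
  have hs : 0 < B ^ (α (k + 1))⁻¹ := Real.rpow_pos_of_pos hB _
  have h := lintegral_intensity_comp_mul (α := α) k hF hs
  rw [lintegral_intensity_rpow_succ hpos hmono, mul_one, ← Real.rpow_mul hB.le] at h
  rw [show α k / α (k + 1) = (α (k + 1))⁻¹ * α k by ring, ← h]
  refine lintegral_congr_ae ?_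
  filter_upwards [ae_intensity_pos (α := α) k] with t ht
  rw [Real.mul_rpow hs.le ht.le, ← Real.rpow_mul hB.le, inv_mul_cancel₀ (hpos _).ne', Real.rpow_one]

include hpos hmono in
-- With `x = 1 - α k / α (k + 1)`, the bound `x * Γ x = Γ (x + 1) ≤ 1` gives `1 / Γ x ≥ x`.
lemma le_intensityConst (k : ℕ) :
    α k / α (k + 1) * (α (k + 1) - α k) ≤ intensityConst α k := by
  have hlt' := hmono k.lt_succ_self
  have h0 := hpos k
  have h1 := hpos (k + 1)
  set x := 1 - α k / α (k + 1) with hx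
  have hx0 : 0 < x := by
    rw [hx, sub_pos, div_lt_one (hpos _)]
    exact hlt'
  have hx1 : x ≤ 1 := by
    have : 0 < α k / α (k + 1) := div_pos h0 h1
    linarith
  have hG : 0 < Real.Gamma x := Real.Gamma_pos_of_pos hx0
  have h2 : x * Real.Gamma x ≤ 1 := by
    rw [← Real.Gamma_add_one hx0.ne']
    exact Gamma_le_one (by linarith) (by linarith)
  have h3 : α k / α (k + 1) * (α (k + 1) - α k) = α k * x := by
    rw [hx]; field_simp
  rw [h3, intensityConst, le_div_iff₀ hG, mul_assoc]
  exact mul_le_of_le_one_right h0.le h2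

/-- The Laplace exponent which is met when one more level is added. -/
noncomputable def levelExponent (α : ℕ → ℝ) (k : ℕ) (F : ℝ → ℝ≥0∞) : ℝ≥0∞ :=
  ∫⁻ t, (1 - expNeg (F t)) ∂(intensity α k)

/-- The function `u ↦ b (u ∧ u^p)`. -/
noncomputable def minRpow (b p u : ℝ) : ℝ≥0∞ := ENNReal.ofReal (b * min u (u ^ p))

lemma measurable_minRpow (b p : ℝ) : Measurable (minRpow b p) := by
  unfold minRpow; fun_prop

lemma exp_sub_exp_ge {x y : ℝ} (h1 : x ≤ y) (h2 : y ≤ 1) :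
    Real.exp (-1) * (y - x) ≤ Real.exp (-x) - Real.exp (-y) := by
  have e : Real.exp (-x) = Real.exp (-y) * Real.exp (y - x) := by
    rw [← Real.exp_add]; congr 1; ring
  have h3 := Real.add_one_le_exp (y - x)
  have h4 : Real.exp (-1) ≤ Real.exp (-y) := Real.exp_le_exp.2 (by linarith)
  calc Real.exp (-1) * (y - x) ≤ Real.exp (-y) * (y - x) :=
        mul_le_mul_of_nonneg_right h4 (by linarith)
    _ ≤ Real.exp (-y) * (Real.exp (y - x) - 1) :=
        mul_le_mul_of_nonneg_left (by linarith) (Real.exp_pos _).le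
    _ = _ := by rw [e]; ring

include hpos hmono hlt in
-- The integral of `t ^ (-1 - α_k) * (t ^ α_{k+1} - t)` over `(0, 1]` is `(1 - α_{k+1}) / ((α_{k+1}
-- - α_k) * (1 - α_k))`. By `le_intensityConst` the constant `c_k` absorbs the factor `α_{k+1} -
-- α_k` in the denominator, and what remains is the ratio of the divergent series.
lemma lintegral_intensity_loss (k : ℕ) {B : ℝ} (hB : 0 < B) :
    ENNReal.ofReal (α k / α (k + 1) * Real.exp (-1) * B * ((1 - α (k + 1)) / (1 - α k)))
      ≤ ∫⁻ t, (Iic 1).indicator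
        (fun t : ℝ => ENNReal.ofReal (Real.exp (-1) * (B * t ^ α (k + 1) - B * t))) t
          ∂(intensity α k) := by
  have hc := intensityConst_pos hpos hmono k
  have h1 := hmono k.lt_succ_self
  have h2 := hlt k
  have h3 := hlt (k + 1)
  have hi1 : IntervalIntegrable (fun t : ℝ => t ^ (α (k + 1) - 1 - α k)) volume 0 1 :=
    intervalIntegral.intervalIntegrable_rpow' (by linarith)
  have hi2 : IntervalIntegrable (fun t : ℝ => t ^ (-α k)) volume 0 1 :=
    intervalIntegral.intervalIntegrable_rpow' (by linarith)
  have hi : IntegrableOn (fun t : ℝ => intensityConst α k * Real.exp (-1) * B *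
      (t ^ (α (k + 1) - 1 - α k) - t ^ (-α k))) (Ioc 0 1) := by
    have := (hi1.sub hi2).const_mul (intensityConst α k * Real.exp (-1) * B)
    rwa [intervalIntegrable_iff_integrableOn_Ioc_of_le zero_le_one] at this
  have hval : ∫ t in Ioc (0 : ℝ) 1, intensityConst α k * Real.exp (-1) * B *
      (t ^ (α (k + 1) - 1 - α k) - t ^ (-α k))
      = intensityConst α k * Real.exp (-1) * B * (1 / (α (k + 1) - α k) - 1 / (1 - α k)) := by
    rw [← intervalIntegral.integral_of_le zero_le_one, intervalIntegral.integral_const_mul,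
      intervalIntegral.integral_sub hi1 hi2, integral_rpow (Or.inl (by linarith)),
      integral_rpow (Or.inl (by linarith))]
    have e1 : α (k + 1) - 1 - α k + 1 = α (k + 1) - α k := by ring
    have e2 : -α k + 1 = 1 - α k := by ring
    rw [e1, e2, Real.one_rpow, Real.one_rpow, Real.zero_rpow (by linarith),
      Real.zero_rpow (by linarith)]
    ring
  have hmeas : Measurable ((Iic 1).indicator
      (fun t : ℝ => ENNReal.ofReal (Real.exp (-1) * (B * t ^ α (k + 1) - B * t)))) :=
    Measurable.indicator (by fun_prop) measurableSet_Iic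
  have hR : ∫⁻ t, (Iic 1).indicator
        (fun t : ℝ => ENNReal.ofReal (Real.exp (-1) * (B * t ^ α (k + 1) - B * t))) t
          ∂(intensity α k)
      = ∫⁻ t in Ioc (0 : ℝ) 1, ENNReal.ofReal (intensityConst α k * Real.exp (-1) * B *
      (t ^ (α (k + 1) - 1 - α k) - t ^ (-α k))) := by
    rw [lintegral_intensity k hmeas, ← lintegral_indicator measurableSet_Ioi,
      ← lintegral_indicator measurableSet_Ioc]
    refine lintegral_congr fun t => ?_
    by_cases ht0 : 0 < t
    · by_cases ht1 : t ≤ 1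
      · rw [indicator_of_mem (show t ∈ Ioi (0 : ℝ) from ht0),
          indicator_of_mem (show t ∈ Iic (1 : ℝ) from ht1),
          indicator_of_mem (show t ∈ Ioc (0 : ℝ) 1 from ⟨ht0, ht1⟩),
          ← ENNReal.ofReal_mul (div_nonneg hc.le (Real.rpow_nonneg ht0.le _))]
        congr 1
        have e1 : t ^ (α (k + 1) - 1 - α k) = t ^ α (k + 1) / t ^ (1 + α k) := by
          rw [← Real.rpow_sub ht0]; congr 1; ring
        have e2 : t ^ (-α k) = t / t ^ (1 + α k) := by
          nth_rewrite 2 [← Real.rpow_one t]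
          rw [← Real.rpow_sub ht0]; congr 1; ring
        rw [e1, e2]
        ring
      · have h5 : t ∉ Iic (1 : ℝ) := by simpa using ht1
        have h6 : t ∉ Ioc (0 : ℝ) 1 := fun h => ht1 h.2
        simp [h5, h6]
    · have h5 : t ∉ Ioi (0 : ℝ) := by simpa using ht0
      have h6 : t ∉ Ioc (0 : ℝ) 1 := fun h => ht0 h.1
      simp [h5, h6]
  rw [hR, ← ofReal_integral_eq_lintegral_ofReal hi, hval]
  · apply ENNReal.ofReal_le_ofReal
    have h4 := le_intensityConst hpos hmono k
    have e : 1 / (α (k + 1) - α k) - 1 / (1 - α k)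
        = (1 - α (k + 1)) / ((α (k + 1) - α k) * (1 - α k)) := by
      rw [div_sub_div _ _ (by linarith) (by linarith)]; ring
    have h5 : 0 ≤ Real.exp (-1) * B * ((1 - α (k + 1)) / ((α (k + 1) - α k) * (1 - α k))) := by
      have : 0 ≤ (1 - α (k + 1)) / ((α (k + 1) - α k) * (1 - α k)) :=
        div_nonneg (by linarith) (mul_nonneg (by linarith) (by linarith))
      positivity
    have h6 := mul_le_mul_of_nonneg_right h4 h5
    rw [e]
    calc _ = α k / α (k + 1) * (α (k + 1) - α k) * (Real.exp (-1) * B *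
          ((1 - α (k + 1)) / ((α (k + 1) - α k) * (1 - α k)))) := by
          have : α (k + 1) - α k ≠ 0 := by linarith
          have : 1 - α k ≠ 0 := by linarith
          field_simp
      _ ≤ _ := h6.trans (by rw [mul_assoc, mul_assoc, mul_assoc])
  · filter_upwards [ae_restrict_mem measurableSet_Ioc] with t ht
    refine mul_nonneg (by positivity) (sub_nonneg.2 ?_)
    exact Real.rpow_le_rpow_of_exponent_ge ht.1 ht.2 (by linarith)

include hpos hmono hlt in
-- For `t ≤ 1` the minimum is `t` instead of `t ^ α_{k+1}`, and the gap between the two exponentials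
-- is the integrand of `lintegral_intensity_loss`. The condition `B ≤ 1` keeps the arguments at most
-- 1, which produces the factor `e⁻¹`.
lemma levelExponent_minRpow_add_le (k : ℕ) {B : ℝ} (hB : 0 < B) (hB1 : B ≤ 1) :
    levelExponent α k (minRpow B (α (k + 1))) + ENNReal.ofReal (α k / α (k + 1) * Real.exp (-1) * B *
      ((1 - α (k + 1)) / (1 - α k))) ≤ ENNReal.ofReal (B ^ (α k / α (k + 1))) := by
  refine (add_le_add_right (lintegral_intensity_loss hpos hmono hlt k hB) _).trans ?_
  have hm : Measurable ((Iic 1).indicator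
      (fun t : ℝ => ENNReal.ofReal (Real.exp (-1) * (B * t ^ α (k + 1) - B * t)))) :=
    Measurable.indicator (by fun_prop) measurableSet_Iic
  unfold levelExponent
  rw [← lintegral_add_right _ hm, ← lintegral_intensity_mul_rpow hpos hmono k hB]
  refine lintegral_mono_ae ?_
  filter_upwards [ae_intensity_pos (α := α) k] with t ht
  have hp := hpos (k + 1)
  have hr : 0 ≤ t ^ α (k + 1) := Real.rpow_nonneg ht.le _
  unfold minRpow
  by_cases ht1 : t ≤ 1
  · have h1 : t ≤ t ^ α (k + 1) := by
      conv_lhs => rw [← Real.rpow_one t]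
      exact Real.rpow_le_rpow_of_exponent_ge ht ht1 (hlt _).le
    have h2 : t ^ α (k + 1) ≤ 1 := Real.rpow_le_one ht.le ht1 hp.le
    have h3 : B * t ≤ B * t ^ α (k + 1) := mul_le_mul_of_nonneg_left h1 hB.le
    have h4 : B * t ^ α (k + 1) ≤ 1 := mul_le_one₀ hB1 hr h2
    have h5 := exp_sub_exp_ge h3 h4
    have h6 : 0 < B * t := mul_pos hB ht
    have h7 : Real.exp (-(B * t)) ≤ 1 := Real.exp_le_one_iff.2 (by linarith)
    rw [indicator_of_mem (show t ∈ Iic (1 : ℝ) from ht1), min_eq_left h1, expNeg_ofReal h6.le,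
      expNeg_ofReal (by positivity), ← ENNReal.ofReal_one, ← ENNReal.ofReal_sub _ (Real.exp_pos _).le,
      ← ENNReal.ofReal_sub _ (Real.exp_pos _).le, ← ENNReal.ofReal_add (by linarith)
        (mul_nonneg (Real.exp_pos _).le (by linarith))]
    exact ENNReal.ofReal_le_ofReal (by linarith)
  · rw [indicator_of_notMem (by simpa using ht1), add_zero]
    refine tsub_le_tsub_left (antitone_expNeg (ENNReal.ofReal_le_ofReal ?_)) _
    exact mul_le_mul_of_nonneg_left (min_le_right _ _) hB.le

/-- This turns a subtracted loss into a shift of the reciprocal, `1 / β ↦ 1 / β + x`, so that the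
losses of successive levels add up. It follows from `β ^ a' ≥ β ^ a * β`, `(1 + xβ) ^ a ≤ 1 + xβ`
and `(1 - xβ) * (1 + xβ) ≤ 1`. -/
lemma rpow_sub_le {a a' β x : ℝ} (ha : 0 < a) (haa : a < a') (ha' : a' < 1) (hβ : 0 < β)
    (hβ1 : β ≤ 1) (hx : 0 ≤ x) :
    β ^ a - x * β ^ a' ≤ (β / (1 + x * β)) ^ a := by
  have hxβ : 0 ≤ x * β := mul_nonneg hx hβ.le
  have h1 : β ^ a * β ≤ β ^ a' := by
    have : β ^ a' = β ^ a * β ^ (a' - a) := by rw [← Real.rpow_add hβ]; congr 1; ring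
    rw [this]
    refine mul_le_mul_of_nonneg_left ?_ (Real.rpow_nonneg hβ.le _)
    conv_lhs => rw [← Real.rpow_one β]
    exact Real.rpow_le_rpow_of_exponent_ge hβ hβ1 (by linarith)
  have h2 : (1 + x * β) ^ a ≤ 1 + x * β := by
    conv_rhs => rw [← Real.rpow_one (1 + x * β)]
    exact Real.rpow_le_rpow_of_exponent_le (by linarith) (by linarith)
  have h3 : 0 < β ^ a := Real.rpow_pos_of_pos hβ _
  have h4 : 0 < (1 + x * β) ^ a := Real.rpow_pos_of_pos (by linarith) _
  rw [Real.div_rpow hβ.le (by linarith), le_div_iff₀ h4]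
  have h5 : β ^ a - x * β ^ a' ≤ β ^ a * (1 - x * β) := by
    have := mul_le_mul_of_nonneg_left h1 hx
    linarith
  rcases le_or_gt (β ^ a - x * β ^ a') 0 with h | h
  · exact (mul_nonpos_of_nonpos_of_nonneg h h4.le).trans h3.le
  · calc (β ^ a - x * β ^ a') * (1 + x * β) ^ a ≤ (β ^ a - x * β ^ a') * (1 + x * β) :=
          mul_le_mul_of_nonneg_left h2 h.le
      _ ≤ β ^ a * (1 - x * β) * (1 + x * β) := mul_le_mul_of_nonneg_right h5 (by linarith)
      _ = β ^ a * (1 - (x * β) ^ 2) := by ring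
      _ ≤ β ^ a := mul_le_of_le_one_right h3.le (by nlinarith [sq_nonneg (x * β)])

include hpos hmono hlt in
/-- One more level decreases the Laplace exponent by a definite amount. -/
lemma levelExponent_minRpow_le (k : ℕ) {β κ : ℝ} (hβ : 0 < β) (hβ1 : β ≤ 1) (hκ0 : 0 ≤ κ)
    (hκ : κ ≤ α k / α (k + 1) * Real.exp (-1)) :
    levelExponent α k (minRpow (β ^ α (k + 1)) (α (k + 1)))
      ≤ ENNReal.ofReal ((β / (1 + κ * ((1 - α (k + 1)) / (1 - α k)) * β)) ^ α k) := by
  have hB : 0 < β ^ α (k + 1) := Real.rpow_pos_of_pos hβ _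
  have hB1 : β ^ α (k + 1) ≤ 1 := Real.rpow_le_one hβ.le hβ1 (hpos _).le
  have h := levelExponent_minRpow_add_le hpos hmono hlt k hB hB1
  have hr : 0 ≤ (1 - α (k + 1)) / (1 - α k) :=
    div_nonneg (by linarith [hlt (k + 1)]) (by linarith [hlt k])
  have h1 : (β ^ α (k + 1)) ^ (α k / α (k + 1)) = β ^ α k := by
    rw [← Real.rpow_mul hβ.le, mul_div_cancel₀ _ (hpos _).ne']
  rw [h1] at h
  have h2 := ENNReal.le_sub_of_add_le_right ENNReal.ofReal_ne_top h
  have hκ2 : 0 ≤ α k / α (k + 1) * Real.exp (-1) := hκ0.trans hκ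
  rw [← ENNReal.ofReal_sub _ (by positivity)] at h2
  refine h2.trans (ENNReal.ofReal_le_ofReal ?_)
  refine le_trans ?_ (rpow_sub_le (hpos k) (hmono k.lt_succ_self) (hlt _) hβ hβ1
    (mul_nonneg hκ0 hr))
  have h3 := mul_le_mul_of_nonneg_right hκ (mul_nonneg hr hB.le)
  nlinarith [h3]

lemma levelExponent_comp_mul (k : ℕ) {F : ℝ → ℝ≥0∞} (hF : Measurable F) {s : ℝ} (hs : 0 < s) :
    levelExponent α k (fun t => F (s * t)) = ENNReal.ofReal (s ^ α k) * levelExponent α k F := by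
  have hF' : Measurable fun t => 1 - expNeg (F t) :=
    Measurable.sub measurable_const (measurable_expNeg.comp hF)
  exact lintegral_intensity_comp_mul k hF' hs

include hpos hlt in
-- By scaling, averaging over `s` multiplies the exponent by the mean of `s ^ α k`, namely `Γ (1 + α
-- k) ≤ 1`.
lemma lintegral_levelExponent_expMeasure_le (k : ℕ) {F : ℝ → ℝ≥0∞} (hF : Measurable F) :
    ∫⁻ t, ∫⁻ s, (1 - expNeg (F (s * t))) ∂(expMeasure 1) ∂(intensity α k) ≤ levelExponent α k F := by
  have : IsProbabilityMeasure (expMeasure 1) := isProbabilityMeasure_expMeasure one_pos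
  rw [lintegral_lintegral_swap]
  · calc ∫⁻ s, ∫⁻ t, (1 - expNeg (F (s * t))) ∂(intensity α k) ∂(expMeasure 1)
        = ∫⁻ s, ENNReal.ofReal (s ^ α k) * levelExponent α k F ∂(expMeasure 1) := by
          refine lintegral_congr_ae ?_
          filter_upwards [ae_expMeasure_pos] with s hs
          exact levelExponent_comp_mul k hF hs
      _ = ENNReal.ofReal (Real.Gamma (1 + α k)) * levelExponent α k F := by
          rw [lintegral_mul_const _ (by fun_prop),
            lintegral_rpow_expMeasure (by linarith [hpos k])]
      _ ≤ 1 * levelExponent α k F := by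
          gcongr
          rw [← ENNReal.ofReal_one]
          exact ENNReal.ofReal_le_ofReal
            (Gamma_le_one (by linarith [hpos k]) (by linarith [hlt k]))
      _ = _ := one_mul _
  · refine Measurable.aemeasurable (Measurable.sub measurable_const (measurable_expNeg.comp ?_))
    exact hF.comp (measurable_snd.mul measurable_fst)

end Intensity

/-! ### Sums over words -/

/-- Words of length `m + 1` by their first letter. -/
def consVectorEquiv (m : ℕ) : ℕ × List.Vector ℕ m ≃ List.Vector ℕ (m + 1) where
  toFun p := p.1 ::ᵥ p.2
  invFun w := (w.head, w.tail)
  left_inv p := by simp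
  right_inv w := by simp

lemma tsum_vector_zero (F : List ℕ → ℝ≥0∞) : ∑' w : List.Vector ℕ 0, F w.toList = F [] := by
  rw [tsum_eq_single List.Vector.nil fun w hw => absurd (Subsingleton.elim w _) hw]
  rfl

lemma tsum_vector_succ (m : ℕ) (F : List ℕ → ℝ≥0∞) :
    ∑' w : List.Vector ℕ (m + 1), F w.toList
      = ∑' x : ℕ, ∑' w : List.Vector ℕ m, F (x :: w.toList) := by
  rw [← (consVectorEquiv m).tsum_eq, ENNReal.tsum_prod']
  rfl

lemma tsum_vector_succ' (m : ℕ) (F : List ℕ → ℝ≥0∞) :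
    ∑' w : List.Vector ℕ (m + 1), F w.toList
      = ∑' w : List.Vector ℕ m, ∑' x : ℕ, F (w.toList ++ [x]) := by
  induction m generalizing F with
  | zero =>
    rw [tsum_vector_succ, tsum_vector_zero fun w => ∑' x : ℕ, F (w ++ [x])]
    exact tsum_congr fun x => tsum_vector_zero fun w => F (x :: w)
  | succ m ih =>
    rw [tsum_vector_succ, tsum_vector_succ m fun w => ∑' x : ℕ, F (w ++ [x])]
    exact tsum_congr fun x => ih fun w => F (x :: w)

namespace Data

variable {Ω : Type*} (D : Data Ω)

lemma pathProd_append_singleton (ω : Ω) (v w : List ℕ) (x : ℕ) :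
    D.pathProd ω v (w ++ [x]) = D.pathProd ω v w * D.g ω (v ++ w) x := by
  induction w generalizing v with
  | nil => simp [pathProd]
  | cons y w ih => simp [pathProd, ih, mul_assoc]

lemma pathProd_ne_top (ω : Ω) (v w : List ℕ) : D.pathProd ω v w ≠ ∞ := by
  induction w generalizing v with
  | nil => simp [pathProd]
  | cons y w ih => exact ENNReal.mul_ne_top ENNReal.ofReal_ne_top (ih _)

lemma partialW_zero (α : ℕ → ℝ) (ω : Ω) (v : List ℕ) : D.partialW α ω v 0 = 1 := by
  unfold partialW
  rw [tsum_vector_zero fun w => D.pathProd ω v w ^ α (v.length + 0)]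
  simp [pathProd]

lemma partialW_succ {α : ℕ → ℝ} (hα : ∀ k, 0 < α k) (ω : Ω) (v : List ℕ) (m : ℕ) :
    D.partialW α ω v (m + 1)
      = ∑' x, D.g ω v x ^ α (v.length + (m + 1)) * D.partialW α ω (v ++ [x]) m := by
  unfold partialW
  rw [tsum_vector_succ m fun w => D.pathProd ω v w ^ α (v.length + (m + 1))]
  refine tsum_congr fun x => ?_
  rw [← ENNReal.tsum_mul_left]
  refine tsum_congr fun w => ?_
  have e : (v ++ [x]).length + m = v.length + (m + 1) := by simp; omega
  rw [e, pathProd, ENNReal.mul_rpow_of_nonneg _ _ (hα _).le]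

/-- Splitting off the last generation serves the submartingale property in `m`; `partialW_succ`,
which splits off the first, serves the recursion along the tree. -/
lemma partialW_succ' {α : ℕ → ℝ} (hα : ∀ k, 0 < α k) (ω : Ω) (v : List ℕ) (m : ℕ) :
    D.partialW α ω v (m + 1)
      = ∑' w : List.Vector ℕ m, D.pathProd ω v w.toList ^ α (v.length + (m + 1)) *
          D.partialW α ω (v ++ w.toList) 1 := by
  unfold partialW
  rw [tsum_vector_succ' m fun w => D.pathProd ω v w ^ α (v.length + (m + 1))]
  refine tsum_congr fun w => ?_
  rw [tsum_vector_succ' 0 fun u => D.pathProd ω (v ++ w.toList) u ^ α ((v ++ w.toList).length + 1),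
    tsum_vector_zero fun u => ∑' x, D.pathProd ω (v ++ w.toList) (u ++ [x]) ^
      α ((v ++ w.toList).length + 1), ← ENNReal.tsum_mul_left]
  refine tsum_congr fun x => ?_
  have e : (v ++ w.toList).length + 1 = v.length + (m + 1) := by simp; omega
  rw [e, pathProd_append_singleton, ENNReal.mul_rpow_of_nonneg _ _ (hα _).le]
  simp [pathProd]

/-- The quenched rates obtained from the terminal rates `w₀` by adding levels from the bottom. -/
noncomputable def backRate (w₀ : Ω → List ℕ → ℝ≥0∞) (ω : Ω) : ℕ → List ℕ → ℝ≥0∞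
  | 0, v => w₀ ω v
  | j + 1, v => ∑' x, frac (backRate w₀ ω j (v ++ [x]) * D.g ω v x)

lemma measurable_backRate {m : MeasurableSpace Ω} (w₀ : Ω → List ℕ → ℝ≥0∞) (j : ℕ) {v : List ℕ}
    (hγ : ∀ u x, Measurable (D.γ (v ++ u) x)) (hw : ∀ u, Measurable fun ω => w₀ ω (v ++ u)) :
    Measurable fun ω => D.backRate w₀ ω j v := by
  induction j generalizing v with
  | zero =>
    have h0 := hw []
    simp only [List.append_nil] at h0
    exact h0
  | succ j ih =>
    refine measurable_tsum fun x => measurable_frac.comp (measurable_mul ?_ ?_)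
    · exact ih (fun u y => by simpa using hγ ([x] ++ u) y) fun u => by simpa using hw ([x] ++ u)
    · simpa [g] using (hγ [] x).ennreal_ofReal

end Data

/-- The parameters of the strict descendants of `v`. -/
def envBelow (v : List ℕ) : Set Source := {s | ∃ u, s = Source.env (v ++ u)}

lemma disjoint_envBelow {v w : List ℕ} (h : v.length = w.length) (hne : v ≠ w) :
    Disjoint (envBelow v) (envBelow w) := by
  rw [Set.disjoint_left]
  rintro s ⟨u, rfl⟩ ⟨u', h'⟩
  injection h' with h'
  exact hne (List.append_inj_left h' h)

namespace Data.IsGREM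

variable {Ω : Type*} [m0 : MeasurableSpace Ω] {P : Measure Ω} [IsProbabilityMeasure P]
  {D : Data Ω} {α : ℕ → ℝ}

lemma ae_γ_pos (hD : D.IsGREM α P) : ∀ᵐ ω ∂P, ∀ v x, 0 < D.γ v x ω := by
  rw [ae_all_iff]
  intro v
  have h0 : intensity α v.length (Iic 0) = 0 := by
    have := ae_intensity_pos (α := α) v.length
    rw [ae_iff] at this
    rw [← this]; congr 1; ext s; simp
  filter_upwards [(hD.poisson_γ v).ae_notMem measurableSet_Iic h0] with ω hω x
  simpa using hω x

/-- A lower bound for the Laplace transform of a sum over the children of a vertex. -/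
lemma le_lintegral_expNeg_children (hD : D.IsGREM α P) (v : List ℕ)
    {K : ℝ≥0∞ × ℝ≥0∞ → ℝ≥0∞} (hK : Measurable K) {w : ℕ → Ω → ℝ≥0∞}
    (hw : ∀ x, Measurable[D.algebraOf (envBelow (v ++ [x]))] (w x))
    {Ψ : ℝ → ℝ≥0∞} (hΨ : Measurable Ψ)
    (hle : ∀ x t, 0 < t → 1 - Ψ t ≤ ∫⁻ ω, expNeg (K (ENNReal.ofReal t, w x ω)) ∂P) :
    expNeg (∫⁻ t, Ψ t ∂(intensity α v.length))
      ≤ ∫⁻ ω, expNeg (∑' x, K (D.g ω v x, w x ω)) ∂P := by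
  set S₁ : Set Source := {Source.env v}
  set S₂ : Set Source := ⋃ x, envBelow (v ++ [x])
  have hd : Disjoint S₁ S₂ := by
    rw [Set.disjoint_singleton_left]
    rintro h
    obtain ⟨x, u, hu⟩ := mem_iUnion.1 h
    injection hu with hu
    have := congrArg List.length hu
    simp at this
  have hw2 : ∀ x, Measurable[D.algebraOf S₂] (w x) := fun x =>
    (hw x).mono (D.algebraOf_mono (subset_iUnion (fun x => envBelow (v ++ [x])) x)) le_rfl
  have hH : Measurable[(D.algebraOf S₁).prod (D.algebraOf S₂)] fun p : Ω × Ω =>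
      expNeg (∑' x, K (D.g p.1 v x, w x p.2)) := by
    refine measurable_expNeg.comp (measurable_tsum fun x => hK.comp (Measurable.prodMk ?_ ?_))
    · exact (ENNReal.measurable_ofReal.comp (D.measurable_γ_algebraOf (S := S₁) rfl x)).comp
        (@measurable_fst _ _ (D.algebraOf S₁) (D.algebraOf S₂))
    · exact (hw2 x).comp (@measurable_snd _ _ (D.algebraOf S₁) (D.algebraOf S₂))
  rw [lintegral_diag_of_indep (hD.algebraOf_le S₁) (hD.algebraOf_le S₂) (hD.indep_algebraOf hd) hH]
  have hinner : ∀ ω, ∫⁻ ω', expNeg (∑' x, K (D.g ω v x, w x ω')) ∂P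
      = expNeg (∑' x, negLog (∫⁻ ω', expNeg (K (D.g ω v x, w x ω')) ∂P)) := by
    intro ω
    refine lintegral_expNeg_tsum (B := fun x => envBelow (v ++ [x])) hD.sourceAlgebra_le hD.indep
      (fun x y hxy => disjoint_envBelow (by simp) (by simpa using hxy)) fun x => ?_
    exact hK.comp (Measurable.prodMk measurable_const (hw x))
  simp_rw [hinner]
  have hneg : Measurable fun t => negLog (1 - Ψ t) :=
    measurable_negLog.comp (Measurable.sub measurable_const hΨ)
  -- `Ψ` may exceed 1; subtraction in `ℝ≥0∞` truncates, and `1 - (1 - Ψ) ≤ Ψ` is the direction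
  -- needed.
  calc expNeg (∫⁻ t, Ψ t ∂(intensity α v.length))
      ≤ expNeg (∫⁻ t, (1 - expNeg (negLog (1 - Ψ t))) ∂(intensity α v.length)) := by
        refine antitone_expNeg (lintegral_mono fun t => ?_)
        rw [expNeg_negLog tsub_le_self]
        exact tsub_tsub_le
    _ = ∫⁻ ω, expNeg (∑' x, negLog (1 - Ψ (D.γ v x ω))) ∂P :=
        ((hD.poisson_γ v).lintegral_expNeg_tsum hneg).symm
    _ ≤ _ := by
        refine lintegral_mono_ae ?_
        filter_upwards [hD.ae_γ_pos] with ω hω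
        refine antitone_expNeg (ENNReal.tsum_le_tsum fun x => ?_)
        rw [← strictAnti_expNeg.le_iff_ge, expNeg_negLog tsub_le_self,
          expNeg_negLog (lintegral_expNeg_le_one P _)]
        exact hle x _ (hω v x)

end Data.IsGREM

/-! ### The variables `W` -/

/-- The parameters of the vertices at depth less than `n`. -/
def envBefore (n : ℕ) : Set Source := {s | ∃ u : List ℕ, u.length < n ∧ s = Source.env u}

lemma disjoint_envBefore (n : ℕ) {v : List ℕ} (hv : n ≤ v.length) :
    Disjoint (envBefore n) (envBelow v) := by
  rw [Set.disjoint_left]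
  rintro s ⟨u, hu, rfl⟩ ⟨u', h'⟩
  injection h' with h'
  rw [h', List.length_append] at hu
  omega

namespace Data

variable {Ω : Type*} (D : Data Ω)

lemma measurable_pathProd_envBefore (w : List ℕ) {v : List ℕ} {n : ℕ} (h : v.length + w.length ≤ n) :
    Measurable[D.algebraOf (envBefore n)] fun ω => D.pathProd ω v w := by
  induction w generalizing v with
  | nil => exact measurable_const
  | cons x w ih =>
    simp only [List.length_cons] at h
    refine measurable_mul ?_ (ih (by simp; omega))
    exact ENNReal.measurable_ofReal.comp
      (D.measurable_γ_algebraOf (S := envBefore n) ⟨v, by omega, rfl⟩ x)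

lemma measurable_partialW_envBefore (α : ℕ → ℝ) (v : List ℕ) (m : ℕ) :
    Measurable[D.algebraOf (envBefore (v.length + m))] fun ω => D.partialW α ω v m :=
  measurable_tsum fun w => (D.measurable_pathProd_envBefore w.toList (by simp)).pow_const _

lemma measurable_partialW_envBelow (α : ℕ → ℝ) (v : List ℕ) (m : ℕ) :
    Measurable[D.algebraOf (envBelow v)] fun ω => D.partialW α ω v m :=
  D.measurable_partialW (fun u x => D.measurable_γ_algebraOf (S := envBelow v) ⟨u, rfl⟩ x) α m

lemma measurable_W_envBelow (α : ℕ → ℝ) (v : List ℕ) :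
    Measurable[D.algebraOf (envBelow v)] fun ω => D.W α ω v :=
  D.measurable_W (fun u x => D.measurable_γ_algebraOf (S := envBelow v) ⟨u, rfl⟩ x) α

end Data

namespace Data.IsGREM

variable {Ω : Type*} [m0 : MeasurableSpace Ω] {P : Measure Ω} [IsProbabilityMeasure P]
  {D : Data Ω} {α : ℕ → ℝ}

section

variable (hpos : ∀ k, 0 < α k) (hmono : StrictMono α)

include hpos hmono in
-- Induction from the top of the tree. A child with parameter `t` sees the argument `l * t ^ a₂`;
-- the bound for it is a multiple of `t ^ α (|v| + 1)`, whose Laplace exponent is the explicit one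
-- of `lintegral_intensity_mul_rpow`.
lemma le_lintegral_expNeg_partialW (hD : D.IsGREM α P) (m : ℕ) (v : List ℕ) {l : ℝ} (hl : 0 ≤ l) :
    expNeg (ENNReal.ofReal (l ^ (α v.length / α (v.length + m))))
      ≤ ∫⁻ ω, expNeg (ENNReal.ofReal l * D.partialW α ω v m) ∂P := by
  induction m generalizing v l with
  | zero =>
    simp [D.partialW_zero, div_self (hpos v.length).ne']
  | succ m ih =>
    rcases hl.eq_or_lt with rfl | hl
    · simp [Real.zero_rpow (div_pos (hpos _) (hpos _)).ne']
    set a₂ := α (v.length + (m + 1)) with ha₂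
    have ha₂0 : 0 < a₂ := hpos _
    have hK : Measurable fun p : ℝ≥0∞ × ℝ≥0∞ => ENNReal.ofReal l * (p.1 ^ a₂ * p.2) :=
      measurable_mul measurable_const (measurable_mul (measurable_fst.pow_const _) measurable_snd)
    have hB : 0 < l ^ (α (v.length + 1) / a₂) := Real.rpow_pos_of_pos hl _
    have hΨ : Measurable fun t : ℝ => 1 - expNeg (ENNReal.ofReal
        (l ^ (α (v.length + 1) / a₂) * t ^ α (v.length + 1))) :=
      Measurable.sub measurable_const (measurable_expNeg.comp (by fun_prop))
    have key := hD.le_lintegral_expNeg_children v hK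
      (w := fun x ω => D.partialW α ω (v ++ [x]) m)
      (fun x => D.measurable_partialW_envBelow α (v ++ [x]) m) hΨ ?_
    · rw [lintegral_intensity_mul_rpow hpos hmono v.length hB, ← Real.rpow_mul hl.le,
        show α (v.length + 1) / a₂ * (α v.length / α (v.length + 1)) = α v.length / a₂ by
          have := (hpos (v.length + 1)).ne'
          field_simp] at key
      refine key.trans (le_of_eq (lintegral_congr fun ω => ?_))
      rw [D.partialW_succ hpos, ← ENNReal.tsum_mul_left]
    · intro x t ht
      rw [one_sub_one_sub_expNeg]
      have h1 := ih (v ++ [x]) (l := l * t ^ a₂) (by positivity)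
      have e1 : (v ++ [x]).length = v.length + 1 := by simp
      have e2 : v.length + 1 + m = v.length + (m + 1) := by omega
      rw [e1, e2, ← ha₂, Real.mul_rpow hl.le (by positivity), ← Real.rpow_mul ht.le,
        mul_div_cancel₀ _ ha₂0.ne'] at h1
      refine h1.trans (le_of_eq (lintegral_congr fun ω => ?_))
      rw [ENNReal.ofReal_mul hl.le, ENNReal.ofReal_rpow_of_pos ht, mul_assoc]

include hpos hmono in
-- Given the earlier generations, the variables `partialW 1` at the vertices of depth `|v| + m` are
-- independent. The bound for one level at the argument `pathProd ^ α (|v| + m + 1)` has exponent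
-- `pathProd ^ α (|v| + m)`, the corresponding term of the present sum.
lemma submartingale_partialW (hD : D.IsGREM α P) (v : List ℕ) (m : ℕ) {A : Set Ω}
    (hA : MeasurableSet[D.algebraOf (envBefore (v.length + m))] A) :
    ∫⁻ ω in A, expNeg (D.partialW α ω v m) ∂P
      ≤ ∫⁻ ω in A, expNeg (D.partialW α ω v (m + 1)) ∂P := by
  set a₂ := α (v.length + (m + 1)) with ha₂
  have ha₂0 : 0 < a₂ := hpos _
  set S₁ := envBefore (v.length + m)
  set S₂ : Set Source := ⋃ w : List.Vector ℕ m, envBelow (v ++ w.toList)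
  have hd : Disjoint S₁ S₂ := by
    rw [disjoint_iUnion_right]
    exact fun w => disjoint_envBefore _ (by simp)
  have hA0 : MeasurableSet A := hD.algebraOf_le S₁ _ hA
  have hH : Measurable[(D.algebraOf S₁).prod (D.algebraOf S₂)] fun p : Ω × Ω =>
      A.indicator 1 p.1 * expNeg (∑' w : List.Vector ℕ m, D.pathProd p.1 v w.toList ^ a₂ *
        D.partialW α p.2 (v ++ w.toList) 1) := by
    refine measurable_mul ?_ (measurable_expNeg.comp (measurable_tsum fun w => measurable_mul ?_ ?_))
    · exact (Measurable.indicator measurable_const hA).comp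
        (@measurable_fst _ _ (D.algebraOf S₁) (D.algebraOf S₂))
    · exact ((D.measurable_pathProd_envBefore w.toList (by simp)).pow_const a₂).comp
        (@measurable_fst _ _ (D.algebraOf S₁) (D.algebraOf S₂))
    · exact ((D.measurable_partialW_envBelow α (v ++ w.toList) 1).mono
        (D.algebraOf_mono (subset_iUnion (fun w : List.Vector ℕ m => envBelow (v ++ w.toList)) w))
          le_rfl).comp (@measurable_snd _ _ (D.algebraOf S₁) (D.algebraOf S₂))
  have hind : ∀ F : Ω → ℝ≥0∞, ∫⁻ ω in A, F ω ∂P = ∫⁻ ω, A.indicator 1 ω * F ω ∂P := by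
    intro F
    rw [← lintegral_indicator hA0]
    refine lintegral_congr fun ω => ?_
    by_cases h : ω ∈ A <;> simp [h]
  rw [hind, hind]
  simp only [fun ω => D.partialW_succ' hpos ω v m]
  rw [lintegral_diag_of_indep (hD.algebraOf_le S₁) (hD.algebraOf_le S₂) (hD.indep_algebraOf hd) hH]
  refine lintegral_mono fun ω => ?_
  simp only []
  rw [lintegral_const_mul' _ _ (by by_cases h : ω ∈ A <;> simp [h])]
  gcongr
  rw [lintegral_expNeg_tsum (B := fun w : List.Vector ℕ m => envBelow (v ++ w.toList))
    hD.sourceAlgebra_le hD.indep (fun x y hxy => disjoint_envBelow (by simp) (by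
      intro h
      exact hxy (Subtype.ext (List.append_cancel_left h)))) (fun w => measurable_mul measurable_const
      (D.measurable_partialW_envBelow α (v ++ w.toList) 1))]
  refine antitone_expNeg (ENNReal.tsum_le_tsum fun w => ?_)
  rw [← strictAnti_expNeg.le_iff_ge, expNeg_negLog (lintegral_expNeg_le_one P _)]
  have hp := D.pathProd_ne_top ω v w.toList
  have h1 := hD.le_lintegral_expNeg_partialW hpos hmono 1 (v ++ w.toList)
    (l := (D.pathProd ω v w.toList).toReal ^ a₂) (by positivity)
  have e1 : (v ++ w.toList).length = v.length + m := by simp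
  have e2 : v.length + m + 1 = v.length + (m + 1) := by omega
  rw [e1, e2, ← ha₂, ← Real.rpow_mul ENNReal.toReal_nonneg, mul_div_cancel₀ _ ha₂0.ne',
    ← ENNReal.ofReal_rpow_of_nonneg ENNReal.toReal_nonneg (hpos _).le, ENNReal.ofReal_toReal hp,
    ← ENNReal.ofReal_rpow_of_nonneg ENNReal.toReal_nonneg ha₂0.le, ENNReal.ofReal_toReal hp] at h1
  exact h1

include hpos hmono in
lemma ae_tendsto_partialW (hD : D.IsGREM α P) :
    ∀ᵐ ω ∂P, ∀ v, Tendsto (fun m => D.partialW α ω v m) atTop (𝓝 (D.W α ω v)) := by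
  rw [ae_all_iff]
  intro v
  have h := ae_exists_tendsto_of_submartingale (P := P)
    (ℱ := fun m => D.algebraOf (envBefore (v.length + m)))
    (fun i j hij => D.algebraOf_mono fun s ⟨u, hu, hs⟩ => ⟨u, by omega, hs⟩)
    (fun n => hD.algebraOf_le _) (fun n => D.measurable_partialW_envBefore α v n)
    (fun n A hA => hD.submartingale_partialW hpos hmono v n hA)
  filter_upwards [h] with ω ⟨y, hy⟩
  have : D.W α ω v = y := hy.limsup_eq
  rwa [this]

variable (htend : Tendsto α atTop (𝓝 1))

include hpos hmono htend in
lemma le_lintegral_expNeg_W (hD : D.IsGREM α P) (v : List ℕ) {l : ℝ} (hl : 0 ≤ l) :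
    expNeg (ENNReal.ofReal (l ^ α v.length))
      ≤ ∫⁻ ω, expNeg (ENNReal.ofReal l * D.W α ω v) ∂P := by
  have hm : ∀ m, Measurable fun ω => D.partialW α ω v m := fun m =>
    (D.measurable_partialW_envBelow α v m).mono (hD.algebraOf_le _) le_rfl
  have h1 : Tendsto (fun m => ∫⁻ ω, expNeg (ENNReal.ofReal l * D.partialW α ω v m) ∂P) atTop
      (𝓝 (∫⁻ ω, expNeg (ENNReal.ofReal l * D.W α ω v) ∂P)) := by
    refine tendsto_lintegral_of_dominated_convergence (fun _ => 1) ?_ ?_ (by simp) ?_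
    · exact fun m => measurable_expNeg.comp (measurable_mul measurable_const (hm m))
    · exact fun m => ae_of_all _ fun ω => expNeg_le_one _
    · filter_upwards [hD.ae_tendsto_partialW hpos hmono] with ω hω
      exact (continuous_expNeg.tendsto _).comp
        (ENNReal.Tendsto.const_mul (hω v) (Or.inr ENNReal.ofReal_ne_top))
  have h2 : Tendsto (fun m => expNeg (ENNReal.ofReal (l ^ (α v.length / α (v.length + m))))) atTop
      (𝓝 (expNeg (ENNReal.ofReal (l ^ α v.length)))) := by
    refine (continuous_expNeg.tendsto _).comp (ENNReal.tendsto_ofReal ?_)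
    have h3 : Tendsto (fun m => α v.length / α (v.length + m)) atTop (𝓝 (α v.length)) := by
      have : Tendsto (fun m => α (v.length + m)) atTop (𝓝 1) := by
        refine htend.comp ?_
        exact (tendsto_add_atTop_nat v.length).congr fun m => add_comm _ _
      have h4 : Tendsto (fun _ : ℕ => α v.length) atTop (𝓝 (α v.length)) := tendsto_const_nhds
      have h5 := h4.div this one_ne_zero
      rwa [div_one] at h5
    exact (Real.continuousAt_const_rpow' (hpos _).ne').tendsto.comp h3
  exact le_of_tendsto_of_tendsto' h2 h1 fun m => hD.le_lintegral_expNeg_partialW hpos hmono m v hl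

include hpos hmono htend in
-- Finite parts of the recursion `partialW_succ` pass to the limit, since the exponents tend to 1.
-- Mass may escape to infinitely many children in the limit, but the inequality suffices for the
-- submartingale property of the clocks.
lemma ae_tsum_W_le (hD : D.IsGREM α P) :
    ∀ᵐ ω ∂P, ∀ v, ∑' x, D.W α ω (v ++ [x]) * D.g ω v x ≤ D.W α ω v := by
  filter_upwards [hD.ae_tendsto_partialW hpos hmono, hD.ae_γ_pos] with ω hω hγ v
  have h1 : Tendsto (fun m => D.partialW α ω v (m + 1)) atTop (𝓝 (D.W α ω v)) :=
    (hω v).comp (tendsto_add_atTop_nat 1)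
  refine ENNReal.tsum_le_of_sum_range_le fun N => ?_
  have h2 : Tendsto (fun m => ∑ x ∈ Finset.range N,
      D.g ω v x ^ α (v.length + (m + 1)) * D.partialW α ω (v ++ [x]) m) atTop
      (𝓝 (∑ x ∈ Finset.range N, D.g ω v x * D.W α ω (v ++ [x]))) := by
    refine tendsto_finsetSum _ fun x _ => ENNReal.Tendsto.mul ?_ ?_ (hω _) ?_
    · have h3 : Tendsto (fun m => α (v.length + (m + 1))) atTop (𝓝 1) := by
        refine htend.comp ?_
        have := tendsto_add_atTop_nat (v.length + 1)
        refine this.congr fun m => by ring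
      have h4 : Tendsto (fun m => ENNReal.ofReal (D.γ v x ω ^ α (v.length + (m + 1)))) atTop
          (𝓝 (ENNReal.ofReal (D.γ v x ω ^ (1 : ℝ)))) :=
        ENNReal.tendsto_ofReal ((Real.continuousAt_const_rpow (hγ v x).ne').tendsto.comp h3)
      rw [Real.rpow_one] at h4
      refine h4.congr fun m => ?_
      rw [g, ENNReal.ofReal_rpow_of_pos (hγ v x)]
    · left
      simpa [g] using hγ v x
    · right
      exact ENNReal.ofReal_ne_top
  simp_rw [mul_comm (D.W α ω _)]
  refine le_of_tendsto_of_tendsto' h2 h1 fun m => ?_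
  rw [D.partialW_succ hpos]
  exact ENNReal.sum_le_tsum _

end

end Data.IsGREM

/-! ### The quenched rates -/

lemma frac_le (u : ℝ≥0∞) : frac u ≤ u := by
  unfold frac
  rw [tsub_le_iff_left]
  rcases eq_or_ne u ∞ with rfl | hu
  · simp
  lift u to ℝ≥0 using hu
  have h : ((1 : ℝ≥0∞) + u)⁻¹ = ((1 + u)⁻¹ : ℝ≥0) := by
    rw [ENNReal.coe_inv (by positivity)]; simp
  rw [h]
  norm_cast
  rw [← NNReal.coe_le_coe]
  push_cast
  have hu0 := u.coe_nonneg
  have h1 : (0 : ℝ) < 1 + u := by positivity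
  rw [← sub_nonneg]
  have : (1 + (u : ℝ))⁻¹ + u - 1 = u ^ 2 / (1 + u) := by field_simp; ring
  rw [this]
  positivity

lemma frac_eq_lintegral (u : ℝ≥0∞) :
    frac u = ∫⁻ s, (1 - expNeg (u * ENNReal.ofReal s)) ∂(expMeasure 1) := by
  have : IsProbabilityMeasure (expMeasure 1) := isProbabilityMeasure_expMeasure one_pos
  rw [lintegral_sub, lintegral_expNeg_mul_expMeasure, frac]
  · simp
  · exact measurable_expNeg.comp (measurable_const.mul ENNReal.measurable_ofReal)
  · rw [lintegral_expNeg_mul_expMeasure]; simp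
  · exact ae_of_all _ fun s => expNeg_le_one _

lemma frac_pos {u : ℝ≥0∞} (hu : u ≠ 0) : frac u ≠ 0 := by
  unfold frac
  rw [ne_eq, tsub_eq_zero_iff_le, not_le, ENNReal.inv_lt_one]
  rcases eq_or_ne u ∞ with rfl | hu'
  · simp
  · exact ENNReal.lt_add_right ENNReal.one_ne_top hu

/-- The inequality `1 - y ≤ e^{-y}`, averaged. It yields the bounds which are linear in `l`. -/
lemma one_sub_lintegral_le {Ω : Type*} [MeasurableSpace Ω] (P : Measure Ω)
    [IsProbabilityMeasure P] {y : Ω → ℝ≥0∞} (hy : Measurable y) :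
    1 - ∫⁻ ω, y ω ∂P ≤ ∫⁻ ω, expNeg (y ω) ∂P := by
  rw [tsub_le_iff_right, ← lintegral_add_right _ hy]
  calc (1 : ℝ≥0∞) = ∫⁻ ω, 1 ∂P := by simp
    _ ≤ _ := lintegral_mono fun ω => tsub_le_iff_left.1 (one_sub_expNeg_le _)

lemma Data.measurable_backRate_envBelow {Ω : Type*} {D : Data Ω}
    {w₀ : Ω → List ℕ → ℝ≥0∞}
    (hw : ∀ v, Measurable[D.algebraOf (envBelow v)] fun ω => w₀ ω v) (j : ℕ) (v : List ℕ) :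
    Measurable[D.algebraOf (envBelow v)] fun ω => D.backRate w₀ ω j v := by
  refine D.measurable_backRate w₀ j (fun u x => D.measurable_γ_algebraOf (S := envBelow v) ⟨u, rfl⟩ x)
    fun u => ?_
  refine (hw (v ++ u)).mono (D.algebraOf_mono ?_) le_rfl
  rintro s ⟨u', rfl⟩
  exact ⟨u ++ u', by simp⟩

namespace Data.IsGREM

variable {Ω : Type*} [m0 : MeasurableSpace Ω] {P : Measure Ω} [IsProbabilityMeasure P]
  {D : Data Ω} {α : ℕ → ℝ}

/-! ### One-level recursions for the Laplace transforms of the rates -/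

section Step

variable {w₀ : Ω → List ℕ → ℝ≥0∞} {v : List ℕ} {j : ℕ} {F : ℝ → ℝ≥0∞}

/-- The bound `frac u ≤ u` removes the fraction; scaling of the intensity then produces the power of
`l`. This is the efficient bound for large `l`. -/
lemma le_lintegral_expNeg_backRate_rpow (hD : D.IsGREM α P)
    (hw : ∀ v, Measurable[D.algebraOf (envBelow v)] fun ω => w₀ ω v) (hF : Measurable F)
    (hle : ∀ x u, 0 < u →
      expNeg (F u) ≤ ∫⁻ ω, expNeg (ENNReal.ofReal u * D.backRate w₀ ω j (v ++ [x])) ∂P)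
    {l : ℝ} (hl : 0 < l) :
    expNeg (ENNReal.ofReal (l ^ α v.length) * levelExponent α v.length F)
      ≤ ∫⁻ ω, expNeg (ENNReal.ofReal l * D.backRate w₀ ω (j + 1) v) ∂P := by
  have hK : Measurable fun p : ℝ≥0∞ × ℝ≥0∞ => ENNReal.ofReal l * frac (p.2 * p.1) :=
    measurable_mul measurable_const
      (measurable_frac.comp (measurable_mul measurable_snd measurable_fst))
  have hFl : Measurable fun t => F (l * t) := hF.comp (measurable_const_mul l)
  have key := hD.le_lintegral_expNeg_children v hK
    (w := fun x ω => D.backRate w₀ ω j (v ++ [x]))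
    (fun x => measurable_backRate_envBelow hw j _)
    (Ψ := fun t => 1 - expNeg (F (l * t)))
    (Measurable.sub measurable_const (measurable_expNeg.comp hFl)) ?_
  · rw [← levelExponent_comp_mul v.length hF hl]
    refine key.trans (le_of_eq (lintegral_congr fun ω => ?_))
    rw [Data.backRate, ← ENNReal.tsum_mul_left]
  · intro x t ht
    rw [one_sub_one_sub_expNeg]
    refine (hle x (l * t) (mul_pos hl ht)).trans (lintegral_mono fun ω => antitone_expNeg ?_)
    rw [ENNReal.ofReal_mul hl.le, mul_assoc, mul_comm (ENNReal.ofReal t)]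
    gcongr
    exact frac_le _

/-- For small `l` the transform of each child is bounded by 1 minus `l` times the mean of `frac`.
Writing `frac` as an average over an exponential `s` brings in the hypothesis at `u = s * t`, and
the average over `s` costs nothing by `lintegral_levelExponent_expMeasure_le`. -/
lemma le_lintegral_expNeg_backRate_linear (hD : D.IsGREM α P) (hpos : ∀ k, 0 < α k)
    (hlt : ∀ k, α k < 1)
    (hw : ∀ v, Measurable[D.algebraOf (envBelow v)] fun ω => w₀ ω v) (hF : Measurable F)
    (hle : ∀ x u, 0 < u →
      expNeg (F u) ≤ ∫⁻ ω, expNeg (ENNReal.ofReal u * D.backRate w₀ ω j (v ++ [x])) ∂P)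
    (l : ℝ) :
    expNeg (ENNReal.ofReal l * levelExponent α v.length F)
      ≤ ∫⁻ ω, expNeg (ENNReal.ofReal l * D.backRate w₀ ω (j + 1) v) ∂P := by
  have : IsProbabilityMeasure (expMeasure 1) := isProbabilityMeasure_expMeasure one_pos
  have hK : Measurable fun p : ℝ≥0∞ × ℝ≥0∞ => ENNReal.ofReal l * frac (p.2 * p.1) :=
    measurable_mul measurable_const
      (measurable_frac.comp (measurable_mul measurable_snd measurable_fst))
  have hF2 : Measurable fun p : ℝ × ℝ => 1 - expNeg (F (p.2 * p.1)) :=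
    Measurable.sub measurable_const (measurable_expNeg.comp
      (hF.comp (measurable_snd.mul measurable_fst)))
  have hint : Measurable fun t => ∫⁻ s, (1 - expNeg (F (s * t))) ∂(expMeasure 1) :=
    hF2.lintegral_prod_right'
  have key := hD.le_lintegral_expNeg_children v hK
    (w := fun x ω => D.backRate w₀ ω j (v ++ [x]))
    (fun x => measurable_backRate_envBelow hw j _)
    (Ψ := fun t => ENNReal.ofReal l * ∫⁻ s, (1 - expNeg (F (s * t))) ∂(expMeasure 1))
    (measurable_mul measurable_const hint) ?_
  · refine (antitone_expNeg ?_).trans (key.trans (le_of_eq (lintegral_congr fun ω => ?_)))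
    · rw [lintegral_const_mul _ hint]
      gcongr
      exact lintegral_levelExponent_expMeasure_le hpos hlt v.length hF
    · rw [Data.backRate, ← ENNReal.tsum_mul_left]
  · intro x t ht
    have hwm : Measurable fun ω => D.backRate w₀ ω j (v ++ [x]) :=
      (measurable_backRate_envBelow hw j _).mono (hD.algebraOf_le _) le_rfl
    have hfm : Measurable fun ω => frac (D.backRate w₀ ω j (v ++ [x]) * ENNReal.ofReal t) :=
      measurable_frac.comp (measurable_mul hwm measurable_const)
    refine le_trans (tsub_le_tsub_left ?_ 1)
      (one_sub_lintegral_le P (measurable_mul measurable_const hfm))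
    rw [lintegral_const_mul _ hfm]
    gcongr
    simp_rw [frac_eq_lintegral]
    rw [lintegral_lintegral_swap]
    · refine lintegral_mono_ae ?_
      filter_upwards [ae_expMeasure_pos] with s hs
      rw [lintegral_sub]
      · simp only [lintegral_const, measure_univ, mul_one]
        refine tsub_le_tsub_left ((hle x (s * t) (mul_pos hs ht)).trans
          (le_of_eq (lintegral_congr fun ω => ?_))) 1
        rw [ENNReal.ofReal_mul hs.le]
        ring_nf
      · exact measurable_expNeg.comp
          (measurable_mul (measurable_mul hwm measurable_const) measurable_const)
      · exact ne_top_of_le_ne_top ENNReal.one_ne_top (lintegral_expNeg_le_one P _)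
      · exact ae_of_all _ fun ω => expNeg_le_one _
    · refine Measurable.aemeasurable (Measurable.sub measurable_const (measurable_expNeg.comp ?_))
      exact measurable_mul (measurable_mul (hwm.comp measurable_fst) measurable_const)
        measurable_snd.ennreal_ofReal

end Step

/-! ### Iterated bounds for the rates -/

section

variable (hpos : ∀ k, 0 < α k) (hmono : StrictMono α) (hlt : ∀ k, α k < 1)

/-- The reciprocal of the bound for the rates obtained from `j + 1` levels. -/
noncomputable def rateDenom (α : ℕ → ℝ) (κ : ℝ) (n j : ℕ) : ℝ :=
  1 + κ * ∑ i ∈ Finset.range j, (1 - α (n + i + 1)) / (1 - α (n + i))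

/-- The recursion adds levels at the top, so the first term of the sum is split off, not the last.
-/
lemma rateDenom_succ (κ : ℝ) (n j : ℕ) :
    rateDenom α κ n (j + 1)
      = rateDenom α κ (n + 1) j + κ * ((1 - α (n + 1)) / (1 - α n)) := by
  unfold rateDenom
  rw [Finset.sum_range_succ']
  have : ∀ i, (1 - α (n + (i + 1) + 1)) / (1 - α (n + (i + 1)))
      = (1 - α (n + 1 + i + 1)) / (1 - α (n + 1 + i)) := by
    intro i
    rw [show n + (i + 1) = n + 1 + i by ring]
  simp_rw [this]
  simp only [add_zero]
  ring

include hlt in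
lemma one_le_rateDenom {κ : ℝ} (hκ : 0 ≤ κ) (n j : ℕ) : 1 ≤ rateDenom α κ n j := by
  unfold rateDenom
  have : 0 ≤ ∑ i ∈ Finset.range j, (1 - α (n + i + 1)) / (1 - α (n + i)) :=
    Finset.sum_nonneg fun i _ => div_nonneg (by linarith [hlt (n + i + 1)])
      (by linarith [hlt (n + i)])
  nlinarith [mul_nonneg hκ this]

include hpos hmono hlt in
-- The minimum of the power bound and the linear bound has again the form `minRpow`, and this
-- minimum creates the loss exploited at the next level. At the start the exponent of `W` is a pure
-- power, so the first level gives the constant 1 without loss; hence `j + 1` levels against `j`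
-- ratios.
lemma le_lintegral_expNeg_backRate_W (hD : D.IsGREM α P) (htend : Tendsto α atTop (𝓝 1))
    {κ : ℝ} (hκ0 : 0 ≤ κ) (hκ : ∀ k, κ ≤ α k / α (k + 1) * Real.exp (-1)) (j : ℕ) (v : List ℕ)
    {l : ℝ} (hl : 0 < l) :
    expNeg (minRpow ((1 / rateDenom α κ v.length j) ^ α v.length) (α v.length) l)
      ≤ ∫⁻ ω, expNeg (ENNReal.ofReal l * D.backRate (fun ω => D.W α ω) ω (j + 1) v) ∂P := by
  induction j generalizing v l with
  | zero =>
    have hF : Measurable fun u : ℝ => ENNReal.ofReal (u ^ α (v.length + 1)) := by fun_prop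
    have hle : ∀ x u, 0 < u → expNeg (ENNReal.ofReal (u ^ α (v.length + 1))) ≤
        ∫⁻ ω, expNeg (ENNReal.ofReal u * D.backRate (fun ω => D.W α ω) ω 0 (v ++ [x])) ∂P := by
      intro x u hu
      have := hD.le_lintegral_expNeg_W hpos hmono htend (v ++ [x]) hu.le
      simpa [Data.backRate] using this
    have h1 := hD.le_lintegral_expNeg_backRate_rpow (D.measurable_W_envBelow α) hF hle hl
    have h2 := hD.le_lintegral_expNeg_backRate_linear hpos hlt (D.measurable_W_envBelow α) hF hle l
    have e : levelExponent α v.length (fun u : ℝ => ENNReal.ofReal (u ^ α (v.length + 1))) = 1 :=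
      lintegral_intensity_rpow_succ hpos hmono v.length
    rw [e, mul_one] at h1 h2
    simp only [minRpow, rateDenom, Finset.range_zero, Finset.sum_empty, mul_zero, add_zero, div_one,
      Real.one_rpow, one_mul]
    rcases min_choice l (l ^ α v.length) with h | h
    · rwa [h]
    · rwa [h]
  | succ j ih =>
    set β := 1 / rateDenom α κ (v.length + 1) j with hβ
    have hd1 := one_le_rateDenom hlt hκ0 (v.length + 1) j
    have hβ0 : 0 < β := by rw [hβ]; positivity
    have hβ1 : β ≤ 1 := by rw [hβ, div_le_one (by linarith)]; exact hd1
    have hF := measurable_minRpow (β ^ α (v.length + 1)) (α (v.length + 1))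
    have hle : ∀ x u, 0 < u → expNeg (minRpow (β ^ α (v.length + 1)) (α (v.length + 1)) u) ≤
        ∫⁻ ω, expNeg (ENNReal.ofReal u * D.backRate (fun ω => D.W α ω) ω (j + 1) (v ++ [x])) ∂P := by
      intro x u hu
      have := ih (v ++ [x]) hu
      simpa [hβ] using this
    have h1 := hD.le_lintegral_expNeg_backRate_rpow (D.measurable_W_envBelow α) hF hle hl
    have h2 := hD.le_lintegral_expNeg_backRate_linear hpos hlt (D.measurable_W_envBelow α) hF hle l
    have h3 := levelExponent_minRpow_le hpos hmono hlt v.length hβ0 hβ1 hκ0 (hκ _)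
    have e : β / (1 + κ * ((1 - α (v.length + 1)) / (1 - α v.length)) * β)
        = 1 / rateDenom α κ v.length (j + 1) := by
      rw [rateDenom_succ, hβ]
      have : rateDenom α κ (v.length + 1) j ≠ 0 := by linarith
      field_simp
    rw [e] at h3
    have hb : 0 ≤ (1 / rateDenom α κ v.length (j + 1)) ^ α v.length := by
      have := one_le_rateDenom hlt hκ0 v.length (j + 1)
      positivity
    have hl' : 0 ≤ l ^ α v.length := Real.rpow_nonneg hl.le _
    unfold minRpow
    rw [ENNReal.ofReal_mul hb, mul_comm]
    rcases min_choice l (l ^ α v.length) with h | h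
    · rw [h]; exact (antitone_expNeg (by gcongr)).trans h2
    · rw [h]; exact (antitone_expNeg (by gcongr)).trans h1

include hpos hmono hlt in
-- A crude companion for the unadjusted clocks, where `C` may depend on the levels: all that matters
-- is that the exponent vanishes as `c` tends to 0. At the bottom level the exponent is finite
-- because `α n < 1`.
lemma exists_le_lintegral_expNeg_backRate_const (hD : D.IsGREM α P) (j n : ℕ) :
    ∃ C : ℝ, 0 < C ∧ ∀ v : List ℕ, v.length = n → ∀ c l : ℝ, 0 < c → 0 < l →
      expNeg (ENNReal.ofReal (C * (c * l) ^ α n)) ≤ ∫⁻ ω, expNeg (ENNReal.ofReal l *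
        D.backRate (fun _ _ => ENNReal.ofReal c) ω (j + 1) v) ∂P := by
  have hwm : ∀ (c : ℝ) (v : List ℕ), Measurable[D.algebraOf (envBelow v)]
      fun _ : Ω => ENNReal.ofReal c := fun c v => measurable_const
  induction j generalizing n with
  | zero =>
    have e0 : levelExponent α n (fun u : ℝ => ENNReal.ofReal u)
        = ENNReal.ofReal (intensityConst α n / α n * Real.Gamma (1 - α n / 1)) := by
      rw [← lintegral_intensity_rpow hpos hmono n (hlt n)]
      simp [levelExponent]
    refine ⟨intensityConst α n / α n * Real.Gamma (1 - α n / 1), ?_, ?_⟩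
    · have := intensityConst_pos hpos hmono n
      have := hpos n
      have := Real.Gamma_pos_of_pos (s := 1 - α n / 1) (by linarith [hlt n])
      positivity
    · intro v hv c l hc hl
      have hF : Measurable fun u : ℝ => ENNReal.ofReal (c * u) := by fun_prop
      have h1 := hD.le_lintegral_expNeg_backRate_rpow (w₀ := fun _ _ => ENNReal.ofReal c)
        (v := v) (j := 0) (F := fun u => ENNReal.ofReal (c * u)) (hwm c) hF (fun x u hu => by
          simp only [Data.backRate, lintegral_const, measure_univ, mul_one]
          rw [ENNReal.ofReal_mul hc.le, mul_comm]) hl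
      rw [hv, levelExponent_comp_mul n ENNReal.measurable_ofReal hc, e0,
        ← ENNReal.ofReal_mul (by positivity), ← ENNReal.ofReal_mul (by positivity)] at h1
      rw [Real.mul_rpow hc.le hl.le]
      convert h1 using 3
      ring
  | succ j ih =>
    obtain ⟨C, hC, h⟩ := ih (n + 1)
    refine ⟨C ^ (α n / α (n + 1)), Real.rpow_pos_of_pos hC _, ?_⟩
    intro v hv c l hc hl
    have hF : Measurable fun u : ℝ => ENNReal.ofReal (C * (c * u) ^ α (n + 1)) := by fun_prop
    have h1 := hD.le_lintegral_expNeg_backRate_rpow (v := v) (hwm c) hF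
      (fun x u hu => h (v ++ [x]) (by simp [hv]) c u hc hu) hl
    have hFC : Measurable fun u : ℝ => ENNReal.ofReal (C * u ^ α (n + 1)) := by fun_prop
    have e : levelExponent α n (fun u : ℝ => ENNReal.ofReal (C * u ^ α (n + 1)))
        = ENNReal.ofReal (C ^ (α n / α (n + 1))) := lintegral_intensity_mul_rpow hpos hmono n hC
    rw [hv, levelExponent_comp_mul n hFC hc, e,
      ← ENNReal.ofReal_mul (by positivity), ← ENNReal.ofReal_mul (by positivity)] at h1
    rw [Real.mul_rpow hc.le hl.le]
    convert h1 using 3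
    ring

end

end Data.IsGREM

/-! ### Averaging over one level -/

lemma measurableSet_ne_fun {E : Type*} {m : MeasurableSpace E} {f g : E → ℝ} (hf : Measurable f)
    (hg : Measurable g) : MeasurableSet {a | f a ≠ g a} :=
  (measurableSet_eq_fun hf hg).compl

lemma tsum_lintegral_frac_clockRate {w : List ℕ → ℕ → ℝ≥0∞} {X : ℝ≥0∞ → List ℕ∞}
    (hX : Measurable X) (r : ℝ≥0∞) :
    ∑' x, ∫⁻ s in Ioi 0, frac (clockRate w X r x s)
      = ∫⁻ s in Ioi 0, (if ENNReal.ofReal s ≤ r then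
          extendFun (fun v => ∑' x, frac (w v x)) (X (ENNReal.ofReal s)) else 0) := by
  have hm : ∀ x, Measurable fun s => frac (clockRate w X r x s) := fun x =>
    measurable_frac.comp (measurable_clockRate hX r x)
  rw [← lintegral_tsum fun x => (hm x).aemeasurable]
  refine lintegral_congr fun s => ?_
  unfold clockRate extendFun extendWeight
  split_ifs <;> simp

namespace Data

variable {Ω : Type*} (D : Data Ω)

/-- The clock of level `n`, with the parameters multiplied by the weights `w₀`, at the time to
which the first `n` clocks send `t`. -/
noncomputable def clockAt (w₀ : Ω → List ℕ → ℝ≥0∞) (n : ℕ) (t : ℝ≥0∞) (ω : Ω) : ℝ≥0∞ :=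
  clockOf (fun v x => w₀ ω (v ++ [x]) * D.g ω v x) (fun x i => D.σ n x i ω)
    (fun x i => D.T n x i ω) (D.X ω n) (D.clockComp ω 0 n t)

/-- The rates of the vertices of a level which arise from averaging over the next level. -/
noncomputable def nextRate (w₀ : Ω → List ℕ → ℝ≥0∞) (ω : Ω) (v : List ℕ) : ℝ≥0∞ :=
  ∑' x, frac (w₀ ω (v ++ [x]) * D.g ω v x)

lemma adjustedθ_zero (α : ℕ → ℝ) (ω : Ω) (n : ℕ) (t : ℝ≥0∞) :
    D.adjustedθ α ω 0 n t = D.clockAt (fun ω => D.W α ω) n t ω := by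
  unfold adjustedθ adjustedΞ clockAt
  simp

lemma clockComp_zero_succ (ω : Ω) (n : ℕ) (t : ℝ≥0∞) :
    D.clockComp ω 0 (n + 1) t = D.Ξ ω n (D.clockComp ω 0 n t) := by
  simp [clockComp]

lemma clockComp_zero_succ' (ω : Ω) (n : ℕ) (t : ℝ≥0∞) :
    D.clockComp ω 0 (n + 1) t = D.clockAt (fun _ _ => 1) n t ω := by
  rw [clockComp_zero_succ]
  simp [clockAt, Ξ]

lemma measurable_X_history (n : ℕ) :
    Measurable[(D.algebraOf (history n)).prod inferInstance]
      fun p : Ω × ℝ≥0∞ => D.X p.1 n p.2 :=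
  D.measurable_X (fun _ x => D.measurable_γ_algebraOf (S := history n) trivial x)
    (fun j hj x i => D.measurable_σ_algebraOf (S := history n) (k := j) (x := x) hj i)
    fun j hj x i => D.measurable_T_algebraOf (S := history n) (k := j) (x := x) (i := i) hj

lemma measurable_clockComp_history (n : ℕ) (t : ℝ≥0∞) :
    Measurable[D.algebraOf (history n)] fun ω => D.clockComp ω 0 n t :=
  D.measurable_clockComp (fun _ x => D.measurable_γ_algebraOf (S := history n) trivial x)
    (fun j hj x i => D.measurable_σ_algebraOf (S := history n) (k := j) (x := x) hj i)
    (fun j hj x i => D.measurable_T_algebraOf (S := history n) (k := j) (x := x) (i := i) hj) t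

lemma measurable_g_history (n : ℕ) (v : List ℕ) (x : ℕ) :
    Measurable[D.algebraOf (history n)] fun ω => D.g ω v x :=
  ENNReal.measurable_ofReal.comp (D.measurable_γ_algebraOf (S := history n) trivial x)

lemma measurable_clockAt_history {w₀ : Ω → List ℕ → ℝ≥0∞}
    (hw : ∀ v, Measurable[D.algebraOf (history 0)] fun ω => w₀ ω v) (n : ℕ) (t : ℝ≥0∞) :
    Measurable[D.algebraOf (history (n + 1))] (D.clockAt w₀ n t) := by
  have hle : ∀ j, j ≤ n + 1 → D.algebraOf (history j) ≤ D.algebraOf (history (n + 1)) :=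
    fun j hj => D.algebraOf_mono (monotone_history hj)
  have h0 : n < n + 1 := n.lt_succ_self
  refine measurable_clockOf (m := D.algebraOf (history (n + 1)))
    (w := fun ω v x => w₀ ω (v ++ [x]) * D.g ω v x)
    (fun v x => measurable_mul ((hw _).mono (hle 0 (Nat.zero_le _)) le_rfl)
      (D.measurable_g_history _ v x)) ?_ ?_ ?_ ?_
  · exact fun x i => D.measurable_σ_algebraOf (S := history (n + 1)) (k := n) (x := x) h0 i
  · exact fun x i => D.measurable_T_algebraOf (S := history (n + 1)) (k := n) (x := x) (i := i) h0
  · exact (D.measurable_X_history n).mono (sup_le_sup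
      (MeasurableSpace.comap_mono (hle n (Nat.le_succ n))) le_rfl) le_rfl
  · exact (D.measurable_clockComp_history n t).mono (hle n (Nat.le_succ n)) le_rfl

section

variable {D} {w₀ : Ω → List ℕ → ℝ≥0∞}
  (hw : ∀ v, Measurable[D.algebraOf (history 0)] fun ω => w₀ ω v)

include hw in
lemma measurable_weight_history (n : ℕ) (v : List ℕ) (x : ℕ) :
    Measurable[D.algebraOf (history n)] fun ω => w₀ ω (v ++ [x]) * D.g ω v x :=
  measurable_mul ((hw _).mono (D.algebraOf_mono (monotone_history (Nat.zero_le n))) le_rfl)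
    (D.measurable_g_history n v x)

include hw in
lemma measurable_backRate_history (j : ℕ) (v : List ℕ) :
    Measurable[D.algebraOf (history 0)] fun ω => D.backRate w₀ ω j v :=
  D.measurable_backRate w₀ j
    (fun _ x => D.measurable_γ_algebraOf (S := history 0) trivial x) fun _ => hw _

end

end Data

namespace Data.IsGREM

variable {Ω : Type*} [m0 : MeasurableSpace Ω] {P : Measure Ω} [IsProbabilityMeasure P]
  {D : Data Ω} {α : ℕ → ℝ}

lemma ae_σ_pos (hD : D.IsGREM α P) : ∀ᵐ ω ∂P, ∀ k x i, 0 < D.σ k x i ω := by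
  rw [ae_all_iff]; intro k
  rw [ae_all_iff]; intro x
  have h0 : (volume.restrict (Ioi (0 : ℝ))) (Iic 0) = 0 := by
    rw [Measure.restrict_apply measurableSet_Iic, Iic_inter_Ioi, Ioc_self, measure_empty]
  filter_upwards [(hD.poisson_σ k x).ae_notMem measurableSet_Iic h0] with ω hω i
  simpa using hω i

/-- With one process frozen, the other almost surely avoids any given point. -/
lemma ae_σ_ne (hD : D.IsGREM α P) (k : ℕ) {x y : ℕ} (hxy : x ≠ y) (i j : ℕ) :
    ∀ᵐ ω ∂P, D.σ k x i ω ≠ D.σ k y j ω := by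
  have hd : Disjoint ({Source.marks k x} : Set Source) {Source.marks k y} := by
    simpa using hxy
  refine ae_diag_of_indep (S := {p | D.σ k x i p.1 ≠ D.σ k y j p.2}) (hD.algebraOf_le _)
    (hD.algebraOf_le _) (hD.indep_algebraOf hd) ?_ fun ω => ?_
  · refine measurableSet_ne_fun ?_ ?_
    · exact (D.measurable_σ_algebraOf (S := {Source.marks k x}) rfl i).comp
        (@measurable_fst _ _ (D.algebraOf {Source.marks k x}) (D.algebraOf {Source.marks k y}))
    · exact (D.measurable_σ_algebraOf (S := {Source.marks k y}) rfl j).comp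
        (@measurable_snd _ _ (D.algebraOf {Source.marks k x}) (D.algebraOf {Source.marks k y}))
  · have h0 : (volume.restrict (Ioi (0 : ℝ))) {D.σ k x i ω} = 0 := by
      rw [Measure.restrict_apply (measurableSet_singleton _)]
      exact measure_mono_null inter_subset_left (measure_singleton _)
    filter_upwards [(hD.poisson_σ k y).ae_notMem (measurableSet_singleton _) h0] with ω' hω'
    have := hω' j
    simp only [mem_singleton_iff] at this
    exact fun h => this h.symm

lemma ae_σ_injective (hD : D.IsGREM α P) :
    ∀ᵐ ω ∂P, ∀ k, Function.Injective fun p : ℕ × ℕ => D.σ k p.1 p.2 ω := by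
  have h1 : ∀ᵐ ω ∂P, ∀ k x y i j, x ≠ y → D.σ k x i ω ≠ D.σ k y j ω := by
    simp only [ae_all_iff]
    exact fun k x y i j hxy => hD.ae_σ_ne k hxy i j
  have h2 : ∀ᵐ ω ∂P, ∀ k x, StrictMono fun i => D.σ k x i ω := by
    simp only [ae_all_iff]
    exact hD.strictMono_σ
  filter_upwards [h1, h2] with ω hω1 hω2 k
  rintro ⟨x, i⟩ ⟨y, j⟩ h
  by_cases hxy : x = y
  · subst hxy
    exact congrArg (Prod.mk x) ((hω2 k x).injective h)
  · exact absurd h (hω1 k x y i j hxy)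

/-- Averaging over the Poisson and exponential variables of a level, given the history. -/
theorem setLIntegral_expNeg_clockOf (hD : D.IsGREM α P) (n : ℕ) {w : Ω → List ℕ → ℕ → ℝ≥0∞}
    (hw : ∀ v x, Measurable[D.algebraOf (history n)] fun ω => w ω v x) {R : Ω → ℝ≥0∞}
    (hR : Measurable[D.algebraOf (history n)] R) {A : Set Ω}
    (hA : MeasurableSet[D.algebraOf (history n)] A) :
    ∫⁻ ω in A, expNeg (clockOf (w ω) (fun x i => D.σ n x i ω) (fun x i => D.T n x i ω)
        (D.X ω n) (R ω)) ∂P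
      = ∫⁻ ω in A, expNeg (∫⁻ s in Ioi 0, (if ENNReal.ofReal s ≤ R ω then
          extendFun (fun v => ∑' x, frac (w ω v x)) (D.X ω n (ENNReal.ofReal s)) else 0)) ∂P := by
  set S₁ := history n
  set S₂ := levelNoise n
  have hA0 : MeasurableSet A := hD.algebraOf_le S₁ _ hA
  have hind : ∀ F : Ω → ℝ≥0∞, ∫⁻ ω in A, F ω ∂P = ∫⁻ ω, A.indicator 1 ω * F ω ∂P := by
    intro F
    rw [← lintegral_indicator hA0]
    refine lintegral_congr fun ω => ?_
    by_cases h : ω ∈ A <;> simp [h]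
  have hf : @Measurable _ _ ((D.algebraOf S₁).prod (D.algebraOf S₂)) (D.algebraOf S₁)
      (Prod.fst : Ω × Ω → Ω) := @measurable_fst _ _ (D.algebraOf S₁) (D.algebraOf S₂)
  have hs : @Measurable _ _ ((D.algebraOf S₁).prod (D.algebraOf S₂)) (D.algebraOf S₂)
      (Prod.snd : Ω × Ω → Ω) := @measurable_snd _ _ (D.algebraOf S₁) (D.algebraOf S₂)
  have hX := D.measurable_X_history n
  have hH : Measurable[(D.algebraOf S₁).prod (D.algebraOf S₂)] fun p : Ω × Ω =>
      A.indicator 1 p.1 * expNeg (clockOf (w p.1) (fun x i => D.σ n x i p.2)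
        (fun x i => D.T n x i p.2) (D.X p.1 n) (R p.1)) := by
    refine measurable_mul ?_ (measurable_expNeg.comp ?_)
    · exact (Measurable.indicator measurable_const hA).comp hf
    · refine measurable_clockOf (m := (D.algebraOf S₁).prod (D.algebraOf S₂))
        (w := fun p => w p.1) (fun v x => (hw v x).comp hf)
        (fun x i => ?_) (fun x i => ?_) ?_ (hR.comp hf)
      · exact (D.measurable_σ_algebraOf (S := S₂) (k := n) (x := x) rfl i).comp hs
      · exact (D.measurable_T_algebraOf (S := S₂) (k := n) (x := x) (i := i) rfl).comp hs
      · exact hX.comp ((hf.comp measurable_fst).prodMk measurable_snd)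
  -- Path, weights, final time and event depend on the history only; marks and holding variables are
  -- independent of it. For a frozen history the clock is driven by a deterministic path.
  rw [hind, hind, lintegral_diag_of_indep (hD.algebraOf_le S₁) (hD.algebraOf_le S₂)
    (hD.indep_algebraOf (disjoint_history_levelNoise n)) hH]
  refine lintegral_congr fun ω => ?_
  simp only []
  have hXω : Measurable (D.X ω n) := hX.comp (@measurable_prodMk_left _ _ (D.algebraOf S₁) _ ω)
  rw [lintegral_const_mul' _ _ (by by_cases h : ω ∈ A <;> simp [h]),
    hD.lintegral_expNeg_clockOf n (w ω) hXω (R ω), tsum_lintegral_frac_clockRate hXω]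

section

variable {w₀ : Ω → List ℕ → ℝ≥0∞}
  (hw : ∀ v, Measurable[D.algebraOf (history 0)] fun ω => w₀ ω v)

include hw in
-- Averaging over level `n + 1` leaves an integral of `nextRate` along the path up to `Ξ_n` of the
-- current time, and the occupation formula rewrites it as a clock of level `n`. The localisation to
-- `A` is what the submartingale argument needs.
lemma setLIntegral_clockAt_le (hD : D.IsGREM α P) (n : ℕ) (t : ℝ≥0∞) {A : Set Ω}
    (hA : MeasurableSet[D.algebraOf (history (n + 1))] A) :
    ∫⁻ ω in A, expNeg (D.clockAt (D.nextRate w₀) n t ω) ∂P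
      ≤ ∫⁻ ω in A, expNeg (D.clockAt w₀ (n + 1) t ω) ∂P := by
  unfold clockAt
  rw [hD.setLIntegral_expNeg_clockOf (n + 1)
    (w := fun ω v x => w₀ ω (v ++ [x]) * D.g ω v x)
    (fun v x => measurable_weight_history hw (n + 1) v x)
    (D.measurable_clockComp_history (n + 1) t) hA]
  refine lintegral_mono_ae (ae_restrict_of_ae ?_)
  filter_upwards [hD.ae_σ_pos, hD.ae_σ_injective] with ω h1 h2
  rw [D.clockComp_zero_succ]
  exact antitone_expNeg (occupation_le (h1 n) (h2 n) (D.nextRate w₀ ω) _)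

include hw in
lemma lintegral_clockAt_eq (hD : D.IsGREM α P) (n : ℕ) (t : ℝ≥0∞)
    (hfin : ∀ᵐ ω ∂P, D.clockComp ω 0 (n + 1) t ≠ ∞) :
    ∫⁻ ω, expNeg (D.clockAt w₀ (n + 1) t ω) ∂P
      = ∫⁻ ω, expNeg (D.clockAt (D.nextRate w₀) n t ω) ∂P := by
  unfold clockAt
  rw [← setLIntegral_univ, hD.setLIntegral_expNeg_clockOf (n + 1)
    (w := fun ω v x => w₀ ω (v ++ [x]) * D.g ω v x)
    (fun v x => measurable_weight_history hw (n + 1) v x)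
    (D.measurable_clockComp_history (n + 1) t) MeasurableSet.univ, setLIntegral_univ]
  refine lintegral_congr_ae ?_
  filter_upwards [hD.ae_σ_pos, hD.ae_σ_injective, hfin] with ω h1 h2 h3
  rw [D.clockComp_zero_succ] at h3 ⊢
  exact congrArg expNeg (occupation_eq (h1 n) (h2 n) (D.nextRate w₀ ω) h3)

include hw in
-- At level 0 the driving path stays at the root, so the averaged rate is constant in time.
lemma lintegral_clockAt_zero (hD : D.IsGREM α P) (t : ℝ≥0∞) :
    ∫⁻ ω, expNeg (D.clockAt w₀ 0 t ω) ∂P = ∫⁻ ω, expNeg (t * D.nextRate w₀ ω []) ∂P := by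
  unfold clockAt
  rw [← setLIntegral_univ, hD.setLIntegral_expNeg_clockOf 0
    (w := fun ω v x => w₀ ω (v ++ [x]) * D.g ω v x)
    (fun v x => measurable_weight_history hw 0 v x)
    (D.measurable_clockComp_history 0 t) MeasurableSet.univ, setLIntegral_univ]
  refine lintegral_congr fun ω => congrArg expNeg ?_
  rw [setLIntegral_le_eq_lt]
  have h1 : ∀ s : ℝ, (if ENNReal.ofReal s < D.clockComp ω 0 0 t then
      extendFun (fun v => ∑' x, frac (w₀ ω (v ++ [x]) * D.g ω v x)) (D.X ω 0 (ENNReal.ofReal s))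
        else 0) = {s : ℝ | ENNReal.ofReal s < t}.indicator (fun _ => D.nextRate w₀ ω []) s := by
    intro s
    by_cases h : ENNReal.ofReal s < t
    · simp [h, Data.clockComp, Data.X, extendFun, extendWeight, Data.nextRate]
    · simp [h, Data.clockComp]
  have hm : MeasurableSet {s : ℝ | ENNReal.ofReal s < t} :=
    measurableSet_lt ENNReal.measurable_ofReal measurable_const
  simp_rw [h1]
  rw [lintegral_indicator_const hm, Measure.restrict_apply hm, mul_comm]
  congr 1
  have h2 := volume_ofReal_mem_Ico 0 t
  rw [tsub_zero] at h2
  refine Eq.trans (congrArg volume ?_) h2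
  ext s
  simp [and_comm]

include hw in
lemma lintegral_backRate_le (hD : D.IsGREM α P) (j n : ℕ) (t : ℝ≥0∞) :
    ∫⁻ ω, expNeg (t * D.backRate w₀ ω (j + n + 1) []) ∂P
      ≤ ∫⁻ ω, expNeg (D.clockAt (fun ω => D.backRate w₀ ω j) n t ω) ∂P := by
  induction n generalizing j with
  | zero => exact (hD.lintegral_clockAt_zero (measurable_backRate_history hw j) t).ge
  | succ n ih =>
    have h1 := hD.setLIntegral_clockAt_le (measurable_backRate_history hw j) n t
      (A := univ) MeasurableSet.univ
    rw [setLIntegral_univ, setLIntegral_univ] at h1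
    refine le_trans ?_ h1
    have := ih (j + 1)
    rwa [show j + 1 + n + 1 = j + (n + 1) + 1 by ring] at this

include hw in
lemma lintegral_backRate_eq (hD : D.IsGREM α P) (j n : ℕ) (t : ℝ≥0∞)
    (hfin : ∀ᵐ ω ∂P, ∀ k, D.clockComp ω 0 k t ≠ ∞) :
    ∫⁻ ω, expNeg (D.clockAt (fun ω => D.backRate w₀ ω j) n t ω) ∂P
      = ∫⁻ ω, expNeg (t * D.backRate w₀ ω (j + n + 1) []) ∂P := by
  induction n generalizing j with
  | zero => exact hD.lintegral_clockAt_zero (measurable_backRate_history hw j) t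
  | succ n ih =>
    rw [hD.lintegral_clockAt_eq (measurable_backRate_history hw j) n t
      (hfin.mono fun ω h => h _)]
    have := ih (j + 1)
    rwa [show j + 1 + n + 1 = j + (n + 1) + 1 by ring] at this

end

end Data.IsGREM

/-! ### Long time behaviour of the clocks -/

lemma ae_eq_zero_of_one_le_lintegral_expNeg {Ω : Type*} [MeasurableSpace Ω] {P : Measure Ω}
    [IsProbabilityMeasure P] {Y : Ω → ℝ≥0∞}
    (h : 1 ≤ ∫⁻ ω, expNeg (Y ω) ∂P) : ∀ᵐ ω ∂P, Y ω = 0 := by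
  have h1 : (fun ω => expNeg (Y ω)) =ᵐ[P] fun _ => 1 :=
    ae_eq_of_ae_le_of_lintegral_le (ae_of_all _ fun ω => expNeg_le_one _)
      (ne_top_of_le_ne_top ENNReal.one_ne_top (lintegral_expNeg_le_one P Y)) aemeasurable_const
      (by simpa using h)
  filter_upwards [h1] with ω hω
  exact expNeg_injective (hω.trans expNeg_zero.symm)

/-- By dominated convergence the mean of `expNeg` of the limit is at least 1, which forces the limit
to vanish. -/
lemma ae_tendsto_zero_of_le_lintegral_expNeg {Ω : Type*} [MeasurableSpace Ω] {P : Measure Ω}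
    [IsProbabilityMeasure P] {Y : ℕ → Ω → ℝ≥0∞} (hY : ∀ n, Measurable (Y n))
    (hlim : ∀ᵐ ω ∂P, ∃ y, Tendsto (fun n => Y n ω) atTop (𝓝 y)) {L : ℕ → ℝ≥0∞}
    (hL : Tendsto L atTop (𝓝 1)) (hLY : ∀ n, L n ≤ ∫⁻ ω, expNeg (Y n ω) ∂P) :
    ∀ᵐ ω ∂P, Tendsto (fun n => Y n ω) atTop (𝓝 0) := by
  have h0 : ∀ᵐ ω ∂P, Tendsto (fun n => Y n ω) atTop (𝓝 (limsup (fun n => Y n ω) atTop)) := by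
    filter_upwards [hlim] with ω ⟨y, hy⟩
    rwa [hy.limsup_eq]
  have h1 : Tendsto (fun n => ∫⁻ ω, expNeg (Y n ω) ∂P) atTop
      (𝓝 (∫⁻ ω, expNeg (limsup (fun n => Y n ω) atTop) ∂P)) := by
    refine tendsto_lintegral_of_dominated_convergence (fun _ => 1)
      (fun n => measurable_expNeg.comp (hY n)) (fun n => ae_of_all _ fun ω => expNeg_le_one _)
      (by simp) ?_
    filter_upwards [h0] with ω hω
    exact (continuous_expNeg.tendsto _).comp hω
  filter_upwards [h0, ae_eq_zero_of_one_le_lintegral_expNeg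
    (le_of_tendsto_of_tendsto' hL h1 hLY)] with ω hω h2
  rwa [h2] at hω

lemma clockOf_mono {w w' : List ℕ → ℕ → ℝ≥0∞} (h : ∀ v x, w v x ≤ w' v x) (σ T : ℕ → ℕ → ℝ)
    (X : ℝ≥0∞ → List ℕ∞) (t : ℝ≥0∞) : clockOf w σ T X t ≤ clockOf w' σ T X t := by
  refine ENNReal.tsum_le_tsum fun x => ENNReal.tsum_le_tsum fun i => ?_
  unfold extendWeight
  split_ifs
  · simp
  · exact mul_le_mul_left (h _ x) _
  · simp

lemma clockOf_const_mul (c : ℝ≥0∞) (w : List ℕ → ℕ → ℝ≥0∞) (σ T : ℕ → ℕ → ℝ)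
    (X : ℝ≥0∞ → List ℕ∞) (t : ℝ≥0∞) :
    clockOf (fun v x => c * w v x) σ T X t = c * clockOf w σ T X t := by
  simp only [clockOf, ← ENNReal.tsum_mul_left]
  refine tsum_congr fun x => tsum_congr fun i => ?_
  unfold extendWeight
  split_ifs <;> simp [mul_assoc]

namespace Data

variable {Ω : Type*} (D : Data Ω)

lemma clockAt_const (c : ℝ≥0∞) (n : ℕ) (t : ℝ≥0∞) (ω : Ω) :
    D.clockAt (fun _ _ => c) n t ω = c * D.clockAt (fun _ _ => 1) n t ω := by
  unfold clockAt
  rw [clockOf_const_mul]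
  simp

lemma monotone_clockComp (ω : Ω) (k m : ℕ) : Monotone (D.clockComp ω k m) := by
  induction m with
  | zero => exact monotone_id
  | succ m ih => exact (D.monotone_Ξ ω (k + m)).comp ih

lemma clockComp_add (ω : Ω) (k m : ℕ) (t : ℝ≥0∞) :
    D.clockComp ω 0 (k + m) t = D.clockComp ω k m (D.clockComp ω 0 k t) := by
  induction m with
  | zero => rfl
  | succ m ih =>
    rw [← add_assoc, clockComp_zero_succ, ih]
    rfl

/-- The clocks from level 0 are those from level `k` evaluated at the image of `r` under the first
`k` clocks; all maps are monotone. -/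
lemma adjustedθ_le (α : ℕ → ℝ) (ω : Ω) (k m : ℕ) {t r : ℝ≥0∞} (h : t ≤ D.clockComp ω 0 k r) :
    D.adjustedθ α ω k m t ≤ D.adjustedθ α ω 0 (k + m) r := by
  have h1 : D.adjustedθ α ω 0 (k + m) r = D.adjustedθ α ω k m (D.clockComp ω 0 k r) := by
    simp only [adjustedθ, Function.comp_apply, zero_add, clockComp_add]
  rw [h1]
  exact ((monotone_clockOf _ _ _ _).comp (D.monotone_clockComp ω k m)) h

lemma backRate_ne_zero {w₀ : Ω → List ℕ → ℝ≥0∞} {ω : Ω} (hw : ∀ v, w₀ ω v ≠ 0)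
    (hγ : ∀ v x, 0 < D.γ v x ω) (j : ℕ) (v : List ℕ) : D.backRate w₀ ω j v ≠ 0 := by
  induction j generalizing v with
  | zero => exact hw v
  | succ j ih =>
    simp only [backRate, ne_eq, ENNReal.tsum_eq_zero, not_forall]
    refine ⟨0, frac_pos (mul_ne_zero (ih _) ?_)⟩
    simpa [g] using hγ v 0

end Data

namespace Data.IsGREM

variable {Ω : Type*} [m0 : MeasurableSpace Ω] {P : Measure Ω} [IsProbabilityMeasure P]
  {D : Data Ω} {α : ℕ → ℝ} (hpos : ∀ k, 0 < α k) (hmono : StrictMono α) (hlt : ∀ k, α k < 1)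

include hpos hmono hlt in
-- If the clock were infinite with positive probability, multiplying it by a small `c` would not
-- bring its Laplace transform close to 1, against the bound with exponent `C * (c * l) ^ α 0`.
lemma ae_clockComp_ne_top (hD : D.IsGREM α P) {l : ℝ} (hl : 0 < l) :
    ∀ᵐ ω ∂P, ∀ k, D.clockComp ω 0 k (ENNReal.ofReal l) ≠ ∞ := by
  rw [ae_all_iff]
  intro k
  rcases k with _ | n
  · exact ae_of_all _ fun ω => ENNReal.ofReal_ne_top
  obtain ⟨C, hC, hbound⟩ := hD.exists_le_lintegral_expNeg_backRate_const hpos hmono hlt n 0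
  have hle : ∀ c : ℝ, 0 < c → expNeg (ENNReal.ofReal (C * (c * l) ^ α 0))
      ≤ ∫⁻ ω, expNeg (ENNReal.ofReal c * D.clockComp ω 0 (n + 1) (ENNReal.ofReal l)) ∂P := by
    intro c hc
    have h1 := hD.lintegral_backRate_le (w₀ := fun _ _ => ENNReal.ofReal c)
      (fun v => measurable_const) 0 n (ENNReal.ofReal l)
    rw [zero_add] at h1
    refine (hbound [] rfl c l hc hl).trans (h1.trans_eq (lintegral_congr fun ω => ?_))
    rw [D.clockComp_zero_succ']
    exact congrArg expNeg (D.clockAt_const _ _ _ _)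
  -- `∞` times the indicator of an infinite clock is at most `c` times the clock, for every `c > 0`.
  have hind : ∀ c : ℝ, 0 < c → ∫⁻ ω, expNeg (ENNReal.ofReal c *
      D.clockComp ω 0 (n + 1) (ENNReal.ofReal l)) ∂P
        ≤ ∫⁻ ω, expNeg (∞ * {ω | D.clockComp ω 0 (n + 1) (ENNReal.ofReal l) = ∞}.indicator
          1 ω) ∂P := by
    intro c hc
    refine lintegral_mono fun ω => antitone_expNeg ?_
    by_cases h : D.clockComp ω 0 (n + 1) (ENNReal.ofReal l) = ∞ <;> simp [h, hc]
  have htend : Tendsto (fun m : ℕ => expNeg (ENNReal.ofReal (C * (1 / ((m : ℝ) + 1) * l) ^ α 0)))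
      atTop (𝓝 1) := by
    rw [← expNeg_zero]
    refine (continuous_expNeg.tendsto _).comp ?_
    rw [← ENNReal.ofReal_zero]
    refine ENNReal.tendsto_ofReal ?_
    have h1 : Tendsto (fun m : ℕ => 1 / ((m : ℝ) + 1) * l) atTop (𝓝 0) := by
      simpa using tendsto_one_div_add_atTop_nhds_zero_nat.mul_const l
    have h2 := (h1.rpow_const (p := α 0) (Or.inr (hpos 0).le)).const_mul C
    rwa [Real.zero_rpow (hpos 0).ne', mul_zero] at h2
  have hone := le_of_tendsto' htend fun m =>
    (hle _ (by positivity)).trans (hind (1 / ((m : ℝ) + 1)) (by positivity))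
  filter_upwards [ae_eq_zero_of_one_le_lintegral_expNeg hone] with ω hω h
  simp [h] at hω

include hpos hmono hlt in
-- Finiteness makes the averaging an identity: the clock at time `N + 1` has the Laplace transform
-- of `N + 1` times the root rate. That rate is almost surely nonzero, so the transforms tend to 0.
lemma ae_iSup_clockComp (hD : D.IsGREM α P) :
    ∀ᵐ ω ∂P, ∀ k, ⨆ N : ℕ, D.clockComp ω 0 k (ENNReal.ofReal (N + 1)) = ∞ := by
  rw [ae_all_iff]
  intro k
  have hunb : ∀ b : ℝ≥0∞, b ≠ 0 →
      Tendsto (fun N : ℕ => ENNReal.ofReal ((N : ℝ) + 1) * b) atTop (𝓝 ∞) := by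
    intro b hb
    have h1 : Tendsto (fun N : ℕ => ENNReal.ofReal ((N : ℝ) + 1)) atTop (𝓝 ∞) :=
      ENNReal.tendsto_ofReal_atTop.comp
        (tendsto_atTop_add_const_right _ _ tendsto_natCast_atTop_atTop)
    have h2 := ENNReal.Tendsto.mul_const (b := b) h1 (Or.inl ENNReal.top_ne_zero)
    rwa [ENNReal.top_mul hb] at h2
  rcases k with _ | n
  · refine ae_of_all _ fun ω => iSup_eq_of_tendsto ?_ ?_
    · intro N M h
      exact ENNReal.ofReal_le_ofReal (by gcongr)
    · exact (hunb 1 one_ne_zero).congr fun N => mul_one _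
  have hw1 : ∀ v, Measurable[D.algebraOf (history 0)] fun ω : Ω => (fun _ _ => 1 :
      Ω → List ℕ → ℝ≥0∞) ω v := fun v => measurable_const
  have heq : ∀ N : ℕ, ∫⁻ ω, expNeg (D.clockComp ω 0 (n + 1) (ENNReal.ofReal (N + 1))) ∂P
      = ∫⁻ ω, expNeg (ENNReal.ofReal (N + 1) * D.backRate (fun _ _ => 1) ω (n + 1) []) ∂P := by
    intro N
    have h1 := hD.lintegral_backRate_eq hw1 0 n (ENNReal.ofReal (N + 1))
      (hD.ae_clockComp_ne_top hpos hmono hlt (by positivity))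
    rw [zero_add] at h1
    rw [← h1]
    exact lintegral_congr fun ω => congrArg expNeg (D.clockComp_zero_succ' ω n _)
  have htend : Tendsto (fun N : ℕ => ∫⁻ ω, expNeg (ENNReal.ofReal ((N : ℝ) + 1) *
      D.backRate (fun _ _ => 1) ω (n + 1) []) ∂P) atTop (𝓝 (∫⁻ _ω, 0 ∂P)) := by
    refine tendsto_lintegral_of_dominated_convergence (fun _ => 1) (fun N => ?_)
      (fun N => ae_of_all _ fun ω => expNeg_le_one _) (by simp) ?_
    · exact measurable_expNeg.comp (((measurable_backRate_history hw1 (n + 1) []).mono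
        (hD.algebraOf_le _) le_rfl).const_mul _)
    · filter_upwards [hD.ae_γ_pos] with ω hω
      rw [← expNeg_top]
      exact (continuous_expNeg.tendsto _).comp
        (hunb _ (D.backRate_ne_zero (fun _ => one_ne_zero) hω _ _))
  rw [lintegral_zero] at htend
  have hz : ∫⁻ ω, expNeg (⨆ N : ℕ, D.clockComp ω 0 (n + 1) (ENNReal.ofReal (N + 1))) ∂P = 0 := by
    refine le_antisymm (ge_of_tendsto' htend fun N => ?_) zero_le
    rw [← heq N]
    exact lintegral_mono fun ω => antitone_expNeg (le_iSup_of_le N le_rfl)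
  have hm : Measurable fun ω => ⨆ N : ℕ, D.clockComp ω 0 (n + 1) (ENNReal.ofReal (N + 1)) :=
    Measurable.iSup fun N =>
      (D.measurable_clockComp_history (n + 1) _).mono (hD.algebraOf_le _) le_rfl
  filter_upwards [(lintegral_eq_zero_iff (measurable_expNeg.comp hm)).1 hz] with ω hω
  exact expNeg_eq_zero.1 hω

include hpos hmono in
/-- The adjusted clocks at a fixed time form, after `expNeg`, a submartingale. -/
lemma ae_exists_tendsto_adjustedθ (hD : D.IsGREM α P) (htend : Tendsto α atTop (𝓝 1))
    (t : ℝ≥0∞) : ∀ᵐ ω ∂P, ∃ y, Tendsto (fun n => D.adjustedθ α ω 0 n t) atTop (𝓝 y) := by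
  simp only [D.adjustedθ_zero]
  have hw : ∀ v, Measurable[D.algebraOf (history 0)] fun ω => (fun ω => D.W α ω) ω v := fun v =>
    D.measurable_W (fun u x => D.measurable_γ_algebraOf (S := history 0) trivial x) α
  refine ae_exists_tendsto_of_submartingale (Y := fun n => D.clockAt (fun ω => D.W α ω) n t)
    (ℱ := fun n => D.algebraOf (history (n + 1)))
    (fun n m h => D.algebraOf_mono (monotone_history (by gcongr))) (fun n => hD.algebraOf_le _)
    (fun n => D.measurable_clockAt_history hw n t) fun n A hA => ?_
  -- Averaging replaces `W` by `nextRate W`, which is at most `W`; a smaller clock has a larger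
  -- `expNeg`.
  refine le_trans (lintegral_mono_ae (ae_restrict_of_ae ?_)) (hD.setLIntegral_clockAt_le hw n t hA)
  filter_upwards [hD.ae_tsum_W_le hpos hmono htend] with ω hω
  refine antitone_expNeg (clockOf_mono (fun v x => mul_le_mul_left ?_ _) _ _ _ _)
  exact (ENNReal.tsum_le_tsum fun y => frac_le _).trans (hω _)

include hpos hmono hlt in
lemma ae_tendsto_adjustedθ_zero (hD : D.IsGREM α P) (htend : Tendsto α atTop (𝓝 1))
    (hratio : ¬ Summable fun k => (1 - α (k + 1)) / (1 - α k)) {l : ℝ} (hl : 0 < l) :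
    ∀ᵐ ω ∂P, Tendsto (fun n => D.adjustedθ α ω 0 n (ENNReal.ofReal l)) atTop (𝓝 0) := by
  have hw : ∀ v, Measurable[D.algebraOf (history 0)] fun ω => (fun ω => D.W α ω) ω v := fun v =>
    D.measurable_W (fun u x => D.measurable_γ_algebraOf (S := history 0) trivial x) α
  -- One constant for all levels: `α k / α (k + 1) ≥ α 0`, because `α k ≥ α 0` and `α (k + 1) < 1`.
  set κ := α 0 * Real.exp (-1) with hκdef
  have hκ0 : 0 < κ := mul_pos (hpos 0) (Real.exp_pos _)
  have hκ : ∀ k, κ ≤ α k / α (k + 1) * Real.exp (-1) := by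
    intro k
    refine mul_le_mul_of_nonneg_right ?_ (Real.exp_pos _).le
    rw [le_div_iff₀ (hpos _)]
    nlinarith [hpos 0, hlt (k + 1), hmono.monotone (Nat.zero_le k)]
  have hden : Tendsto (rateDenom α κ 0) atTop atTop := by
    have h1 := (not_summable_iff_tendsto_nat_atTop_of_nonneg fun k =>
      div_nonneg (sub_nonneg.2 (hlt (k + 1)).le) (sub_nonneg.2 (hlt k).le)).1 hratio
    have h2 := tendsto_atTop_add_const_left _ 1 (h1.const_mul_atTop hκ0)
    refine h2.congr fun j => ?_
    simp [rateDenom]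
  have hL : Tendsto (fun n => expNeg (minRpow ((1 / rateDenom α κ 0 n) ^ α 0) (α 0) l)) atTop
      (𝓝 1) := by
    rw [← expNeg_zero]
    refine (continuous_expNeg.tendsto _).comp ?_
    unfold minRpow
    rw [← ENNReal.ofReal_zero]
    refine ENNReal.tendsto_ofReal ?_
    have h1 : Tendsto (fun n => 1 / rateDenom α κ 0 n) atTop (𝓝 0) := by
      simp only [one_div]
      exact hden.inv_tendsto_atTop
    have h2 := (h1.rpow_const (p := α 0) (Or.inr (hpos 0).le)).mul_const (min l (l ^ α 0))
    rwa [Real.zero_rpow (hpos 0).ne', zero_mul] at h2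
  refine ae_tendsto_zero_of_le_lintegral_expNeg (fun n => ?_)
    (hD.ae_exists_tendsto_adjustedθ hpos hmono htend _) hL fun n => ?_
  · simp only [D.adjustedθ_zero]
    exact (D.measurable_clockAt_history hw n _).mono (hD.algebraOf_le _) le_rfl
  · have h1 := hD.lintegral_backRate_le hw 0 n (ENNReal.ofReal l)
    rw [zero_add] at h1
    refine (hD.le_lintegral_expNeg_backRate_W hpos hmono hlt htend hκ0.le hκ n [] hl).trans
      (h1.trans_eq (lintegral_congr fun ω => ?_))
    rw [D.adjustedθ_zero]
    rfl

include hpos hmono hlt in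
-- Integer starting times suffice for one null set to serve all `k` and `t`: almost surely some `N +
-- 1` is sent beyond `t` by the first `k` clocks.
lemma ae_forall_tendsto_adjustedθ_zero (hD : D.IsGREM α P) (htend : Tendsto α atTop (𝓝 1))
    (hratio : ¬ Summable fun k => (1 - α (k + 1)) / (1 - α k)) :
    ∀ᵐ ω ∂P, ∀ (k : ℕ) (t : ℝ≥0), Tendsto (fun m => D.adjustedθ α ω k m t) atTop (𝓝 0) := by
  have h0 : ∀ᵐ ω ∂P, ∀ N : ℕ,
      Tendsto (fun n => D.adjustedθ α ω 0 n (ENNReal.ofReal (N + 1))) atTop (𝓝 0) :=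
    ae_all_iff.2 fun N =>
      hD.ae_tendsto_adjustedθ_zero hpos hmono hlt htend hratio (by positivity)
  filter_upwards [h0, hD.ae_iSup_clockComp hpos hmono hlt] with ω h1 h2 k t
  obtain ⟨N, hN⟩ := lt_iSup_iff.1 (ENNReal.coe_lt_top.trans_eq (h2 k).symm : (t : ℝ≥0∞) < _)
  refine tendsto_of_tendsto_of_tendsto_of_le_of_le tendsto_const_nhds
    ((h1 N).comp (tendsto_add_atTop_nat k)) (fun _ => zero_le) fun m => ?_
  simpa [add_comm] using D.adjustedθ_le α ω k m hN.le

end Data.IsGREM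

end KTree

/-! ### The limit clock exists and vanishes -/

theorem mainTheorem4 {Ω : Type*} [MeasurableSpace Ω] (P : Measure Ω) [IsProbabilityMeasure P]
    (α : ℕ → ℝ) (hα_pos : 0 < α 0) (hα_mono : StrictMono α) (hα_lt : ∀ k, α k < 1)
    (D : KTree.Data Ω) (hD : D.IsGREM α P)
    (hsum : Summable fun k => 1 - α k)
    (hratio : ¬ Summable fun k => (1 - α (k + 1)) / (1 - α k)) :
    ∀ k : ℕ, D.IsLimitClock α P k (D.limitθ α k) ∧
      (∀ θ : Ω → ℝ≥0 → ℝ≥0∞, D.IsLimitClock α P k θ →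
        ∀ t : ℝ≥0, ∀ᵐ ω ∂P, θ ω t = 0) := by
  have hpos : ∀ k, 0 < α k := fun k => hα_pos.trans_le (hα_mono.monotone (Nat.zero_le k))
  have htend : Tendsto α atTop (𝓝 1) := by
    simpa using hsum.tendsto_atTop_zero.const_sub 1
  have hlim := hD.ae_forall_tendsto_adjustedθ_zero hpos hα_mono hα_lt htend hratio
  intro k
  constructor
  · have hzero : ∀ᵐ ω ∂P, ∀ t, D.limitθ α k ω t = 0 := by
      filter_upwards [hlim] with ω hω t
      -- Any time after `t` would do, since every `limsup` in the infimum is 0.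
      refine le_antisymm ((iInf₂_le (t + 1) (by simp)).trans ?_) zero_le
      exact (hω k (t + 1)).limsup_eq.le
    constructor
    · filter_upwards [hzero] with ω hω
      have h0 : D.limitθ α k ω = fun _ => 0 := funext hω
      rw [h0]
      exact ⟨fun t => ENNReal.zero_ne_top, monotone_const, fun t => continuousWithinAt_const⟩
    · obtain ⟨S, hSc, hSd⟩ := TopologicalSpace.exists_countable_dense ℝ≥0
      refine ⟨S, hSc, hSd, fun t _ => ?_⟩
      filter_upwards [hlim, hzero] with ω h1 h2
      rw [h2 t]
      exact h1 k t
  · rintro θ ⟨hreg, S, -, hSd, hS⟩ t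
    -- A version is tied to the clocks only on `S`; monotonicity carries the value 0 from a later
    -- point of `S` back to `t`.
    obtain ⟨s, hsS, hts⟩ := hSd.exists_gt t
    filter_upwards [hlim, hreg, hS s hsS] with ω h1 h2 h3
    have h4 : θ ω s = 0 := tendsto_nhds_unique h3 (h1 k s)
    exact le_antisymm ((h2.2.1 hts.le).trans h4.le) zero_le
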